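/- Let $\gamma$ be a closed polygon in the plane $\mathbb R^2=\mathbb C$ with $N\ge 3$ sides $E_1,\dots,E_N$, embedded (nondegenerate sides, consecutive sides meeting only in their common vertex, all other sides disjoint). *Rectangles.* A labeled rectangle is a quadruple $R=(R_0,R_1,R_2,R_3)$ listing the vertices of a nondegenerate rectangle in counterclockwise order; its aspect ratio is $\rho(R)=|R_2-R_1|/|R_1-R_0|\in(0,\infty)$, and it is a square when $\rho(R)=1$. Let $I(\gamma)\subset\mathbb R^8$ be the space of labeled rectangles with all four vertices on $\gamma$. Cyclic relabeling gives an action of $\mathbb Z/4$ on $I(\gamma)$. *The class $\mathcal P$.* An associated quad of $\gamma$ is a quadruple $L=(L_0,L_1,L_2,L_3)$ of lines extending sides of $\gamma$, in any order, at least three of which come from distinct sides. It is generic if its distinct lines are in general position (no two parallel, no three concurrent) and for every $\rho>0$ there is at most one labeled rectangle $R_\rho$ of aspect ratio $\rho$ with $k$-th vertex on $L_k$ for $k=0,1,2,3$. A singular image of the $k$-th vertex map of $L$ is a point $\phi_k(b)$ with $\phi_k'(b)=0$, where $\phi_k(\rho)$ is the $k$-th vertex of $R_\rho$. Then $\gamma\in\mathcal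 P$ means: no two sides of $\gamma$ are parallel, and 1. every associated quad is generic; 2. no inscribed rectangle has more than one vertex in common with $\gamma$, that is, at most one vertex of the rectangle is a vertex of the polygon; 3. no vertex of an inscribed square is a vertex of the polygon; 4. no vertex of $\gamma$ is a singular image with respect to an associated quad. *Components.* A connected component $A$ of $I(\gamma)$ is hyperbolic if it is homeomorphic to an open arc and $\rho$ tends to $0$ towards one end of $A$ and to $\infty$ towards the other end. It is elliptic if it is mapped to itself by the $\mathbb Z/4$-action. Unlabeled inscribed squares, hyperbolic components and elliptic components are the $\mathbb Z/4$-orbits of labeled ones. **Statement.** For every $\gamma\in\mathcal P$, the number $\Omega(\gamma)$ of unlabeled inscribed squares, the number $\Omega_H(\gamma)$ of unlabeled hyperbolic components and the number $\Omega_E(\gamma)$ of unlabeled elliptic components are finite, and $$\Omega(\gamma)+\Omega_H(\gamma)+\Omega_E(\gamma)\equiv 0 \pmod 2 .$$ -/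

import Mathlib

open scoped Topology

namespace InscribedRect

/-! ### Labeled rectangles -/

/-- `R` lists the vertices of a nondegenerate rectangle in the plane, in counterclockwise order
around the rectangle, such that second side divided by first side is `ρ`. -/
def IsRectangle (ρ : ℝ) (R : Fin 4 → ℂ) : Prop :=
  0 < ρ ∧ R 0 ≠ R 1 ∧ R 2 - R 1 = Complex.I * ρ * (R 1 - R 0) ∧ R 3 - R 0 = R 2 - R 1

/-- Length of the second side divided by the length of the first side. -/
noncomputable def aspectRatio (R : Fin 4 → ℂ) : ℝ := ‖R 2 - R 1‖ / ‖R 1 - R 0‖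

/-- The action of `ℤ/4` on labeled quadruples by cyclic relabeling. -/
def relabel (j : Fin 4) (R : Fin 4 → ℂ) : Fin 4 → ℂ := fun k => R (k + j)

/-! ### Quadruples of lines -/

/-- The counterclockwise rectangles of aspect ratio `ρ` whose `k`-th vertex lies on `L k`. -/
def rectanglesOn (L : Fin 4 → AffineSubspace ℝ ℂ) (ρ : ℝ) : Set (Fin 4 → ℂ) :=
  {R | IsRectangle ρ R ∧ ∀ k, R k ∈ L k}

/-- The distinct lines among `L 0, L 1, L 2, L 3` are in general position, and for each aspect
ratio there is at most one rectangle whose `k`-th vertex lies on `L k`. -/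
def IsGenericQuad (L : Fin 4 → AffineSubspace ℝ ℂ) : Prop :=
  (∀ j k, L j ≠ L k → ¬ AffineSubspace.Parallel (L j) (L k)) ∧
  (∀ i j k, L i ≠ L j → L j ≠ L k → L i ≠ L k → ∀ z, ¬ (z ∈ L i ∧ z ∈ L j ∧ z ∈ L k)) ∧
  ∀ ρ : ℝ, 0 < ρ → (rectanglesOn L ρ).Subsingleton

/-- `z` is a singular image for the `k`-th vertex map of `L`: if `φ b` denotes the rectangle of
aspect ratio `b` on `L` (it is unique when `L` is generic), then `z = φ b k` for some `b` at which
the derivative of the `k`-th vertex with respect to the aspect ratio vanishes. -/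
def IsSingularImage (L : Fin 4 → AffineSubspace ℝ ℂ) (k : Fin 4) (z : ℂ) : Prop :=
  ∃ b : ℝ, 0 < b ∧ ∃ φ : ℝ → Fin 4 → ℂ, (∀ᶠ ρ in 𝓝 b, φ ρ ∈ rectanglesOn L ρ) ∧
    HasDerivAt (fun ρ => φ ρ k) 0 b ∧ φ b k = z

/-! ### Polygons -/

variable {N : ℕ}

/-- The closed polygon is embedded: its edges are nondegenerate, consecutive edges meet only in
their common vertex, and all other pairs of edges are disjoint. -/
def IsSimple (P : Polygon ℂ N) : Prop :=
  P.HasNondegenerateEdges ∧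
  (∀ i, P.edgeSet ℝ i ∩ P.edgeSet ℝ (finRotate N i) = {P (finRotate N i)}) ∧
  ∀ i j, j ≠ i → j ≠ finRotate N i → i ≠ finRotate N j →
    Disjoint (P.edgeSet ℝ i) (P.edgeSet ℝ j)

/-- The line that extends the `i`-th side. -/
noncomputable def sideLine (P : Polygon ℂ N) (i : Fin N) : AffineSubspace ℝ ℂ :=
  line[ℝ, P i, P (finRotate N i)]

/-- The space `I(γ)` of labeled rectangles inscribed in the polygon (as a subset of
`ℂ⁴ = ℝ⁸`). -/
def inscribed (P : Polygon ℂ N) : Set (Fin 4 → ℂ) :=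
  {R | (∃ ρ, IsRectangle ρ R) ∧ ∀ k, R k ∈ P.boundary ℝ}

/-- A quadruple of sides, in any order, at least three of which are distinct. (All orders are
allowed, so it suffices to look at counterclockwise rectangles on such quadruples.) -/
def IsAssociated (e : Fin 4 → Fin N) : Prop := 3 ≤ (Set.range e).ncard

/-- The class `𝒫` of generic polygons: embedded, no two sides parallel, all associated quadruples
generic, no inscribed rectangle with more than one vertex at a vertex of the polygon, no inscribed
square with a vertex at a vertex of the polygon, and no vertex of the polygon a singular image. -/
structure IsGenericPolygon (P : Polygon ℂ N) : Prop where
  simple : IsSimple P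
  not_parallel : ∀ i j, i ≠ j → ¬ AffineSubspace.Parallel (sideLine P i) (sideLine P j)
  generic_quad : ∀ e : Fin 4 → Fin N, IsAssociated e → IsGenericQuad fun k => sideLine P (e k)
  rectangle_vertex : ∀ R ∈ inscribed P, ∀ j k, R j ∈ Set.range P.vertices →
    R k ∈ Set.range P.vertices → j = k
  square_vertex : ∀ R ∈ inscribed P, aspectRatio R = 1 → ∀ k, R k ∉ Set.range P.vertices
  regular_vertex : ∀ e : Fin 4 → Fin N, IsAssociated e → ∀ (k : Fin 4) (i : Fin N),
    ¬ IsSingularImage (fun k => sideLine P (e k)) k (P i)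

/-! ### Components and counts -/

/-- `A` is a connected component of `I(γ)`. -/
def IsComponent (P : Polygon ℂ N) (A : Set (Fin 4 → ℂ)) : Prop :=
  ∃ R ∈ inscribed P, A = connectedComponentIn (inscribed P) R

/-- A component that is an (open) arc such that the aspect ratio tends to `0` towards one end
and to `∞` towards the other end. -/
def IsHyperbolic (P : Polygon ℂ N) (A : Set (Fin 4 → ℂ)) : Prop :=
  IsComponent P A ∧ ∃ h : ℝ ≃ₜ A,
    Filter.Tendsto (fun t => aspectRatio (h t)) Filter.atBot (𝓝 0) ∧
    Filter.Tendsto (fun t => aspectRatio (h t)) Filter.atTop Filter.atTop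

/-- A component that is stabilized by the relabeling action. -/
def IsElliptic (P : Polygon ℂ N) (A : Set (Fin 4 → ℂ)) : Prop :=
  IsComponent P A ∧ ∀ j, relabel j '' A = A

/-- The orbit of a labeled rectangle under relabeling. -/
def rectangleOrbit (R : Fin 4 → ℂ) : Set (Fin 4 → ℂ) := Set.range fun j => relabel j R

/-- The orbit of a set of labeled rectangles under relabeling. -/
def componentOrbit (A : Set (Fin 4 → ℂ)) : Set (Set (Fin 4 → ℂ)) :=
  Set.range fun j => relabel j '' A

/-- The unlabeled inscribed squares. -/
def unlabeledSquares (P : Polygon ℂ N) : Set (Set (Fin 4 → ℂ)) :=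
  rectangleOrbit '' {R | R ∈ inscribed P ∧ aspectRatio R = 1}

/-- The unlabeled hyperbolic components. -/
def unlabeledHyperbolic (P : Polygon ℂ N) : Set (Set (Set (Fin 4 → ℂ))) :=
  componentOrbit '' {A | IsHyperbolic P A}

/-- The unlabeled elliptic components. -/
def unlabeledElliptic (P : Polygon ℂ N) : Set (Set (Set (Fin 4 → ℂ))) :=
  componentOrbit '' {A | IsElliptic P A}

end InscribedRect

/-! Replace the aspect ratio by $t=(\rho-1)/(\rho+1)\in(-1,1)$. Squares sit at $t=0$, and cyclic
relabeling changes the sign of $t$. Rectangles with vertices on four given side lines satisfy a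
linear system that is affine in $t$. On an associated quad, genericity makes this system nonsingular
wherever it has a solution with $|t|<1$, so the rectangles form a rational curve with parameter $t$.
The inscribed ones are those whose four coordinates on the sides lie in $[0,1]$.

Only finitely many values of $t$ belong to inscribed rectangles that use a vertex of $\gamma$.
Cutting $(-1,1)$ there decomposes $I(\gamma)$ into finitely many arcs, each a section of $t$ over a
gap. Where a rectangle meets a vertex of $\gamma$, the two sides at that vertex give two quads. The
rectangle curve of each quad crosses the end of its side with nonzero speed, hence continues to
exactly one side of $t$. So exactly two arcs meet at each cut rectangle
(`IsGenericPolygon.exists_germs`), and $I(\gamma)$ is a finite disjoint union of paths and cycles of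
arcs (`IsGenericPolygon.arcSystem`). The free ends of the paths lie over $t=\pm1$.

Squares on a component are the arcs that cross $t=0$. On a path their number is odd exactly when its
two ends lie over $-1$ and $1$, that is, when the path is hyperbolic. On a cycle it is even.
Relabeling is free on rectangles and on arcs, and so is its square; hence neither maps a path to
itself, and on a cycle that they preserve they act as rotations. If relabeling preserves a cycle, a
quarter turn joins opposite signs of $t$ and contains an odd number of squares, so the cycle carries
$4\cdot$odd. If only its square does, a half turn joins equal signs and the number is divisible by
$4$ (`ArcSystem.Symmetry.component_zeros`).

Now count labeled squares modulo $8$ by orbits of components. A hyperbolic orbit has four components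
with an odd number each; an elliptic orbit is one component with $4$ modulo $8$; every other orbit
contributes $0$ (`IsGenericPolygon.orbit_count`). Each unlabeled square has four labelings, so
$4\Omega\equiv4(\Omega_H+\Omega_E)$ modulo $8$. -/

namespace InscribedRect

/-! ### Chains of flags

A finite set of flags with two involutions: `r` passes to the other end of the same piece, and `j`
passes to the other piece at the same end (and fixes a flag at a free end). -/

section Dihedral

variable {F : Type*} {r j : Equiv.Perm F}

/-- Walk along a piece and step over to the next one. -/
def step (r j : Equiv.Perm F) : Equiv.Perm F := j * r

lemma step_apply (x : F) : step r j x = j (r x) := rfl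

/-- Two involutions generate a dihedral group: conjugation by `r` inverts the rotation `j * r`. -/
lemma comm_step_zpow (hr : ∀ x, r (r x) = x) (hj : ∀ x, j (j x) = x) (i : ℤ) (x : F) :
    r ((step r j ^ i) x) = (step r j ^ (-i)) (r x) := by
  have hr' : r⁻¹ = r := by
    ext x; rw [Equiv.Perm.inv_eq_iff_eq, hr]
  have hj' : j⁻¹ = j := by
    ext x; rw [Equiv.Perm.inv_eq_iff_eq, hj]
  have h : r * step r j * r⁻¹ = (step r j)⁻¹ := by
    ext x; simp [step, hr', hj', hr]
  have h2 : r * step r j ^ i * r⁻¹ = step r j ^ (-i) := by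
    rw [← conj_zpow, h, inv_zpow, zpow_neg]
  rw [← h2]
  simp

lemma jump_step_zpow (hr : ∀ x, r (r x) = x) (hj : ∀ x, j (j x) = x) (i : ℤ) (x : F) :
    j ((step r j ^ i) x) = (step r j ^ (-i)) (j x) := by
  have h1 : ∀ y, j y = step r j (r y) := fun y => by rw [step_apply, hr]
  rw [h1, comm_step_zpow hr hj, h1, ← Equiv.Perm.mul_apply, ← Equiv.Perm.mul_apply (_ ^ _),
    ← zpow_one_add, ← zpow_add_one, add_comm]

/-- The opposite flag of the same piece is not on the walk, if the walk meets no free end. -/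
lemma opposite_ne_step (hr : ∀ x, r (r x) = x) (hj : ∀ x, j (j x) = x) (hrx : ∀ x, r x ≠ x) {d : F}
    (hd : ∀ i : ℤ, j ((step r j ^ i) d) ≠ (step r j ^ i) d) (m : ℤ) :
    r d ≠ (step r j ^ m) d := by
  intro h
  -- A reflection of the walk has a centre. For even `m` it is the middle of a piece, which `r`
  -- would fix; for odd `m` it is a junction, which `j` would fix.
  obtain ⟨i, hi | hi⟩ := Int.even_or_odd' m
  · apply hrx ((step r j ^ i) d)
    rw [comm_step_zpow hr hj, h, ← Equiv.Perm.mul_apply, ← zpow_add]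
    congr 2; omega
  · apply hd (i + 1)
    have : j d = (step r j ^ (m + 1)) d := by
      rw [add_comm, zpow_one_add, Equiv.Perm.mul_apply, ← h, step_apply, hr]
    rw [jump_step_zpow hr hj, this, ← Equiv.Perm.mul_apply, ← zpow_add]
    congr 2; omega

section Free

variable {g : F → F}

lemma map_step_zpow (hgr : ∀ x, g (r x) = r (g x)) (hgj : ∀ x, g (j x) = j (g x)) (i : ℤ) (x : F) :
    g ((step r j ^ i) x) = (step r j ^ i) (g x) := by
  have h1 : ∀ x, g (step r j x) = step r j (g x) := fun x => by simp [step_apply, hgr, hgj]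
  have h2 : ∀ x, g ((step r j)⁻¹ x) = (step r j)⁻¹ (g x) := fun x => by
    rw [eq_comm, Equiv.Perm.inv_eq_iff_eq, ← h1, ← Equiv.Perm.mul_apply, mul_inv_cancel, Equiv.Perm.one_apply]
  induction i using Int.induction_on generalizing x with
  | zero => simp
  | succ i ih => rw [zpow_add_one, Equiv.Perm.mul_apply, ih, h1, Equiv.Perm.mul_apply]
  | pred i ih => rw [zpow_sub_one, Equiv.Perm.mul_apply, ih, h2, Equiv.Perm.mul_apply]

/-- A free symmetry does not reverse a walk. -/
lemma map_ne_opposite_step (hr : ∀ x, r (r x) = x) (hj : ∀ x, j (j x) = x)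
    (hgr : ∀ x, g (r x) = r (g x)) (hgj : ∀ x, g (j x) = j (g x))
    (hg1 : ∀ x, g x ≠ r x) (hg2 : ∀ x, g x ≠ j x) (d : F) (k : ℤ) :
    g d ≠ r ((step r j ^ k) d) := by
  intro h
  -- The symmetry would reflect the walk. At the centre of the reflection it would agree with `r` on
  -- a piece or with `j` at a junction, according to the parity of `k`.
  have key : ∀ i : ℤ, g ((step r j ^ i) d) = r ((step r j ^ (k - i)) d) := fun i => by
    rw [map_step_zpow hgr hgj, h, comm_step_zpow hr hj, comm_step_zpow hr hj,
      ← Equiv.Perm.mul_apply, ← zpow_add]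
    congr 2; omega
  obtain ⟨i, hi | hi⟩ := Int.even_or_odd' k
  · apply hg1 ((step r j ^ i) d)
    rw [key]; congr 3; omega
  · apply hg2 (r ((step r j ^ i) d))
    rw [hgr, key, hr, ← step_apply, show k - i = 1 + i by omega, zpow_one_add]; rfl

lemma step_zpow_eq_iff (d : F) (i : ℤ) :
    (step r j ^ i) d = d ↔ (Function.minimalPeriod (step r j) d : ℤ) ∣ i := by
  rw [← Equiv.Perm.smul_def, MulAction.zpow_smul_eq_iff_minimalPeriod_dvd]
  rfl

lemma step_zpow_eq_zpow_iff (d : F) (i k : ℤ) :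
    (step r j ^ i) d = (step r j ^ k) d ↔ (Function.minimalPeriod (step r j) d : ℤ) ∣ i - k := by
  rw [← step_zpow_eq_iff, sub_eq_neg_add, zpow_add, Equiv.Perm.mul_apply, zpow_neg,
    Equiv.Perm.inv_eq_iff_eq]

lemma minimalPeriod_step_pos [Finite F] (d : F) : 0 < Function.minimalPeriod (step r j) d := by
  apply Function.minimalPeriod_pos_of_mem_periodicPts
  have h := isOfFinOrder_of_finite (step r j)
  rw [isOfFinOrder_iff_pow_eq_one] at h
  obtain ⟨n, hn, h⟩ := h
  refine ⟨n, hn, ?_⟩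
  rw [Function.IsPeriodicPt, Function.IsFixedPt, ← Equiv.Perm.coe_pow, h]; rfl

/-- Two flags on a walk without free ends that belong to the same piece are equal. -/
lemma cycle_piece_eq_iff (hr : ∀ x, r (r x) = x) (hj : ∀ x, j (j x) = x) (hrx : ∀ x, r x ≠ x) {d : F}
    (hd : ∀ i : ℤ, j ((step r j ^ i) d) ≠ (step r j ^ i) d) (i k : ℤ) :
    ((step r j ^ k) d = (step r j ^ i) d ∨ (step r j ^ k) d = r ((step r j ^ i) d)) ↔
      (Function.minimalPeriod (step r j) d : ℤ) ∣ k - i := by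
  rw [step_zpow_eq_zpow_iff, or_iff_left]
  rw [comm_step_zpow hr hj]
  intro h
  apply opposite_ne_step hr hj hrx hd (k + i)
  rw [← Equiv.Perm.inv_eq_iff_eq, ← zpow_neg, neg_neg, ← Equiv.Perm.mul_apply, ← zpow_add] at h
  rw [← h, add_comm]

section Path

variable (hr : ∀ x, r (r x) = x) (hj : ∀ x, j (j x) = x) {d : F} (hd : j d = d)
include hr hj hd

/-- Since `j` fixes `d`, the flag `r d` is the predecessor of `d`. So the walk turns round at a free
end and contains both flags of each of its pieces. -/
lemma path_opposite (i : ℤ) : r ((step r j ^ i) d) = (step r j ^ (-i - 1)) d := by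
  have : r d = (step r j)⁻¹ d := by
    rw [eq_comm, Equiv.Perm.inv_eq_iff_eq, step_apply, hr, hd]
  rw [comm_step_zpow hr hj, zpow_sub_one, Equiv.Perm.mul_apply, this]

lemma path_jump (i : ℤ) : j ((step r j ^ i) d) = (step r j ^ (-i)) d := by
  rw [jump_step_zpow hr hj, hd]

/-- The walk from a free end comes back from the other free end. -/
lemma path_even [Finite F] (hrx : ∀ x, r x ≠ x) :
    ∃ l : ℕ, 0 < l ∧ Function.minimalPeriod (step r j) d = 2 * l := by
  obtain ⟨l, hl | hl⟩ := Nat.even_or_odd' (Function.minimalPeriod (step r j) d)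
  · refine ⟨l, ?_, hl⟩
    have := minimalPeriod_step_pos (r := r) (j := j) d
    omega
  · exfalso
    apply hrx ((step r j ^ (l : ℤ)) d)
    rw [path_opposite hr hj hd, step_zpow_eq_zpow_iff, hl]
    exact ⟨-1, by push_cast; ring⟩

/-- `j` sends index `i` to `-i`, so a fixed flag means that the period `2 * l` divides `2 * i`. Up
to the period, the free ends have the indices `0` and `l` only. -/
lemma path_end_iff {l : ℕ} (hl : Function.minimalPeriod (step r j) d = 2 * l) (i : ℤ) :
    j ((step r j ^ i) d) = (step r j ^ i) d ↔ (l : ℤ) ∣ i := by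
  rw [path_jump hr hj hd, step_zpow_eq_zpow_iff, hl, show -i - i = 2 * (-i) by ring, Nat.cast_mul,
    Nat.cast_ofNat, mul_dvd_mul_iff_left two_ne_zero, dvd_neg]

lemma path_piece_eq_iff {l : ℕ} (hl : Function.minimalPeriod (step r j) d = 2 * l) (i k : ℤ)
    (hi : 0 ≤ i ∧ i < l) (hk : 0 ≤ k ∧ k < l) :
    ((step r j ^ k) d = (step r j ^ i) d ∨ (step r j ^ k) d = r ((step r j ^ i) d)) ↔ k = i := by
  rw [path_opposite hr hj hd, step_zpow_eq_zpow_iff, step_zpow_eq_zpow_iff, hl]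
  constructor
  · rintro (h | h)
    · have := Int.eq_zero_of_abs_lt_dvd h (by rw [abs_lt]; push_cast; omega)
      omega
    · have := Int.eq_zero_of_abs_lt_dvd h (by rw [abs_lt]; push_cast; omega)
      omega
  · rintro rfl; simp

lemma path_piece_cover {l : ℕ} (hl : Function.minimalPeriod (step r j) d = 2 * l) (hl0 : 0 < l)
    (i : ℤ) : ∃ k : ℕ, k < l ∧
      ((step r j ^ i) d = (step r j ^ (k : ℤ)) d ∨ (step r j ^ i) d = r ((step r j ^ (k : ℤ)) d)) := by
  have h0 : (0 : ℤ) < 2 * l := by omega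
  have h1 := Int.emod_nonneg i h0.ne'
  have h2 := Int.emod_lt_of_pos i h0
  have h3 : (step r j ^ i) d = (step r j ^ (i % (2 * l))) d := by
    rw [step_zpow_eq_zpow_iff, hl]
    push_cast
    exact Int.dvd_self_sub_emod
  rw [h3]
  generalize i % (2 * l) = m at h1 h2
  by_cases h : m < l
  · exact ⟨m.toNat, by omega, Or.inl (by rw [Int.toNat_of_nonneg h1])⟩
  -- On the way back, index `m` runs over the piece that index `2l - 1 - m` passed on the way out.
  · refine ⟨(2 * l - 1 - m).toNat, by omega, Or.inr ?_⟩
    rw [Int.toNat_of_nonneg (by omega), path_opposite hr hj hd, step_zpow_eq_zpow_iff, hl]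
    exact ⟨1, by push_cast; ring⟩

/-- A free symmetry does not preserve a walk between two free ends. -/
lemma path_map_ne (hgr : ∀ x, g (r x) = r (g x)) (hgj : ∀ x, g (j x) = j (g x))
    (hg1 : ∀ x, g x ≠ r x) (hg2 : ∀ x, g x ≠ j x) (k : ℤ) : g d ≠ (step r j ^ k) d := by
  intro h
  apply map_ne_opposite_step hr hj hgr hgj hg1 hg2 d (-k - 1)
  rw [path_opposite hr hj hd, h]
  congr 2; omega

end Path

end Free

end Dihedral

end InscribedRect


/-! ### Counting sign changes along a walk. -/

namespace InscribedRect

section Crossings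

open Finset

variable {F : Type*} {r j : Equiv.Perm F} {v : F → Prop}

open Classical in
/-- `1` if the two ends of the piece of the flag `x` lie on different sides, else `0`. -/
noncomputable def crossing (r : Equiv.Perm F) (v : F → Prop) (x : F) : ℕ :=
  if v x ↔ v (r x) then 0 else 1

/-- The number of crossings among the first `k` pieces of a walk. -/
noncomputable def crossingsUpTo (r j : Equiv.Perm F) (v : F → Prop) (d : F) (k : ℕ) : ℕ :=
  ∑ i ∈ range k, crossing r v ((step r j ^ i) d)

/-- Jumps at junctions keep the side, so the side changes once per crossing piece. -/
lemma crossingsUpTo_even_iff (hvj : ∀ x, v (j x) ↔ v x) (d : F) (k : ℕ) :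
    Even (crossingsUpTo r j v d k) ↔ (v d ↔ v ((step r j ^ k) d)) := by
  induction k with
  | zero => simp [crossingsUpTo]
  | succ k ih =>
    rw [crossingsUpTo, sum_range_succ, ← crossingsUpTo, pow_succ', Equiv.Perm.mul_apply,
      step_apply, hvj, Nat.even_add, ih, crossing]
    split_ifs with h
    · simp [h]
    · simp only [Nat.not_even_one, iff_false]; tauto

lemma crossingsUpTo_add (d : F) (k l : ℕ) :
    crossingsUpTo r j v d (k + l) =
      crossingsUpTo r j v d k + crossingsUpTo r j v ((step r j ^ k) d) l := by
  simp only [crossingsUpTo]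
  rw [sum_range_add]
  congr 1
  refine sum_congr rfl fun i _ => ?_
  rw [← Equiv.Perm.mul_apply, ← pow_add, add_comm i k]

lemma crossingsUpTo_mul_of_fixed {d : F} {n : ℕ} (h : (step r j ^ n) d = d) (m : ℕ) :
    crossingsUpTo r j v d (m * n) = m * crossingsUpTo r j v d n := by
  induction m with
  | zero => simp [crossingsUpTo]
  | succ m ih =>
    have : (step r j ^ (m * n)) d = d := by
      clear ih
      induction m with
      | zero => simp
      | succ m ih => rw [add_mul, one_mul, pow_add, Equiv.Perm.mul_apply, h, ih]
    rw [add_mul, one_mul, crossingsUpTo_add, ih, this, add_mul, one_mul]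

variable {g : F → F}

lemma crossingsUpTo_map (hgr : ∀ x, g (r x) = r (g x)) (hgj : ∀ x, g (j x) = j (g x))
    (hvg : ∀ x, crossing r v (g x) = crossing r v x) (d : F) (k : ℕ) :
    crossingsUpTo r j v (g d) k = crossingsUpTo r j v d k := by
  refine sum_congr rfl fun i _ => ?_
  have := map_step_zpow hgr hgj i d
  rw [zpow_natCast] at this
  rw [← this, hvg]

variable {d : F} {k : ℕ}

lemma iterate_eq_step_pow (hgr : ∀ x, g (r x) = r (g x)) (hgj : ∀ x, g (j x) = j (g x))
    (hk : g d = (step r j ^ k) d) (a : ℕ) : g^[a] d = (step r j ^ (a * k)) d := by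
  induction a with
  | zero => simp
  | succ a ih =>
    have := map_step_zpow hgr hgj (a * k : ℕ) d
    rw [zpow_natCast] at this
    rw [Function.iterate_succ_apply', ih, this, hk, ← Equiv.Perm.mul_apply, ← pow_add, add_mul,
      one_mul]

/-- The stretches of the walk between successive images of `d` under `g` are translates of each
other by `g`, hence have equally many crossings. -/
lemma crossingsUpTo_mul (hgr : ∀ x, g (r x) = r (g x)) (hgj : ∀ x, g (j x) = j (g x))
    (hvg : ∀ x, crossing r v (g x) = crossing r v x) (hk : g d = (step r j ^ k) d) (a : ℕ) :
    crossingsUpTo r j v d (a * k) = a * crossingsUpTo r j v d k := by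
  have key : ∀ a, crossingsUpTo r j v ((step r j ^ (a * k)) d) k = crossingsUpTo r j v d k := by
    intro a
    induction a with
    | zero => simp
    | succ a ih =>
      have := map_step_zpow hgr hgj (a * k : ℕ) d
      rw [zpow_natCast] at this
      rw [add_mul, one_mul, pow_add, Equiv.Perm.mul_apply, ← hk, ← this,
        crossingsUpTo_map hgr hgj hvg, ih]
  induction a with
  | zero => simp [crossingsUpTo]
  | succ a ih => rw [add_mul, one_mul, crossingsUpTo_add, ih, key, add_mul, one_mul]

/-- Comparison of the crossings on a closed walk with the crossings on the stretch from a flag to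
its image under a symmetry of order `2 * c`. -/
lemma crossings_closed_eq [Finite F] (hgr : ∀ x, g (r x) = r (g x)) (hgj : ∀ x, g (j x) = j (g x))
    (hvg : ∀ x, crossing r v (g x) = crossing r v x) (hk : g d = (step r j ^ k) d) {c : ℕ}
    (h1 : g^[c] d ≠ d) (h2 : g^[2 * c] d = d) :
    ∃ m, Odd m ∧ 2 * c * crossingsUpTo r j v d k =
      m * crossingsUpTo r j v d (Function.minimalPeriod (step r j) d) := by
  have hdvd : ∀ a, (step r j ^ a) d = d ↔ Function.minimalPeriod (step r j) d ∣ a := fun a => by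
    have := step_zpow_eq_iff (r := r) (j := j) d a
    rwa [zpow_natCast, Int.natCast_dvd_natCast] at this
  rw [iterate_eq_step_pow hgr hgj hk, hdvd] at h2
  rw [iterate_eq_step_pow hgr hgj hk, Ne, hdvd] at h1
  obtain ⟨m, hm⟩ := h2
  refine ⟨m, ?_, ?_⟩
  -- With `n` the period, `2 * c * k = n * m`. If `m` were even, `n` would divide `c * k`, and
  -- `g^[c]` would already fix `d`.
  · by_contra hodd
    rw [Nat.not_odd_iff_even] at hodd
    obtain ⟨b, rfl⟩ := hodd
    apply h1
    refine ⟨b, ?_⟩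
    linarith
  · rw [← crossingsUpTo_mul hgr hgj hvg hk, hm, mul_comm, crossingsUpTo_mul_of_fixed]
    rw [hdvd]

lemma crossings_closed_even (hvj : ∀ x, v (j x) ↔ v x) (d : F) :
    Even (crossingsUpTo r j v d (Function.minimalPeriod (step r j) d)) := by
  rw [crossingsUpTo_even_iff hvj]
  have := (step_zpow_eq_iff (r := r) (j := j) d (Function.minimalPeriod (step r j) d : ℤ)).2 dvd_rfl
  rw [zpow_natCast] at this
  rw [this]

/-- Let `T` count the crossings from `d` to `g d`, and `q` those on the whole cycle. `T` is odd
because `g` exchanges the two sides, and `4 * T = m * q` with `m` odd. So `q` is four times an odd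
number. -/
lemma crossings_closed_of_order_four [Finite F] (hvj : ∀ x, v (j x) ↔ v x)
    (hgr : ∀ x, g (r x) = r (g x)) (hgj : ∀ x, g (j x) = j (g x)) (hvg : ∀ x, v (g x) ↔ ¬ v x)
    (hk : g d = (step r j ^ k) d) (h2 : g (g d) ≠ d) (h4 : g (g (g (g d))) = d) :
    crossingsUpTo r j v d (Function.minimalPeriod (step r j) d) ≡ 4 [MOD 8] := by
  have hc : ∀ x, crossing r v (g x) = crossing r v x := fun x => by
    have : (v (g x) ↔ v (r (g x))) ↔ (v x ↔ v (r x)) := by rw [← hgr, hvg, hvg, not_iff_not]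
    unfold crossing; split_ifs <;> tauto
  obtain ⟨m, hm, h⟩ := crossings_closed_eq hgr hgj hc hk (c := 2) h2 h4
  have hodd : Odd (crossingsUpTo r j v d k) := by
    rw [← Nat.not_even_iff_odd, crossingsUpTo_even_iff hvj, ← hk, hvg]; tauto
  generalize crossingsUpTo r j v d (Function.minimalPeriod (step r j) d) = q at *
  generalize crossingsUpTo r j v d k = T at *
  have h4q : 4 ∣ q := by
    have : Nat.Coprime 4 m := (Nat.Coprime.pow_left 2 (Nat.coprime_two_left.2 hm) : (2 ^ 2).Coprime m)
    exact this.dvd_of_dvd_mul_left ⟨T, by rw [← h]⟩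
  obtain ⟨c, rfl⟩ := h4q
  have : Odd c := by
    have : T = m * c := by linarith
    rw [this, Nat.odd_mul] at hodd
    exact hodd.2
  obtain ⟨b, rfl⟩ := this
  rw [Nat.ModEq]; omega

/-- Here `g` keeps the sides, so the stretch from `d` to `g d` has an even number `T` of crossings,
and `2 * T = m * q` with `m` odd. -/
lemma crossings_closed_of_order_two [Finite F] (hvj : ∀ x, v (j x) ↔ v x)
    (hgr : ∀ x, g (r x) = r (g x)) (hgj : ∀ x, g (j x) = j (g x)) (hvg : ∀ x, v (g x) ↔ v x)
    (hk : g d = (step r j ^ k) d) (h1 : g d ≠ d) (h2 : g (g d) = d) :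
    4 ∣ crossingsUpTo r j v d (Function.minimalPeriod (step r j) d) := by
  have hc : ∀ x, crossing r v (g x) = crossing r v x := fun x => by
    have : (v (g x) ↔ v (r (g x))) ↔ (v x ↔ v (r x)) := by rw [← hgr, hvg, hvg]
    unfold crossing; split_ifs <;> tauto
  obtain ⟨m, hm, h⟩ := crossings_closed_eq hgr hgj hc hk (c := 1) h1 h2
  have heven : Even (crossingsUpTo r j v d k) := by
    rw [crossingsUpTo_even_iff hvj, ← hk, hvg]
  have : Nat.Coprime 4 m := (Nat.Coprime.pow_left 2 (Nat.coprime_two_left.2 hm) : (2 ^ 2).Coprime m)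
  obtain ⟨b, hb⟩ := heven
  exact this.dvd_of_dvd_mul_left ⟨b, by rw [← h, hb]; ring⟩

end Crossings

end InscribedRect


namespace InscribedRect

open Set

/-! ### Decompositions of a space into arcs -/

/-- The space `X` with the coordinate function `u` is a union of finitely many arcs, which are
sections of `u` over intervals. Different arcs meet only in their ends, and an arc that ends over
a point of the open interval `(-1, 1)` is continued by exactly one other arc. -/
structure ArcSystem {V : Type*} [TopologicalSpace V] (X : Set V) (u : V → ℝ) (ι : Type*) where
  /-- The lower end of the interval. -/
  lo : ι → ℝ
  /-- The upper end of the interval. -/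
  hi : ι → ℝ
  /-- The section. -/
  arc : ι → ℝ → V
  lo_lt_hi : ∀ p, lo p < hi p
  neg_one_le_lo : ∀ p, -1 ≤ lo p
  hi_le_one : ∀ p, hi p ≤ 1
  lo_ne_zero : ∀ p, lo p ≠ 0
  hi_ne_zero : ∀ p, hi p ≠ 0
  continuousOn_u : ContinuousOn u X
  u_mem : ∀ x ∈ X, u x ∈ Ioo (-1 : ℝ) 1
  continuousOn_arc : ∀ p, ContinuousOn (arc p) (Icc (lo p) (hi p) ∩ Ioo (-1) 1)
  arc_mem : ∀ p, ∀ t ∈ Icc (lo p) (hi p) ∩ Ioo (-1) 1, arc p t ∈ X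
  u_arc : ∀ p, ∀ t ∈ Icc (lo p) (hi p) ∩ Ioo (-1) 1, u (arc p t) = t
  exists_arc : ∀ x ∈ X, ∃ p, u x ∈ Icc (lo p) (hi p) ∧ arc p (u x) = x
  eq_of_interior : ∀ p q t, t ∈ Ioo (lo p) (hi p) → t ∈ Icc (lo q) (hi q) → arc p t = arc q t →
    p = q
  exists_other : ∀ x : ι × Bool, (bif x.2 then hi x.1 else lo x.1) ∈ Ioo (-1 : ℝ) 1 →
    ∃ y, y ≠ x ∧ ∀ z : ι × Bool, ((bif z.2 then hi z.1 else lo z.1) =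
      (bif x.2 then hi x.1 else lo x.1) ∧ arc z.1 (bif x.2 then hi x.1 else lo x.1) =
      arc x.1 (bif x.2 then hi x.1 else lo x.1)) ↔ z = x ∨ z = y

namespace ArcSystem

variable {V : Type*} [TopologicalSpace V] {X : Set V} {u : V → ℝ} {ι : Type*}
  (S : ArcSystem X u ι)

/-- The end of the interval that a flag stands for. -/
def pos (x : ι × Bool) : ℝ := bif x.2 then S.hi x.1 else S.lo x.1

/-- The interval over which an arc is defined. -/
def dom (p : ι) : Set ℝ := Icc (S.lo p) (S.hi p) ∩ Ioo (-1) 1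

/-- The points of an arc. -/
def carrier (p : ι) : Set V := S.arc p '' S.dom p

lemma mem_carrier_iff {p : ι} {x : V} :
    x ∈ S.carrier p ↔ x ∈ X ∧ u x ∈ Icc (S.lo p) (S.hi p) ∧ S.arc p (u x) = x := by
  constructor
  · rintro ⟨t, ht, rfl⟩
    exact ⟨S.arc_mem p t ht, by rw [S.u_arc p t ht]; exact ht.1, by rw [S.u_arc p t ht]⟩
  · rintro ⟨h1, h2, h3⟩
    exact ⟨u x, ⟨h2, S.u_mem x h1⟩, h3⟩

lemma carrier_subset (p : ι) : S.carrier p ⊆ X := fun _ hx => (S.mem_carrier_iff.1 hx).1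

/-- The arc consists of the points over a closed interval with `arc p (u x) = x`, the preimage of
the diagonal under a continuous map. -/
lemma isClosed_carrier [T2Space V] (p : ι) : IsClosed ((↑) ⁻¹' S.carrier p : Set X) := by
  have hu : Continuous fun x : X => u x := continuousOn_iff_continuous_domRestrict.1 S.continuousOn_u
  have hD : IsClosed ((fun x : X => u x) ⁻¹' Icc (S.lo p) (S.hi p)) := isClosed_Icc.preimage hu
  have hf : ContinuousOn (fun x : X => (S.arc p (u x), (x : V)))
      ((fun x : X => u x) ⁻¹' Icc (S.lo p) (S.hi p)) := by
    refine ContinuousOn.prodMk ?_ continuous_subtype_val.continuousOn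
    exact (S.continuousOn_arc p).comp hu.continuousOn fun x hx => ⟨hx, S.u_mem x x.2⟩
  have := hf.preimage_isClosed_of_isClosed hD isClosed_diagonal
  convert this using 1
  ext x
  simp [mem_carrier_iff]

lemma isPreconnected_carrier (p : ι) : IsPreconnected (S.carrier p) :=
  ((ordConnected_Icc.inter ordConnected_Ioo).isPreconnected).image _ (S.continuousOn_arc p)

lemma exists_mem_carrier {x : V} (hx : x ∈ X) : ∃ p, x ∈ S.carrier p := by
  obtain ⟨p, h1, h2⟩ := S.exists_arc x hx
  exact ⟨p, S.mem_carrier_iff.2 ⟨hx, h1, h2⟩⟩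

lemma Ioo_subset_dom (p : ι) : Ioo (S.lo p) (S.hi p) ⊆ S.dom p := fun _ ht =>
  ⟨Ioo_subset_Icc_self ht, (S.neg_one_le_lo p).trans_lt ht.1, ht.2.trans_le (S.hi_le_one p)⟩

/-- The flag at the other end of the same arc. -/
def opp (ι : Type*) : Equiv.Perm (ι × Bool) :=
  Function.Involutive.toPerm (fun x => (x.1, !x.2)) fun x => by simp

@[simp] lemma opp_apply (x : ι × Bool) : opp ι x = (x.1, !x.2) := rfl

lemma opp_opp (x : ι × Bool) : opp ι (opp ι x) = x := by simp

lemma opp_ne (x : ι × Bool) : opp ι x ≠ x := by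
  simp [Prod.ext_iff]

lemma eq_or_eq_opp {x y : ι × Bool} (h : x.1 = y.1) : x = y ∨ x = opp ι y := by
  obtain ⟨p, a⟩ := x
  obtain ⟨q, b⟩ := y
  obtain rfl : p = q := h
  cases a <;> cases b <;> simp

open Classical in
/-- The flag of the other arc at the same end; at a free end, the flag itself. -/
noncomputable def other (x : ι × Bool) : ι × Bool :=
  if h : S.pos x ∈ Ioo (-1 : ℝ) 1 then (S.exists_other x h).choose else x

lemma other_of_free {x : ι × Bool} (h : S.pos x ∉ Ioo (-1 : ℝ) 1) : S.other x = x := dif_neg h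

lemma other_ne {x : ι × Bool} (h : S.pos x ∈ Ioo (-1 : ℝ) 1) : S.other x ≠ x := by
  rw [other, dif_pos h]
  exact (S.exists_other x h).choose_spec.1

lemma same_end_iff {x : ι × Bool} (h : S.pos x ∈ Ioo (-1 : ℝ) 1) (z : ι × Bool) :
    (S.pos z = S.pos x ∧ S.arc z.1 (S.pos x) = S.arc x.1 (S.pos x)) ↔ z = x ∨ z = S.other x := by
  rw [other, dif_pos h]
  exact (S.exists_other x h).choose_spec.2 z

lemma pos_other (x : ι × Bool) : S.pos (S.other x) = S.pos x := by
  by_cases h : S.pos x ∈ Ioo (-1 : ℝ) 1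
  · exact ((S.same_end_iff h _).2 (Or.inr rfl)).1
  · rw [S.other_of_free h]

lemma arc_other (x : ι × Bool) : S.arc (S.other x).1 (S.pos x) = S.arc x.1 (S.pos x) := by
  by_cases h : S.pos x ∈ Ioo (-1 : ℝ) 1
  · exact ((S.same_end_iff h _).2 (Or.inr rfl)).2
  · rw [S.other_of_free h]

lemma other_other (x : ι × Bool) : S.other (S.other x) = x := by
  by_cases h : S.pos x ∈ Ioo (-1 : ℝ) 1
  · have h' : S.pos (S.other x) ∈ Ioo (-1 : ℝ) 1 := by rwa [S.pos_other]
    have := (S.same_end_iff h' x).1 ⟨(S.pos_other x).symm, by rw [S.pos_other, S.arc_other]⟩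
    rcases this with h2 | h2
    · exact absurd h2.symm (S.other_ne h)
    · exact h2.symm
  · rw [S.other_of_free h, S.other_of_free h]

/-- `other` as a permutation. -/
noncomputable def jump : Equiv.Perm (ι × Bool) := Function.Involutive.toPerm _ S.other_other

lemma jump_apply (x : ι × Bool) : S.jump x = S.other x := rfl

lemma jump_jump (x : ι × Bool) : S.jump (S.jump x) = x := S.other_other x

lemma pos_jump (x : ι × Bool) : S.pos (S.jump x) = S.pos x := S.pos_other x

lemma jump_eq_self_iff (x : ι × Bool) : S.jump x = x ↔ S.pos x ∉ Ioo (-1 : ℝ) 1 :=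
  ⟨fun h h' => S.other_ne h' h, S.other_of_free⟩

/-- The flags of the walk that starts with the flag `d`. -/
noncomputable def walk (d : ι × Bool) (i : ℤ) : ι × Bool := (step (opp ι) S.jump ^ i) d

lemma walk_zero (d : ι × Bool) : S.walk d 0 = d := rfl

lemma walk_add_one (d : ι × Bool) (i : ℤ) :
    S.walk d (i + 1) = S.jump (opp ι (S.walk d i)) := by
  rw [walk, add_comm, zpow_one_add]; rfl

lemma opp_walk_sub_one (d : ι × Bool) (i : ℤ) :
    opp ι (S.walk d (i - 1)) = S.jump (S.walk d i) := by
  have := S.walk_add_one d (i - 1)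
  rw [sub_add_cancel] at this
  rw [this, jump_jump]

lemma walk_walk (d : ι × Bool) (i k : ℤ) : S.walk (S.walk d i) k = S.walk d (k + i) := by
  rw [walk, walk, walk, zpow_add, Equiv.Perm.mul_apply]

/-- The union of the arcs on a walk. -/
def walkCarrier (d : ι × Bool) : Set V := ⋃ i : ℤ, S.carrier (S.walk d i).1

lemma walkCarrier_walk (d : ι × Bool) (k : ℤ) : S.walkCarrier (S.walk d k) = S.walkCarrier d := by
  ext x
  simp only [walkCarrier, mem_iUnion, walk_walk]
  exact ⟨fun ⟨i, hi⟩ => ⟨_, hi⟩, fun ⟨i, hi⟩ => ⟨i - k, by simpa using hi⟩⟩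

lemma pos_mem_Icc (x : ι × Bool) : S.pos x ∈ Icc (S.lo x.1) (S.hi x.1) := by
  obtain ⟨p, b⟩ := x
  have := S.lo_lt_hi p
  cases b <;> simp [pos, this.le]

/-- Two arcs meet only at a common end. -/
lemma exists_jump_of_mem {p q : ι} (hpq : p ≠ q) {x : V} (hp : x ∈ S.carrier p)
    (hq : x ∈ S.carrier q) : ∃ y z : ι × Bool, y.1 = p ∧ z.1 = q ∧ S.jump y = z ∧ S.pos y = u x := by
  rw [mem_carrier_iff] at hp hq
  obtain ⟨hX, hp1, hp2⟩ := hp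
  obtain ⟨-, hq1, hq2⟩ := hq
  have aux : ∀ {p q : ι}, p ≠ q → u x ∈ Icc (S.lo p) (S.hi p) → S.arc p (u x) = x →
      u x ∈ Icc (S.lo q) (S.hi q) → S.arc q (u x) = x → ∃ y : ι × Bool, y.1 = p ∧ S.pos y = u x := by
    intro p q hpq hp1 hp2 hq1 hq2
    by_cases h : u x ∈ Ioo (S.lo p) (S.hi p)
    · exact absurd (S.eq_of_interior p q _ h hq1 (hp2.trans hq2.symm)) hpq
    · rcases eq_or_lt_of_le hp1.1 with h1 | h1
      · exact ⟨(p, false), rfl, h1⟩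
      · rcases eq_or_lt_of_le hp1.2 with h2 | h2
        · exact ⟨(p, true), rfl, h2.symm⟩
        · exact absurd ⟨h1, h2⟩ h
  obtain ⟨y, hy, hy'⟩ := aux hpq hp1 hp2 hq1 hq2
  obtain ⟨z, hz, hz'⟩ := aux hpq.symm hq1 hq2 hp1 hp2
  refine ⟨y, z, hy, hz, ?_, hy'⟩
  have := (S.same_end_iff (x := y) (by rw [hy']; exact S.u_mem x hX) z).1
    ⟨hz'.trans hy'.symm, by rw [hy', hy, hz, hp2, hq2]⟩
  rcases this with h | h
  · exact absurd (hy.symm.trans ((congrArg Prod.fst h).symm.trans hz)) hpq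
  · exact h.symm

/-- The arcs on a walk are disjoint from the other arcs. -/
lemma exists_walk_of_mem {d : ι × Bool} {i : ℤ} {q : ι} {x : V}
    (hx : x ∈ S.carrier (S.walk d i).1) (hq : x ∈ S.carrier q) : ∃ k, (S.walk d k).1 = q := by
  by_cases h : (S.walk d i).1 = q
  · exact ⟨i, h⟩
  obtain ⟨y, z, hy, hz, hj, -⟩ := S.exists_jump_of_mem h hx hq
  -- The common end is either where the walk enters this piece, and the other arc precedes it, or
  -- where it leaves, and the other arc follows.
  rcases eq_or_eq_opp hy with rfl | rfl
  · refine ⟨i - 1, ?_⟩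
    have := S.opp_walk_sub_one d i
    rw [hj] at this
    rw [← hz, ← this]; rfl
  · refine ⟨i + 1, ?_⟩
    rw [walk_add_one, hj, hz]

lemma carrier_nonempty (p : ι) : (S.carrier p).Nonempty := by
  obtain ⟨t, ht⟩ := nonempty_Ioo.2 (S.lo_lt_hi p)
  exact ⟨_, t, S.Ioo_subset_dom p ht, rfl⟩

/-- An arc contained in the union of the arcs on a walk is one of them. -/
lemma exists_walk_of_carrier_subset {d : ι × Bool} {q : ι} (h : S.carrier q ⊆ S.walkCarrier d) :
    ∃ k, (S.walk d k).1 = q := by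
  obtain ⟨x, hx⟩ := S.carrier_nonempty q
  obtain ⟨i, hi⟩ := mem_iUnion.1 (h hx)
  exact S.exists_walk_of_mem hi hx

lemma arc_pos_mem_carrier {x : ι × Bool} (h : S.pos x ∈ Ioo (-1 : ℝ) 1) :
    S.arc x.1 (S.pos x) ∈ S.carrier x.1 := ⟨_, ⟨S.pos_mem_Icc x, h⟩, rfl⟩

lemma isPreconnected_walkCarrier (d : ι × Bool) : IsPreconnected (S.walkCarrier d) := by
  refine IsPreconnected.iUnion_of_chain (fun i => S.isPreconnected_carrier _) fun i => ?_
  rw [Order.succ_eq_add_one, walk_add_one]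
  by_cases h : S.pos (opp ι (S.walk d i)) ∈ Ioo (-1 : ℝ) 1
  · have h1 := S.arc_pos_mem_carrier h
    have h2 : S.pos (S.jump (opp ι (S.walk d i))) ∈ Ioo (-1 : ℝ) 1 := by rwa [pos_jump]
    have h3 := S.arc_pos_mem_carrier h2
    rw [pos_jump, jump_apply, arc_other] at h3
    exact ⟨_, h1, h3⟩
  -- At a free end the next flag of the walk belongs to the same piece.
  · rw [(S.jump_eq_self_iff _).2 h, opp_apply, inter_self]
    exact S.carrier_nonempty _

lemma isClosed_biUnion_carrier [T2Space V] [Finite ι] (Z : Set ι) :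
    IsClosed ((↑) ⁻¹' (⋃ p ∈ Z, S.carrier p) : Set X) := by
  simp only [preimage_iUnion]
  exact Z.toFinite.isClosed_biUnion fun p _ => S.isClosed_carrier p

lemma walkCarrier_subset (d : ι × Bool) : S.walkCarrier d ⊆ X :=
  iUnion_subset fun _ => S.carrier_subset _

/-- The arcs on the walk and the remaining arcs form two finite families of closed sets that cover
`X`. No arc of the second family meets the walk, since arcs meet only at junctions and the walk
follows these. -/
lemma isClopen_walkCarrier [T2Space V] [Finite ι] (d : ι × Bool) :
    IsClopen ((↑) ⁻¹' S.walkCarrier d : Set X) := by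
  set Z : Set ι := range fun i => (S.walk d i).1 with hZ
  have h1 : S.walkCarrier d = ⋃ p ∈ Z, S.carrier p := by
    rw [hZ, biUnion_range]; rfl
  constructor
  · rw [h1]; exact S.isClosed_biUnion_carrier Z
  · rw [← isClosed_compl_iff]
    convert S.isClosed_biUnion_carrier Zᶜ using 1
    ext x
    simp only [mem_compl_iff, mem_preimage, mem_iUnion, exists_prop, walkCarrier, not_exists]
    constructor
    · intro h
      obtain ⟨p, hp⟩ := S.exists_mem_carrier x.2
      refine ⟨p, ?_, hp⟩
      rintro ⟨i, rfl⟩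
      exact h i hp
    · rintro ⟨p, hp, hx⟩ i hi
      exact hp (S.exists_walk_of_mem hi hx)

lemma connectedComponentIn_eq [T2Space V] [Finite ι] {d : ι × Bool} {x : V}
    (hx : x ∈ S.walkCarrier d) : connectedComponentIn X x = S.walkCarrier d := by
  have hX := S.walkCarrier_subset d hx
  apply Subset.antisymm
  · rw [connectedComponentIn_eq_image hX, image_subset_iff]
    exact (S.isClopen_walkCarrier d).connectedComponent_subset hx
  · exact (S.isPreconnected_walkCarrier d).subset_connectedComponentIn hx (S.walkCarrier_subset d)

lemma exists_walkCarrier_eq [T2Space V] [Finite ι] {x : V} (hx : x ∈ X) :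
    ∃ d, connectedComponentIn X x = S.walkCarrier d := by
  obtain ⟨p, hp⟩ := S.exists_mem_carrier hx
  refine ⟨(p, true), S.connectedComponentIn_eq ?_⟩
  exact mem_iUnion.2 ⟨0, by rwa [walk_zero]⟩

/-! ### Zeros of the coordinate -/

/-- The flag lies over the negative half of the interval. -/
def Neg (x : ι × Bool) : Prop := S.pos x < 0

lemma neg_jump (x : ι × Bool) : S.Neg (S.jump x) ↔ S.Neg x := by
  rw [Neg, Neg, pos_jump]

-- No end of an arc lies over `0`, and `u` is the parameter of the arc. So the arc has a zero of
-- `u`, and then a single one, exactly when its ends have opposite signs.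
open Classical in
lemma crossing_eq (x : ι × Bool) : crossing (opp ι) S.Neg x =
    if S.lo x.1 < 0 ∧ 0 < S.hi x.1 then 1 else 0 := by
  obtain ⟨p, b⟩ := x
  have h1 := S.lo_lt_hi p
  have h2 := (S.hi_ne_zero p)
  have h3 := S.lo_ne_zero p
  have h : (S.Neg (p, b) ↔ S.Neg (opp ι (p, b))) ↔ ¬ (S.lo p < 0 ∧ 0 < S.hi p) := by
    have : 0 < S.hi p ↔ ¬ S.hi p < 0 := by
      rw [not_lt]; exact ⟨le_of_lt, fun h => lt_of_le_of_ne h h2.symm⟩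
    have h4 : S.hi p < 0 → S.lo p < 0 := fun h => h1.trans h
    cases b <;> simp only [Neg, pos, opp_apply, this, Bool.not_true, Bool.not_false, cond_true,
      cond_false] <;> tauto
  unfold crossing
  split_ifs <;> tauto

/-- The number of zeros of the coordinate on the arcs of a walk. -/
lemma ncard_zeros {d : ι × Bool} {n : ℕ}
    (hinj : ∀ i k : ℕ, i < n → k < n → (S.walk d i).1 = (S.walk d k).1 → i = k)
    (hcov : ∀ i : ℤ, ∃ k : ℕ, k < n ∧ (S.walk d i).1 = (S.walk d k).1) :
    {y ∈ S.walkCarrier d | u y = 0}.ncard = crossingsUpTo (opp ι) S.jump S.Neg d n := by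
  classical
  have h1 : {y ∈ S.walkCarrier d | u y = 0} =
      ((Finset.range n).filter fun i : ℕ => S.lo (S.walk d i).1 < 0 ∧ 0 < S.hi (S.walk d i).1).image
        fun i : ℕ => S.arc (S.walk d i).1 0 := by
    ext y
    simp only [mem_ofPred_eq, Finset.coe_image, Finset.coe_filter, Finset.mem_range, mem_image]
    constructor
    · rintro ⟨hy, h0⟩
      obtain ⟨i, hi⟩ := mem_iUnion.1 hy
      obtain ⟨k, hk, hik⟩ := hcov i
      rw [hik, mem_carrier_iff, h0] at hi
      exact ⟨k, ⟨hk, lt_of_le_of_ne hi.2.1.1 (S.lo_ne_zero _),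
        lt_of_le_of_ne hi.2.1.2 (S.hi_ne_zero _).symm⟩, hi.2.2⟩
    · rintro ⟨k, ⟨hk, h2, h3⟩, rfl⟩
      have h4 := S.Ioo_subset_dom _ ⟨h2, h3⟩
      exact ⟨mem_iUnion.2 ⟨k, 0, h4, rfl⟩, S.u_arc _ _ h4⟩
  rw [h1, ncard_coe_finset, Finset.card_image_of_injOn, Finset.card_filter, crossingsUpTo]
  · refine Finset.sum_congr rfl fun i _ => ?_
    rw [crossing_eq]
    simp only [walk, zpow_natCast]
  · intro i hi k hk hik
    simp only [Finset.coe_filter, Finset.mem_range, mem_ofPred_eq] at hi hk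
    -- Zeros lie in the interior of their arcs, where different arcs are disjoint.
    exact hinj i k hi.1 hk.1 (S.eq_of_interior _ _ 0 hi.2 (Ioo_subset_Icc_self hk.2) hik)

end ArcSystem

end InscribedRect


/-! ### Paths between opposite ends are open arcs. -/

namespace InscribedRect

open Set Filter Topology

/-- The affine order isomorphism between the intervals `(-1, 1)` and `(0, L)`. -/
noncomputable def IooRescale {L : ℝ} (hL : 0 < L) : Ioo (-1 : ℝ) 1 ≃o Ioo (0 : ℝ) L where
  toFun x := ⟨(x + 1) * (L / 2), by
    have h1 := x.2.1
    have h2 := x.2.2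
    constructor <;> nlinarith⟩
  invFun y := ⟨y / (L / 2) - 1, by
    have h1 := y.2.1
    have h2 := y.2.2
    constructor
    · have : 0 < (y : ℝ) / (L / 2) := by positivity
      linarith
    · have : (y : ℝ) / (L / 2) < 2 := by rw [div_lt_iff₀ (by positivity)]; linarith
      linarith⟩
  left_inv x := by ext; simp only; field_simp; ring
  right_inv y := by ext; simp only; field_simp; ring
  map_rel_iff' := by
    intro a b
    change ((a : ℝ) + 1) * (L / 2) ≤ ((b : ℝ) + 1) * (L / 2) ↔ (a : ℝ) ≤ b
    rw [mul_le_mul_iff_left₀ (by positivity), add_le_add_iff_right]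

/-- An increasing reparametrization of $(0,L)$ by $\mathbb R$ turns the one-sided limits at the ends
into limits at `atBot` and `atTop`. -/
lemma exists_homeomorph_real_of_inverse {V : Type*} [TopologicalSpace V] {A : Set V} {u : V → ℝ}
    {c : ℝ → V} {G : V → ℝ} {L a b : ℝ} (hL : 0 < L) (hc : ContinuousOn c (Ioo 0 L))
    (hcA : MapsTo c (Ioo 0 L) A) (hG : ContinuousOn G A) (hGA : MapsTo G A (Ioo 0 L))
    (hGc : ∀ s ∈ Ioo 0 L, G (c s) = s) (hcG : ∀ y ∈ A, c (G y) = y)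
    (ha : Tendsto (fun s => u (c s)) (𝓝[>] 0) (𝓝 a))
    (hb : Tendsto (fun s => u (c s)) (𝓝[<] L) (𝓝 b)) :
    ∃ h : ℝ ≃ₜ A, Tendsto (fun t => u (h t)) atBot (𝓝 a) ∧
      Tendsto (fun t => u (h t)) atTop (𝓝 b) := by
  let e : Ioo (0 : ℝ) L ≃ₜ A :=
    { toFun := hcA.restrict
      invFun := hGA.restrict
      left_inv := fun s => Subtype.ext (hGc s s.2)
      right_inv := fun y => Subtype.ext (hcG y y.2)
      continuous_toFun := hc.mapsToRestrict hcA
      continuous_invFun := hG.mapsToRestrict hGA }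
  let o : ℝ ≃o Ioo (0 : ℝ) L := (orderIsoIooNegOneOne ℝ).trans (IooRescale hL)
  refine ⟨o.toHomeomorph.trans e, ?_, ?_⟩
  · have h1 : Tendsto (fun s : Ioo (0 : ℝ) L => u (c s)) atBot (𝓝 a) :=
      (tendsto_comp_coe_Ioo_atBot hL).2 ha
    exact h1.comp o.tendsto_atBot
  · have h1 : Tendsto (fun s : Ioo (0 : ℝ) L => u (c s)) atTop (𝓝 b) :=
      (tendsto_comp_coe_Ioo_atTop hL).2 hb
    exact h1.comp o.tendsto_atTop

namespace ArcSystem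

variable {V : Type*} [TopologicalSpace V] {X : Set V} {u : V → ℝ} {ι : Type*}
  (S : ArcSystem X u ι)

/-- The set `A` is an open arc such that `u` tends to `-1` towards one end and to `1` towards the
other end. -/
def IsCrossingArc (u : V → ℝ) (A : Set V) : Prop :=
  ∃ h : ℝ ≃ₜ A, Tendsto (fun t => u (h t)) atBot (𝓝 (-1)) ∧ Tendsto (fun t => u (h t)) atTop (𝓝 1)

/-- The coordinate on the `i`-th arc of a walk as an affine function on `[i, i + 1]`. -/
noncomputable def along (d : ι × Bool) (i : ℤ) (s : ℝ) : ℝ :=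
  S.pos (S.walk d i) + (s - i) * (S.pos (S.walk d (i + 1)) - S.pos (S.walk d i))

/-- The point of a walk at the time `s`. -/
noncomputable def point (d : ι × Bool) (s : ℝ) : V :=
  S.arc (S.walk d ⌊s⌋).1 (S.along d ⌊s⌋ s)

open Classical in
/-- The time at which a walk passes through `y`. -/
noncomputable def time (d : ι × Bool) (l : ℕ) (y : V) : ℝ :=
  if h : ∃ i : ℤ, (0 ≤ i ∧ i < l) ∧ y ∈ S.carrier (S.walk d i).1 then
    h.choose + (u y - S.pos (S.walk d h.choose)) /
      (S.pos (S.walk d (h.choose + 1)) - S.pos (S.walk d h.choose))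
  -- Never reached for points of a path with `l` pieces, by `walkCarrier_cover`.
  else 0

lemma pos_walk_cases (d : ι × Bool) (i : ℤ) :
    (S.pos (S.walk d i) = S.lo (S.walk d i).1 ∧ S.pos (S.walk d (i + 1)) = S.hi (S.walk d i).1) ∨
    (S.pos (S.walk d i) = S.hi (S.walk d i).1 ∧ S.pos (S.walk d (i + 1)) = S.lo (S.walk d i).1) := by
  rw [walk_add_one, pos_jump]
  generalize S.walk d i = x
  obtain ⟨p, b⟩ := x
  cases b <;> simp [pos]

lemma pos_walk_ne (d : ι × Bool) (i : ℤ) :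
    S.pos (S.walk d (i + 1)) - S.pos (S.walk d i) ≠ 0 := by
  have := S.lo_lt_hi (S.walk d i).1
  rw [sub_ne_zero]
  rcases S.pos_walk_cases d i with ⟨h1, h2⟩ | ⟨h1, h2⟩
  · rw [h1, h2]; exact this.ne'
  · rw [h1, h2]; exact this.ne

lemma along_left (d : ι × Bool) (i : ℤ) : S.along d i i = S.pos (S.walk d i) := by
  simp [along]

lemma along_right (d : ι × Bool) (i : ℤ) : S.along d i (i + 1) = S.pos (S.walk d (i + 1)) := by
  simp [along]

lemma continuous_along (d : ι × Bool) (i : ℤ) : Continuous (S.along d i) := by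
  unfold along; fun_prop

lemma along_mem_Ioo {d : ι × Bool} {i : ℤ} {s : ℝ} (h1 : (i : ℝ) < s) (h2 : s < i + 1) :
    S.along d i s ∈ Ioo (S.lo (S.walk d i).1) (S.hi (S.walk d i).1) := by
  have := S.lo_lt_hi (S.walk d i).1
  rw [along]
  rcases S.pos_walk_cases d i with ⟨h3, h4⟩ | ⟨h3, h4⟩ <;> rw [h3, h4] <;> constructor <;> nlinarith

lemma arc_walk_add_one (d : ι × Bool) (i : ℤ) :
    S.arc (S.walk d (i + 1)).1 (S.pos (S.walk d (i + 1))) =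
      S.arc (S.walk d i).1 (S.pos (S.walk d (i + 1))) := by
  rw [walk_add_one, pos_jump, jump_apply, arc_other]
  rfl

/-- The formula of the `i`-th piece also holds at the right end, where the floor jumps, because
consecutive arcs agree at their junction. -/
lemma point_eq {d : ι × Bool} {i : ℤ} {s : ℝ} (h1 : (i : ℝ) ≤ s) (h2 : s ≤ i + 1) :
    S.point d s = S.arc (S.walk d i).1 (S.along d i s) := by
  rcases eq_or_lt_of_le h2 with rfl | h2
  · have : ⌊(i : ℝ) + 1⌋ = i + 1 := by simp
    have h3 := S.along_left d (i + 1)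
    push_cast at h3
    rw [point, this, h3, arc_walk_add_one, along_right]
  · have : ⌊s⌋ = i := Int.floor_eq_iff.2 ⟨h1, h2⟩
    rw [point, this]

section Path

variable {d : ι × Bool} {l : ℕ} (hd : S.jump d = d)
  (hl : Function.minimalPeriod (step (opp ι) S.jump) d = 2 * l)
include hd hl

lemma pos_walk_mem {i : ℤ} (h0 : 0 < i) (h1 : i < l) : S.pos (S.walk d i) ∈ Ioo (-1 : ℝ) 1 := by
  by_contra h
  rw [← jump_eq_self_iff, walk, path_end_iff opp_opp S.jump_jump hd hl] at h
  have := Int.le_of_dvd h0 h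
  omega

lemma along_mem_dom {i : ℤ} {s : ℝ} (hs : s ∈ Ioo (0 : ℝ) l) (h0 : 0 ≤ i)
    (h1 : i < l) (h2 : (i : ℝ) ≤ s) (h3 : s ≤ i + 1) : S.along d i s ∈ S.dom (S.walk d i).1 := by
  rcases eq_or_lt_of_le h2 with rfl | h2
  · rw [along_left]
    exact ⟨S.pos_mem_Icc _, S.pos_walk_mem hd hl (by exact_mod_cast hs.1) h1⟩
  · rcases eq_or_lt_of_le h3 with rfl | h3
    · rw [along_right]
      refine ⟨?_, S.pos_walk_mem hd hl (by omega) (by exact_mod_cast hs.2)⟩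
      have := S.lo_lt_hi (S.walk d i).1
      rcases S.pos_walk_cases d i with ⟨-, h⟩ | ⟨-, h⟩ <;> rw [h]
      · exact right_mem_Icc.2 this.le
      · exact left_mem_Icc.2 this.le
    · exact S.Ioo_subset_dom _ (S.along_mem_Ioo h2 h3)

lemma path_consecutive {i k : ℤ} (hi : 0 ≤ i) (hik : i < k) (hk : k < l) {y : V}
    (h1 : y ∈ S.carrier (S.walk d i).1) (h2 : y ∈ S.carrier (S.walk d k).1) :
    k = i + 1 ∧ u y = S.pos (S.walk d (i + 1)) := by
  have key : ∀ a b : ℤ, 0 ≤ a → a < l → 0 ≤ b → b < l → (S.walk d b).1 = (S.walk d a).1 → b = a := by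
    intro a b ha ha' hb hb' h
    exact (path_piece_eq_iff opp_opp S.jump_jump hd hl a b ⟨ha, ha'⟩ ⟨hb, hb'⟩).1 (eq_or_eq_opp h)
  have hne : (S.walk d i).1 ≠ (S.walk d k).1 := fun h => by
    have := key _ _ (by omega) hk hi (by omega) h
    omega
  obtain ⟨x, z, hx, hz, hj, hp⟩ := S.exists_jump_of_mem hne h1 h2
  rcases eq_or_eq_opp hx with rfl | rfl
  · exfalso
    rw [← opp_walk_sub_one] at hj
    have hz' : (S.walk d (i - 1)).1 = (S.walk d k).1 := by rw [← hz, ← hj]; rfl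
    -- For `i = 0` the preceding flag lies on the piece of `d` itself, since the walk turns round at
    -- the free end `d`.
    rcases eq_or_lt_of_le hi with rfl | hi
    · have := S.opp_walk_sub_one d 0
      rw [walk_zero, hd] at this
      have h3 : (S.walk d (0 - 1)).1 = d.1 := (congrArg Prod.fst this :)
      rw [h3] at hz'
      exact hne hz'
    · have := key _ _ (by omega) hk (by omega) (by omega) hz'
      omega
  · rw [← walk_add_one] at hj
    refine ⟨?_, by rw [← hp, walk_add_one, pos_jump]⟩
    exact (key (i + 1) k (by omega) (by omega) (by omega) hk (by rw [hj, hz]))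

/-- The time does not depend on the chosen piece: a point on two pieces is the junction of
consecutive ones, and both formulas give the integer between them. -/
lemma time_eq {i : ℤ} (hi : 0 ≤ i) (hil : i < l) {y : V} (hy : y ∈ S.carrier (S.walk d i).1) :
    S.time d l y = i + (u y - S.pos (S.walk d i)) /
      (S.pos (S.walk d (i + 1)) - S.pos (S.walk d i)) := by
  have h : ∃ i : ℤ, (0 ≤ i ∧ i < l) ∧ y ∈ S.carrier (S.walk d i).1 := ⟨i, ⟨hi, hil⟩, hy⟩
  rw [time, dif_pos h]
  obtain ⟨⟨h1, h2⟩, h3⟩ := h.choose_spec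
  generalize h.choose = k at *
  have aux : ∀ i k : ℤ, 0 ≤ i → i < k → k < l → y ∈ S.carrier (S.walk d i).1 →
      y ∈ S.carrier (S.walk d k).1 → (i : ℝ) + (u y - S.pos (S.walk d i)) /
      (S.pos (S.walk d (i + 1)) - S.pos (S.walk d i)) = k + (u y - S.pos (S.walk d k)) /
      (S.pos (S.walk d (k + 1)) - S.pos (S.walk d k)) := by
    intro i k hi hik hk h1 h2
    obtain ⟨rfl, h⟩ := S.path_consecutive hd hl hi hik hk h1 h2
    rw [h, div_self (S.pos_walk_ne d i), sub_self, zero_div]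
    push_cast; ring
  rcases lt_trichotomy i k with h4 | rfl | h4
  · exact (aux i k hi h4 h2 hy h3).symm
  · rfl
  · exact aux k i h1 h4 hil h3 hy

lemma walkCarrier_cover (hl0 : 0 < l) {y : V} (hy : y ∈ S.walkCarrier d) :
    ∃ i : ℤ, 0 ≤ i ∧ i < l ∧ y ∈ S.carrier (S.walk d i).1 := by
  obtain ⟨i, hi⟩ := mem_iUnion.1 hy
  obtain ⟨k, hk, h⟩ := path_piece_cover opp_opp S.jump_jump hd hl hl0 i
  refine ⟨k, by omega, by omega, ?_⟩
  have : (S.walk d i).1 = (S.walk d k).1 := by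
    rcases h with h | h
    · exact congrArg Prod.fst h
    · exact (congrArg Prod.fst h :)
  rwa [← this]

lemma time_mem (hl0 : 0 < l) (h0 : S.pos d = -1) (h1 : S.pos (S.walk d l) = 1) {y : V}
    (hy : y ∈ S.walkCarrier d) : S.time d l y ∈ Ioo (0 : ℝ) l ∧ S.point d (S.time d l y) = y := by
  obtain ⟨i, hi, hil, h⟩ := S.walkCarrier_cover hd hl hl0 hy
  have hne := S.pos_walk_ne d i
  have ht := S.time_eq hd hl hi hil h
  have hle : 0 ≤ (u y - S.pos (S.walk d i)) / (S.pos (S.walk d (i + 1)) - S.pos (S.walk d i)) ∧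
      (u y - S.pos (S.walk d i)) / (S.pos (S.walk d (i + 1)) - S.pos (S.walk d i)) ≤ 1 := by
    have h2 := (S.mem_carrier_iff.1 h).2.1
    have h3 := S.lo_lt_hi (S.walk d i).1
    rcases S.pos_walk_cases d i with ⟨h4, h5⟩ | ⟨h4, h5⟩ <;> rw [h4, h5]
    · constructor
      · exact div_nonneg (by linarith [h2.1]) (by linarith)
      · rw [div_le_one (by linarith)]; linarith [h2.2]
    · constructor
      · exact div_nonneg_of_nonpos (by linarith [h2.2]) (by linarith)
      · rw [div_le_one_of_neg (by linarith)]; linarith [h2.1]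
  have hu := S.u_mem y (S.carrier_subset _ h)
  have hal : S.along d i (S.time d l y) = u y := by
    rw [along, ht]; field_simp; ring
  refine ⟨⟨?_, ?_⟩, ?_⟩
  -- Time `0` would mean `u y = -1`, and time `l`, treated next, `u y = 1`. Neither value is
  -- attained on `X`.
  · by_contra hneg
    have hi' : i = 0 := by
      have : (i : ℝ) ≤ 0 := by linarith [hle.1]
      have : i ≤ 0 := by exact_mod_cast this
      omega
    subst hi'
    have h2 : S.time d l y = ((0 : ℤ) : ℝ) := by
      apply le_antisymm
      · simpa using hneg
      · rw [ht]; linarith [hle.1]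
    rw [h2, along_left, walk_zero, h0] at hal
    exact hu.1.ne hal
  · by_contra hneg
    have hi' : i + 1 = l := by
      have : (l : ℝ) ≤ i + 1 := by linarith [hle.2]
      have : (l : ℤ) ≤ i + 1 := by exact_mod_cast this
      omega
    have hi2 : (i : ℝ) + 1 = l := by exact_mod_cast hi'
    have h2 : S.time d l y = i + 1 := by
      apply le_antisymm
      · rw [ht]; linarith [hle.2]
      · rw [hi2]; simpa using hneg
    rw [h2, along_right, hi', h1] at hal
    exact hu.2.ne hal.symm
  · rw [S.point_eq (i := i), hal]
    · exact (S.mem_carrier_iff.1 h).2.2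
    · rw [ht]; linarith [hle.1]
    · rw [ht]; linarith [hle.2]

lemma point_mem {s : ℝ} (hs : s ∈ Ioo (0 : ℝ) l) :
    S.point d s ∈ S.walkCarrier d ∧ S.time d l (S.point d s) = s := by
  have h0 : 0 ≤ ⌊s⌋ := Int.floor_nonneg.2 hs.1.le
  have h1 : ⌊s⌋ < l := Int.floor_lt.2 (by exact_mod_cast hs.2)
  have h2 := S.along_mem_dom hd hl hs h0 h1 (Int.floor_le s) (Int.lt_floor_add_one s).le
  have h3 : S.point d s ∈ S.carrier (S.walk d ⌊s⌋).1 := ⟨_, h2, rfl⟩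
  refine ⟨mem_iUnion.2 ⟨_, h3⟩, ?_⟩
  have hne := S.pos_walk_ne d ⌊s⌋
  rw [S.time_eq hd hl h0 h1 h3, point, S.u_arc _ _ h2, along]
  field_simp; ring

/-- Continuity is checked on finitely many relatively closed unit intervals; the formulas agree at
their common ends. -/
lemma continuousOn_point : ContinuousOn (S.point d) (Ioo (0 : ℝ) l) := by
  rw [continuousOn_iff_continuous_domRestrict]
  refine LocallyFinite.continuous
    (f := fun i : Ico (0 : ℤ) l => {s : Ioo (0 : ℝ) l | (s : ℝ) ∈ Icc (i : ℝ) (i + 1)})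
    (locallyFinite_of_finite _) ?_ ?_ ?_
  · ext s
    simp only [mem_iUnion, mem_univ, iff_true]
    exact ⟨⟨⌊(s : ℝ)⌋, Int.floor_nonneg.2 s.2.1.le, Int.floor_lt.2 (by exact_mod_cast s.2.2)⟩,
      Int.floor_le _, (Int.lt_floor_add_one _).le⟩
  · intro i
    exact isClosed_Icc.preimage continuous_subtype_val
  · intro i
    have h1 : ContinuousOn (fun s : Ioo (0 : ℝ) l => S.arc (S.walk d i).1 (S.along d i s))
        {s : Ioo (0 : ℝ) l | (s : ℝ) ∈ Icc (i : ℝ) (i + 1)} :=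
      (S.continuousOn_arc _).comp
        ((S.continuous_along d i).comp continuous_subtype_val).continuousOn
        fun s hs => S.along_mem_dom hd hl s.2 i.2.1 i.2.2 hs.1 hs.2
    exact h1.congr fun s hs => S.point_eq hs.1 hs.2

lemma continuousOn_time [T2Space V] (hl0 : 0 < l) :
    ContinuousOn (S.time d l) (S.walkCarrier d) := by
  rw [continuousOn_iff_continuous_domRestrict]
  refine LocallyFinite.continuous
    (f := fun i : Ico (0 : ℤ) l => {y : S.walkCarrier d | (y : V) ∈ S.carrier (S.walk d i).1})
    (locallyFinite_of_finite _) ?_ ?_ ?_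
  · ext y
    simp only [mem_iUnion, mem_univ, iff_true]
    obtain ⟨i, h1, h2, h3⟩ := S.walkCarrier_cover hd hl hl0 y.2
    exact ⟨⟨i, h1, h2⟩, h3⟩
  · intro i
    exact (S.isClosed_carrier (S.walk d i).1).preimage
      (continuous_inclusion (S.walkCarrier_subset d))
  · intro i
    have h1 : ContinuousOn (fun y : S.walkCarrier d => (i : ℝ) + (u y - S.pos (S.walk d i)) /
        (S.pos (S.walk d (i + 1)) - S.pos (S.walk d i))) univ := by
      have : ContinuousOn (fun y : S.walkCarrier d => u y) univ :=
        S.continuousOn_u.comp continuous_subtype_val.continuousOn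
          fun y _ => S.walkCarrier_subset d y.2
      exact continuousOn_const.add ((this.sub continuousOn_const).div_const _)
    exact (h1.mono (subset_univ _)).congr fun y hy => S.time_eq hd hl i.2.1 i.2.2 hy

lemma tendsto_point {i : ℤ} (hi : 0 ≤ i) (hil : i < l) {a : ℝ} {s : Set ℝ}
    (hs : Ioo (i : ℝ) (i + 1) ∈ 𝓝[s] a) :
    Tendsto (fun t => u (S.point d t)) (𝓝[s] a) (𝓝 (S.along d i a)) := by
  refine ((S.continuous_along d i).tendsto a |>.mono_left nhdsWithin_le_nhds).congr' ?_
  filter_upwards [hs] with t ht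
  rw [S.point_eq ht.1.le ht.2.le, S.u_arc]
  refine S.along_mem_dom hd hl ⟨?_, ?_⟩ hi hil ht.1.le ht.2.le
  · exact lt_of_le_of_lt (by exact_mod_cast hi) ht.1
  · exact lt_of_lt_of_le ht.2 (by exact_mod_cast hil)

lemma isCrossingArc_walkCarrier [T2Space V] (hl0 : 0 < l) (h0 : S.pos d = -1)
    (h1 : S.pos (S.walk d l) = 1) : IsCrossingArc u (S.walkCarrier d) := by
  refine exists_homeomorph_real_of_inverse (L := l) (by exact_mod_cast hl0)
    (S.continuousOn_point hd hl) (fun s hs => (S.point_mem hd hl hs).1)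
    (S.continuousOn_time hd hl hl0) (fun y hy => (S.time_mem hd hl hl0 h0 h1 hy).1)
    (fun s hs => (S.point_mem hd hl hs).2) (fun y hy => (S.time_mem hd hl hl0 h0 h1 hy).2) ?_ ?_
  · have := S.tendsto_point hd hl (i := 0) le_rfl (by exact_mod_cast hl0) (a := 0) (s := Ioi 0)
      (by simpa using Ioo_mem_nhdsGT (zero_lt_one' ℝ))
    have h2 := S.along_left d 0
    rw [walk_zero, h0] at h2
    push_cast at h2
    rwa [h2] at this
  · have h3 : ((l - 1 : ℤ) : ℝ) + 1 = l := by push_cast; ring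
    have := S.tendsto_point hd hl (i := l - 1) (by omega) (by omega) (a := l) (s := Iio (l : ℝ))
      (by rw [h3]; exact Ioo_mem_nhdsLT (by push_cast; linarith))
    have h2 := S.along_right d (l - 1)
    rw [h3, sub_add_cancel, h1] at h2
    rwa [h2] at this

end Path

end ArcSystem

end InscribedRect


/-! ### Symmetries of order four and the number of zeros on a component. -/

namespace InscribedRect

open Set Filter Topology

namespace ArcSystem

variable {V : Type*} [TopologicalSpace V] {X : Set V} {u : V → ℝ} {ι : Type*}

/-- A free symmetry of order four of a decomposition into arcs, which changes the sign of the
coordinate. -/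
structure Symmetry (S : ArcSystem X u ι) where
  /-- The symmetry on points. -/
  map : V → V
  /-- The symmetry on arcs. -/
  perm : ι → ι
  lo_perm : ∀ p, S.lo (perm p) = -S.hi p
  hi_perm : ∀ p, S.hi (perm p) = -S.lo p
  arc_perm : ∀ p, ∀ t ∈ S.dom p, S.arc (perm p) (-t) = map (S.arc p t)
  perm_four : ∀ p, perm (perm (perm (perm p))) = p
  perm_ne : ∀ p, perm p ≠ p
  perm_perm_ne : ∀ p, perm (perm p) ≠ p
  map_ne : ∀ x ∈ X, map x ≠ x
  map_map_ne : ∀ x ∈ X, map (map x) ≠ x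

namespace Symmetry

variable {S : ArcSystem X u ι} (g : S.Symmetry)

/-- The symmetry on flags. -/
def flag (x : ι × Bool) : ι × Bool := (g.perm x.1, !x.2)

lemma flag_opp (x : ι × Bool) : g.flag (opp ι x) = opp ι (g.flag x) := rfl

lemma pos_flag (x : ι × Bool) : S.pos (g.flag x) = -S.pos x := by
  obtain ⟨p, b⟩ := x
  cases b <;> simp [pos, flag, g.lo_perm, g.hi_perm]

lemma flag_four (x : ι × Bool) : g.flag (g.flag (g.flag (g.flag x))) = x := by
  simp [flag, g.perm_four]

lemma flag_injective : Function.Injective g.flag := fun x y h => by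
  rw [← g.flag_four x, h, g.flag_four]

/-- The partner of a flag is the only other flag with the same end point, and the symmetry carries
common end points to common end points. -/
lemma flag_jump (x : ι × Bool) : g.flag (S.jump x) = S.jump (g.flag x) := by
  have hiff : S.pos (g.flag x) ∈ Ioo (-1 : ℝ) 1 ↔ S.pos x ∈ Ioo (-1 : ℝ) 1 := by
    rw [pos_flag, mem_Ioo, mem_Ioo, neg_lt_neg_iff, neg_lt, and_comm]
  by_cases h : S.pos x ∈ Ioo (-1 : ℝ) 1
  · have h1 : S.pos (S.jump x) = S.pos x := S.pos_jump x
    have h2 := (S.same_end_iff (hiff.2 h) (g.flag (S.jump x))).1 (by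
      refine ⟨by rw [pos_flag, pos_flag, h1], ?_⟩
      rw [pos_flag]
      change S.arc (g.perm _) _ = S.arc (g.perm _) _
      rw [g.arc_perm _ _ ⟨h1 ▸ S.pos_mem_Icc (S.jump x), h⟩, g.arc_perm _ _ ⟨S.pos_mem_Icc x, h⟩,
        jump_apply, arc_other])
    rcases h2 with h2 | h2
    · exact absurd (g.flag_injective h2) (S.other_ne h)
    · exact h2
  · rw [(S.jump_eq_self_iff x).2 h, (S.jump_eq_self_iff _).2 (by rwa [hiff])]

lemma mem_dom_perm {p : ι} {t : ℝ} : -t ∈ S.dom (g.perm p) ↔ t ∈ S.dom p := by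
  simp only [dom, mem_inter_iff, mem_Icc, mem_Ioo, g.lo_perm, g.hi_perm]
  constructor <;> rintro ⟨⟨h1, h2⟩, h3, h4⟩ <;> refine ⟨⟨?_, ?_⟩, ?_, ?_⟩ <;> linarith

lemma image_carrier (p : ι) : g.map '' S.carrier p = S.carrier (g.perm p) := by
  ext y
  constructor
  · rintro ⟨_, ⟨t, ht, rfl⟩, rfl⟩
    exact ⟨-t, g.mem_dom_perm.2 ht, g.arc_perm p t ht⟩
  · rintro ⟨t, ht, rfl⟩
    have h : -t ∈ S.dom p := by rw [← g.mem_dom_perm, neg_neg]; exact ht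
    exact ⟨_, ⟨-t, h, rfl⟩, by rw [← g.arc_perm p _ h, neg_neg]⟩

lemma flag_walk (d : ι × Bool) (i : ℤ) : g.flag (S.walk d i) = S.walk (g.flag d) i :=
  map_step_zpow g.flag_opp g.flag_jump i d

lemma image_walkCarrier (d : ι × Bool) :
    g.map '' S.walkCarrier d = S.walkCarrier (g.flag d) := by
  simp only [walkCarrier, image_iUnion, image_carrier, ← flag_walk]
  rfl

lemma flag_ne_opp (x : ι × Bool) : g.flag x ≠ opp ι x := fun h => g.perm_ne x.1 (congrArg Prod.fst h)

lemma flag_flag_ne (x : ι × Bool) : g.flag (g.flag x) ≠ x := fun h =>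
  g.perm_perm_ne x.1 (congrArg Prod.fst h)

lemma flag_flag_ne_opp (x : ι × Bool) : g.flag (g.flag x) ≠ opp ι x := fun h =>
  g.perm_perm_ne x.1 (congrArg Prod.fst h)

/-- A junction whose two flags are exchanged would be a point fixed by the symmetry. At a free end
the symmetry would fix a piece instead. -/
lemma flag_ne_jump (x : ι × Bool) : g.flag x ≠ S.jump x := by
  intro h
  by_cases hx : S.pos x ∈ Ioo (-1 : ℝ) 1
  · have h1 : -S.pos x = S.pos x := by rw [← pos_flag, h, pos_jump]
    have h2 : S.arc (g.perm x.1) (-S.pos x) = S.arc x.1 (S.pos x) := by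
      rw [← S.arc_other x, ← jump_apply, ← h, h1]; rfl
    rw [g.arc_perm _ _ ⟨S.pos_mem_Icc x, hx⟩] at h2
    exact g.map_ne _ (S.arc_mem _ _ ⟨S.pos_mem_Icc x, hx⟩) h2
  · rw [(S.jump_eq_self_iff x).2 hx] at h
    exact g.perm_ne x.1 (congrArg Prod.fst h)

lemma flag_flag_ne_jump (x : ι × Bool) : g.flag (g.flag x) ≠ S.jump x := by
  intro h
  by_cases hx : S.pos x ∈ Ioo (-1 : ℝ) 1
  · have hd : S.pos x ∈ S.dom x.1 := ⟨S.pos_mem_Icc x, hx⟩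
    have h2 : S.arc (g.perm (g.perm x.1)) (S.pos x) = S.arc x.1 (S.pos x) := by
      rw [← S.arc_other x, ← jump_apply, ← h]; rfl
    have h3 := g.arc_perm (g.perm x.1) (-S.pos x) (g.mem_dom_perm.2 hd)
    rw [neg_neg, g.arc_perm _ _ hd, h2] at h3
    exact g.map_map_ne _ (S.arc_mem _ _ hd) h3.symm
  · rw [(S.jump_eq_self_iff x).2 hx] at h
    exact g.flag_flag_ne x h

lemma neg_flag (x : ι × Bool) : S.Neg (g.flag x) ↔ ¬ S.Neg x := by
  have : S.pos x ≠ 0 := by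
    obtain ⟨p, b⟩ := x
    cases b
    · exact S.lo_ne_zero p
    · exact S.hi_ne_zero p
  rw [Neg, Neg, pos_flag, neg_lt_zero, not_lt]
  exact ⟨le_of_lt, fun h => lt_of_le_of_ne h this.symm⟩

lemma neg_flag_flag (x : ι × Bool) : S.Neg (g.flag (g.flag x)) ↔ S.Neg x := by
  rw [neg_flag, neg_flag, not_not]

end Symmetry

variable (S : ArcSystem X u ι)

lemma jump_eq_self_cases {x : ι × Bool} (h : S.jump x = x) : S.pos x = -1 ∨ S.pos x = 1 := by
  rw [jump_eq_self_iff, mem_Ioo, not_and_or, not_lt, not_lt] at h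
  have h1 := S.pos_mem_Icc x
  rcases h with h | h
  · exact Or.inl (le_antisymm h ((S.neg_one_le_lo _).trans h1.1))
  · exact Or.inr (le_antisymm (h1.2.trans (S.hi_le_one _)) h)

lemma walk_natCast (d : ι × Bool) (k : ℕ) : S.walk d k = (step (opp ι) S.jump ^ k) d := by
  rw [walk, zpow_natCast]

/-- A walk that is mapped into itself moves a flag to another flag of the same walk. -/
lemma exists_pow_of_walkCarrier_eq [Finite ι] {d : ι × Bool} {f : ι × Bool → ι × Bool}
    (h : S.walkCarrier (f d) = S.walkCarrier d)
    (hf : ∀ k : ℤ, f d ≠ opp ι ((step (opp ι) S.jump ^ k) d)) :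
    ∃ k : ℕ, f d = (step (opp ι) S.jump ^ k) d := by
  have h1 : S.carrier (f d).1 ⊆ S.walkCarrier d := by
    rw [← h]; exact subset_iUnion (fun i : ℤ => S.carrier (S.walk (f d) i).1) 0
  obtain ⟨k, hk⟩ := S.exists_walk_of_carrier_subset h1
  rcases eq_or_eq_opp hk.symm with h2 | h2
  · have hn := minimalPeriod_step_pos (r := opp ι) (j := S.jump) d
    refine ⟨(k % (Function.minimalPeriod (step (opp ι) S.jump) d : ℤ)).toNat, ?_⟩
    rw [h2, ← zpow_natCast, Int.toNat_of_nonneg (Int.emod_nonneg _ (by omega)), walk,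
      step_zpow_eq_zpow_iff]
    exact Int.dvd_self_sub_emod
  · exact absurd h2 (hf k)

/-- A crossing arc contains arcs that run to both ends of the interval. -/
lemma exists_free_of_isCrossingArc [Finite ι] {d : ι × Bool} (h : IsCrossingArc u (S.walkCarrier d)) :
    (∃ i, S.lo (S.walk d i).1 = -1) ∧ ∃ i, S.hi (S.walk d i).1 = 1 := by
  obtain ⟨e, h1, h2⟩ := h
  have hfin : (range fun i : ℤ => (S.walk d i).1).Finite := toFinite _
  constructor
  · by_contra! hne
    -- Otherwise the least lower end of the finitely many pieces would bound `u` away from `-1`.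
    obtain ⟨p, ⟨i, rfl⟩, hp⟩ := hfin.exists_minimalFor S.lo _ (range_nonempty _)
    have hlt : -1 < S.lo (S.walk d i).1 := lt_of_le_of_ne (S.neg_one_le_lo _) (hne i).symm
    obtain ⟨t, ht⟩ := (h1.eventually (gt_mem_nhds hlt)).exists
    obtain ⟨k, hk⟩ := mem_iUnion.1 (e t).2
    have h3 := (S.mem_carrier_iff.1 hk).2.1.1
    have h4 : S.lo (S.walk d i).1 ≤ S.lo (S.walk d k).1 := by
      by_contra! h5
      exact absurd (hp ⟨k, rfl⟩ h5.le) h5.not_ge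
    linarith
  · by_contra! hne
    obtain ⟨p, ⟨i, rfl⟩, hp⟩ := hfin.exists_maximalFor S.hi _ (range_nonempty _)
    have hlt : S.hi (S.walk d i).1 < 1 := lt_of_le_of_ne (S.hi_le_one _) (hne i)
    obtain ⟨t, ht⟩ := (h2.eventually (lt_mem_nhds hlt)).exists
    obtain ⟨k, hk⟩ := mem_iUnion.1 (e t).2
    have h3 := (S.mem_carrier_iff.1 hk).2.1.2
    have h4 : S.hi (S.walk d k).1 ≤ S.hi (S.walk d i).1 := by
      by_contra! h5
      exact absurd (hp ⟨k, rfl⟩ h5.le) h5.not_ge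
    linarith

section Cycle

variable [Finite ι] {d : ι × Bool} (hd : ∀ i : ℤ, S.jump (S.walk d i) ≠ S.walk d i)
include hd

/-- Without free ends the walk never meets the opposite flag of one of its pieces, so one period
visits every piece exactly once. -/
lemma ncard_zeros_cycle : {y ∈ S.walkCarrier d | u y = 0}.ncard =
    crossingsUpTo (opp ι) S.jump S.Neg d (Function.minimalPeriod (step (opp ι) S.jump) d) := by
  set n := Function.minimalPeriod (step (opp ι) S.jump) d with hn
  have hpos : 0 < n := minimalPeriod_step_pos d
  have key : ∀ i k : ℤ, (S.walk d i).1 = (S.walk d k).1 → (n : ℤ) ∣ i - k := fun i k h =>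
    (cycle_piece_eq_iff opp_opp S.jump_jump opp_ne hd k i).1 (eq_or_eq_opp h)
  apply S.ncard_zeros
  · intro i k hi hk h
    have := Int.eq_zero_of_abs_lt_dvd (key i k h) (by rw [abs_lt]; omega)
    omega
  · intro i
    have h0 := Int.emod_nonneg i (b := n) (by omega)
    have h1 := Int.emod_lt_of_pos i (b := n) (by omega)
    refine ⟨(i % n).toNat, by omega, ?_⟩
    rw [Int.toNat_of_nonneg h0]
    have : S.walk d i = S.walk d (i % n) := by
      rw [walk, walk, step_zpow_eq_zpow_iff]
      exact Int.dvd_self_sub_emod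
    rw [this]

lemma not_isCrossingArc_cycle : ¬ IsCrossingArc u (S.walkCarrier d) := by
  intro h
  obtain ⟨⟨i, hi⟩, -⟩ := S.exists_free_of_isCrossingArc h
  rcases S.pos_walk_cases d i with ⟨h1, -⟩ | ⟨-, h1⟩
  · apply hd i
    rw [jump_eq_self_iff, h1, hi]; simp
  · apply hd (i + 1)
    rw [jump_eq_self_iff, h1, hi]; simp

end Cycle

section Path

variable {d : ι × Bool} {l : ℕ} (hd : S.jump d = d) (hl0 : 0 < l)
  (hl : Function.minimalPeriod (step (opp ι) S.jump) d = 2 * l)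
include hd hl0 hl

/-- The period `2 * l` runs through the path and back; its first half visits every piece once. -/
lemma ncard_zeros_path : {y ∈ S.walkCarrier d | u y = 0}.ncard =
    crossingsUpTo (opp ι) S.jump S.Neg d l := by
  apply S.ncard_zeros
  · intro i k hi hk h
    have := (path_piece_eq_iff opp_opp S.jump_jump hd hl k i (by omega) (by omega)).1
      (eq_or_eq_opp h)
    omega
  · intro i
    obtain ⟨k, hk, h⟩ := path_piece_cover opp_opp S.jump_jump hd hl hl0 i
    refine ⟨k, hk, ?_⟩
    rcases h with h | h
    · exact congrArg Prod.fst h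
    · exact (congrArg Prod.fst h :)

lemma path_isCrossingArc_iff [Finite ι] [T2Space V] :
    IsCrossingArc u (S.walkCarrier d) ↔ ¬ (S.Neg d ↔ S.Neg (S.walk d l)) := by
  have hend : ∀ i : ℤ, S.jump (S.walk d i) = S.walk d i ↔ (l : ℤ) ∣ i :=
    path_end_iff opp_opp S.jump_jump hd hl
  have hl1 : S.jump (S.walk d l) = S.walk d l := (hend l).2 dvd_rfl
  have hper : S.walk d (l + l) = d := by
    rw [walk, step_zpow_eq_iff, hl]; exact ⟨1, by push_cast; ring⟩
  have hneg : ∀ x, S.jump x = x → (S.Neg x ↔ S.pos x = -1) := by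
    intro x hx
    rcases S.jump_eq_self_cases hx with h | h <;> rw [Neg, h] <;> norm_num
  rw [hneg _ hd, hneg _ hl1]
  constructor
  · intro h heq
    obtain ⟨⟨i, hi⟩, ⟨k, hk⟩⟩ := S.exists_free_of_isCrossingArc h
    -- All free ends of the walk are at `d` or at index `l`. If these two lie on the same side, the
    -- walk cannot reach both `-1` and `1`.
    have hwalk : ∀ i : ℤ, (l : ℤ) ∣ i → S.pos (S.walk d i) = S.pos d := by
      have h1 : S.pos (S.walk d l) = S.pos d := by
        rcases S.jump_eq_self_cases hd with h1 | h1 <;>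
          rcases S.jump_eq_self_cases hl1 with h2 | h2 <;> rw [h1, h2] at heq ⊢ <;> norm_num at heq
      rintro i ⟨c, rfl⟩
      obtain ⟨b, rfl | rfl⟩ := Int.even_or_odd' c
      · have : S.walk d (l * (2 * b)) = d := by
          rw [walk, step_zpow_eq_iff, hl]; exact ⟨b, by push_cast; ring⟩
        rw [this]
      · have : S.walk d (l * (2 * b + 1)) = S.walk d l := by
          rw [walk, walk, step_zpow_eq_zpow_iff, hl]; exact ⟨b, by push_cast; ring⟩
        rw [this, h1]
    have h1 : S.pos d = -1 := by
      rcases S.pos_walk_cases d i with ⟨h1, -⟩ | ⟨-, h1⟩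
      · rw [hi] at h1
        rw [← hwalk i, h1]
        rw [← hend, jump_eq_self_iff, h1]; simp
      · rw [hi] at h1
        rw [← hwalk (i + 1), h1]
        rw [← hend, jump_eq_self_iff, h1]; simp
    have h2 : S.pos d = 1 := by
      rcases S.pos_walk_cases d k with ⟨-, h1⟩ | ⟨h1, -⟩
      · rw [hk] at h1
        rw [← hwalk (k + 1), h1]
        rw [← hend, jump_eq_self_iff, h1]; simp
      · rw [hk] at h1
        rw [← hwalk k, h1]
        rw [← hend, jump_eq_self_iff, h1]; simp
    rw [h1] at h2
    norm_num at h2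
  · intro h
    rcases S.jump_eq_self_cases hd with h1 | h1 <;> rcases S.jump_eq_self_cases hl1 with h2 | h2
    · rw [h1, h2] at h; simp at h
    · exact S.isCrossingArc_walkCarrier hd hl hl0 h1 h2
    -- Here `d` lies over `1`; the path is traversed from its other end.
    · rw [← S.walkCarrier_walk d l]
      refine S.isCrossingArc_walkCarrier (l := l) hl1 ?_ hl0 h2 ?_
      · rw [← hl]
        apply Nat.dvd_antisymm
        · rw [← Int.natCast_dvd_natCast, ← step_zpow_eq_iff]
          change S.walk (S.walk d l) _ = _
          rw [walk_walk, hl, walk, walk, step_zpow_eq_zpow_iff, hl]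
          exact ⟨1, by push_cast; ring⟩
        · rw [← Int.natCast_dvd_natCast, ← step_zpow_eq_iff]
          have h3 : S.walk (S.walk d l) (Function.minimalPeriod (step (opp ι) S.jump) (S.walk d l)) =
            S.walk d l := (step_zpow_eq_iff _ _).2 dvd_rfl
          rw [walk_walk, walk, walk, step_zpow_eq_zpow_iff, add_sub_cancel_right] at h3
          rwa [step_zpow_eq_iff]
      · rw [walk_walk, hper, h1]
    · rw [h1, h2] at h; simp at h

end Path

variable {S}

/-- The number of zeros of the coordinate on a connected component, in terms of the way in which
the symmetry acts on the component. -/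
theorem Symmetry.component_zeros [Finite ι] [T2Space V] (g : S.Symmetry) {x : V} (hx : x ∈ X) {A : Set V}
    (hA : A = connectedComponentIn X x) :
    (IsCrossingArc u A → Odd {y ∈ A | u y = 0}.ncard ∧ g.map '' A ≠ A ∧
      g.map '' (g.map '' A) ≠ A) ∧
    (¬ IsCrossingArc u A → Even {y ∈ A | u y = 0}.ncard) ∧
    (g.map '' A = A → {y ∈ A | u y = 0}.ncard ≡ 4 [MOD 8]) ∧
    (g.map '' (g.map '' A) = A → 4 ∣ {y ∈ A | u y = 0}.ncard) := by
  obtain ⟨d, hd⟩ := S.exists_walkCarrier_eq hx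
  rw [hd] at hA
  have hgg : ∀ x, g.flag (g.flag (opp ι x)) = opp ι (g.flag (g.flag x)) := fun x => by
    rw [g.flag_opp, g.flag_opp]
  have hgg' : ∀ x, g.flag (g.flag (S.jump x)) = S.jump (g.flag (g.flag x)) := fun x => by
    rw [g.flag_jump, g.flag_jump]
  clear hd hx
  -- The component is a path if its walk meets a free end, which then serves as the starting flag;
  -- otherwise it is a cycle.
  by_cases hfree : ∃ i, S.jump (S.walk d i) = S.walk d i
  · obtain ⟨i, hi⟩ := hfree
    rw [← S.walkCarrier_walk d i] at hA
    generalize S.walk d i = d at *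
    obtain ⟨l, hl0, hl⟩ := path_even opp_opp S.jump_jump hi opp_ne
    have hstab1 : g.map '' A ≠ A := by
      rw [hA, g.image_walkCarrier]
      intro h
      obtain ⟨k, hk⟩ := S.exists_pow_of_walkCarrier_eq (f := g.flag) h
        (map_ne_opposite_step opp_opp S.jump_jump g.flag_opp g.flag_jump g.flag_ne_opp
          g.flag_ne_jump d)
      rw [← zpow_natCast] at hk
      exact path_map_ne opp_opp S.jump_jump hi g.flag_opp g.flag_jump g.flag_ne_opp
          g.flag_ne_jump k hk
    have hstab2 : g.map '' (g.map '' A) ≠ A := by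
      rw [hA, g.image_walkCarrier, g.image_walkCarrier]
      intro h
      obtain ⟨k, hk⟩ := S.exists_pow_of_walkCarrier_eq (f := fun x => g.flag (g.flag x)) h
        (map_ne_opposite_step opp_opp S.jump_jump hgg hgg' g.flag_flag_ne_opp
          g.flag_flag_ne_jump d)
      rw [← zpow_natCast] at hk
      exact path_map_ne opp_opp S.jump_jump hi hgg hgg' g.flag_flag_ne_opp
          g.flag_flag_ne_jump k hk
    have heven : Even {y ∈ A | u y = 0}.ncard ↔ (S.Neg d ↔ S.Neg (S.walk d l)) := by
      rw [hA, S.ncard_zeros_path hi hl0 hl, crossingsUpTo_even_iff S.neg_jump, walk_natCast]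
    have hiff : IsCrossingArc u A ↔ ¬ (S.Neg d ↔ S.Neg (S.walk d l)) := by
      rw [hA]; exact S.path_isCrossingArc_iff hi hl0 hl
    refine ⟨fun h => ⟨?_, hstab1, hstab2⟩, fun h => ?_, fun h => absurd h hstab1,
      fun h => absurd h hstab2⟩
    · rw [← Nat.not_even_iff_odd, heven]; exact hiff.1 h
    · rw [heven]; rw [hiff] at h; exact not_not.1 h
  · push Not at hfree
    have hno : ¬ IsCrossingArc u A := hA ▸ S.not_isCrossingArc_cycle hfree
    have hcard := S.ncard_zeros_cycle hfree
    rw [← hA] at hcard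
    rw [hcard]
    refine ⟨fun h => absurd h hno, fun _ => crossings_closed_even S.neg_jump d, fun h => ?_,
      fun h => ?_⟩
    · rw [hA, g.image_walkCarrier] at h
      obtain ⟨k, hk⟩ := S.exists_pow_of_walkCarrier_eq (f := g.flag) h
        (map_ne_opposite_step opp_opp S.jump_jump g.flag_opp g.flag_jump g.flag_ne_opp
          g.flag_ne_jump d)
      exact crossings_closed_of_order_four S.neg_jump g.flag_opp g.flag_jump g.neg_flag hk
        (g.flag_flag_ne d) (g.flag_four d)
    · rw [hA, g.image_walkCarrier, g.image_walkCarrier] at h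
      obtain ⟨k, hk⟩ := S.exists_pow_of_walkCarrier_eq (f := fun x => g.flag (g.flag x)) h
        (map_ne_opposite_step opp_opp S.jump_jump hgg hgg' g.flag_flag_ne_opp
          g.flag_flag_ne_jump d)
      exact crossings_closed_of_order_two (g := fun x => g.flag (g.flag x)) S.neg_jump hgg hgg'
        g.neg_flag_flag hk (g.flag_flag_ne d) (g.flag_four d)

end ArcSystem

end InscribedRect


namespace InscribedRect

open Set Filter Topology Polynomial

/-! ### Linear systems that depend on a parameter -/

section Pencil

variable {n : Type*} [Fintype n] [DecidableEq n] (A B : Matrix n n ℝ) (a b : n → ℝ)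

/-- The determinant of `A + t B` as a polynomial in `t`. -/
noncomputable def pencilDet : ℝ[X] := (A.map C + (X : ℝ[X]) • B.map C).det

/-- The numerators in Cramer's rule for the system `(A + t B) s = a + t b`. -/
noncomputable def pencilNum (k : n) : ℝ[X] :=
  (A.map C + (X : ℝ[X]) • B.map C).cramer (fun i => C (a i) + X * C (b i)) k

/-- The solution of the system `(A + t B) s = a + t b`. -/
noncomputable def pencilSol (k : n) (t : ℝ) : ℝ :=
  (pencilNum A B a b k).eval t / (pencilDet A B).eval t

lemma eval_pencilDet (t : ℝ) : (pencilDet A B).eval t = (A + t • B).det := by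
  rw [pencilDet, ← coe_evalRingHom, RingHom.map_det]
  congr 1
  ext i j
  simp; ring

lemma eval_pencilNum (k : n) (t : ℝ) :
    (pencilNum A B a b k).eval t = (A + t • B).cramer (a + t • b) k := by
  rw [pencilNum, Matrix.cramer_apply, Matrix.cramer_apply, ← coe_evalRingHom, RingHom.map_det]
  congr 1
  ext i j
  by_cases h : j = k
  · subst h; simp; ring
  · simp [h]; ring

lemma pencil_mulVec_eq_iff {t : ℝ} (h : (pencilDet A B).eval t ≠ 0) (s : n → ℝ) :
    (A + t • B).mulVec s = a + t • b ↔ s = fun k => pencilSol A B a b k t := by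
  rw [eval_pencilDet] at h
  have hsol : (fun k => pencilSol A B a b k t) =
      (A + t • B).det⁻¹ • (A + t • B).cramer (a + t • b) := by
    ext k
    rw [pencilSol, eval_pencilDet, eval_pencilNum, Pi.smul_apply, smul_eq_mul, div_eq_inv_mul]
  rw [hsol]
  constructor
  · intro hs
    rw [← hs, Matrix.cramer_eq_adjugate_mulVec, Matrix.mulVec_mulVec, Matrix.adjugate_mul,
      Matrix.smul_mulVec, Matrix.one_mulVec, inv_smul_smul₀ h]
  · rintro rfl
    rw [Matrix.mulVec_smul, Matrix.mulVec_cramer, inv_smul_smul₀ h]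

lemma hasDerivAt_pencilSol (k : n) {t : ℝ} (h : (pencilDet A B).eval t ≠ 0) :
    HasDerivAt (pencilSol A B a b k) (deriv (pencilSol A B a b k) t) t := by
  apply DifferentiableAt.hasDerivAt
  exact (Polynomial.differentiableAt _).div (Polynomial.differentiableAt _) h

lemma eventually_pencilDet_ne {t : ℝ} (h : (pencilDet A B).eval t ≠ 0) :
    ∀ᶠ x in 𝓝 t, (pencilDet A B).eval x ≠ 0 :=
  (pencilDet A B).continuous.continuousAt.eventually_ne h

end Pencil

/-! ### The equations of a rectangle -/

/-- The constant part of the linear equations for rectangles. -/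
noncomputable def rectForm₀ : (Fin 4 → ℂ) →ₗ[ℝ] Fin 4 → ℝ where
  toFun R := ![(R 3 - R 0 - (R 2 - R 1)).re, (R 3 - R 0 - (R 2 - R 1)).im,
    (R 2 - R 1 - Complex.I * (R 1 - R 0)).re, (R 2 - R 1 - Complex.I * (R 1 - R 0)).im]
  map_add' R R' := by ext i; fin_cases i <;> simp <;> ring
  map_smul' c R := by ext i; fin_cases i <;> simp <;> ring

/-- The part of the linear equations for rectangles that is multiplied by the parameter. -/
noncomputable def rectForm₁ : (Fin 4 → ℂ) →ₗ[ℝ] Fin 4 → ℝ where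
  toFun R := ![0, 0, (-(R 2 - R 1) - Complex.I * (R 1 - R 0)).re,
    (-(R 2 - R 1) - Complex.I * (R 1 - R 0)).im]
  map_add' R R' := by ext i; fin_cases i <;> simp <;> ring
  map_smul' c R := by ext i; fin_cases i <;> simp <;> ring

/-- The equations of a (possibly degenerate) rectangle of aspect ratio `(1 + t) / (1 - t)`. -/
def RectEq (t : ℝ) (R : Fin 4 → ℂ) : Prop := rectForm₀ R + t • rectForm₁ R = 0

/-- With $\rho=(1+t)/(1-t)$ and the denominator cleared, the conditions are affine in `t`. So
Cramer's rule gives rational functions of `t`. -/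
lemma rectEq_iff (t : ℝ) (R : Fin 4 → ℂ) : RectEq t R ↔
    R 3 - R 0 = R 2 - R 1 ∧ (1 - t) * (R 2 - R 1) = Complex.I * (1 + t) * (R 1 - R 0) := by
  rw [RectEq, funext_iff, Fin.forall_fin_succ, Fin.forall_fin_succ, Fin.forall_fin_succ,
    Fin.forall_fin_one, Complex.ext_iff, Complex.ext_iff]
  simp [rectForm₀, rectForm₁]
  constructor
  · rintro ⟨h1, h2, h3, h4⟩
    refine ⟨⟨?_, ?_⟩, ?_, ?_⟩ <;> linarith
  · rintro ⟨⟨h1, h2⟩, h3, h4⟩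
    refine ⟨?_, ?_, ?_, ?_⟩ <;> linarith

lemma isRectangle_iff_rectEq {t : ℝ} (ht : t ∈ Ioo (-1 : ℝ) 1) (R : Fin 4 → ℂ) :
    IsRectangle ((1 + t) / (1 - t)) R ↔ R 0 ≠ R 1 ∧ RectEq t R := by
  have h1 : (0 : ℝ) < 1 - t := by linarith [ht.2]
  have h2 : (0 : ℝ) < 1 + t := by linarith [ht.1]
  have h3 : (1 : ℂ) - t ≠ 0 := by exact_mod_cast h1.ne'
  rw [IsRectangle, rectEq_iff]
  have h4 : R 2 - R 1 = Complex.I * ((1 + t) / (1 - t) : ℝ) * (R 1 - R 0) ↔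
      (1 - t) * (R 2 - R 1) = Complex.I * (1 + t) * (R 1 - R 0) := by
    push_cast
    constructor
    · intro h; rw [h]; field_simp
    · intro h
      rw [← mul_right_inj' h3, h]; field_simp
  rw [h4]
  have : 0 < (1 + t) / (1 - t) := by positivity
  tauto

/-- A coordinate on the space of rectangles which takes values in `(-1, 1)`. -/
noncomputable def ratioCoord (R : Fin 4 → ℂ) : ℝ :=
  (‖R 2 - R 1‖ - ‖R 1 - R 0‖) / (‖R 2 - R 1‖ + ‖R 1 - R 0‖)

lemma IsRectangle.norm_eq {ρ : ℝ} {R : Fin 4 → ℂ} (h : IsRectangle ρ R) :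
    ‖R 2 - R 1‖ = ρ * ‖R 1 - R 0‖ := by
  rw [h.2.2.1, norm_mul, norm_mul, Complex.norm_I, one_mul, Complex.norm_real, Real.norm_of_nonneg h.1.le]

lemma IsRectangle.norm_pos {ρ : ℝ} {R : Fin 4 → ℂ} (h : IsRectangle ρ R) : 0 < ‖R 1 - R 0‖ := by
  rw [norm_pos_iff, sub_ne_zero]
  exact h.2.1.symm

lemma IsRectangle.aspectRatio_eq {ρ : ℝ} {R : Fin 4 → ℂ} (h : IsRectangle ρ R) :
    aspectRatio R = ρ := by
  rw [aspectRatio, h.norm_eq, mul_div_assoc, div_self h.norm_pos.ne', mul_one]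

lemma IsRectangle.ratioCoord_eq {ρ : ℝ} {R : Fin 4 → ℂ} (h : IsRectangle ρ R) :
    ratioCoord R = (ρ - 1) / (ρ + 1) := by
  have h1 := h.norm_pos
  have h2 := h.1
  rw [ratioCoord, h.norm_eq]
  field_simp

lemma IsRectangle.ratioCoord_mem {ρ : ℝ} {R : Fin 4 → ℂ} (h : IsRectangle ρ R) :
    ratioCoord R ∈ Ioo (-1 : ℝ) 1 := by
  have h2 := h.1
  rw [h.ratioCoord_eq]
  constructor
  · rw [lt_div_iff₀ (by linarith)]; linarith
  · rw [div_lt_iff₀ (by linarith)]; linarith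

lemma IsRectangle.eq_of_ratioCoord {ρ : ℝ} {R : Fin 4 → ℂ} (h : IsRectangle ρ R) :
    ρ = (1 + ratioCoord R) / (1 - ratioCoord R) := by
  have h2 := h.1
  rw [h.ratioCoord_eq]
  have : 1 - (ρ - 1) / (ρ + 1) ≠ 0 := by
    have : (ρ - 1) / (ρ + 1) < 1 := by rw [div_lt_one (by linarith)]; linarith
    linarith
  field_simp
  ring

lemma IsRectangle.rectEq {ρ : ℝ} {R : Fin 4 → ℂ} (h : IsRectangle ρ R) :
    RectEq (ratioCoord R) R := by
  have h2 := h
  rw [h.eq_of_ratioCoord] at h2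
  exact ((isRectangle_iff_rectEq h.ratioCoord_mem R).1 h2).2

lemma ratioCoord_of_rectEq {t : ℝ} (ht : t ∈ Ioo (-1 : ℝ) 1) {R : Fin 4 → ℂ} (h0 : R 0 ≠ R 1)
    (h : RectEq t R) : ratioCoord R = t := by
  have := (isRectangle_iff_rectEq ht R).2 ⟨h0, h⟩
  rw [this.ratioCoord_eq]
  have h1 : (1 : ℝ) - t ≠ 0 := by linarith [ht.2]
  field_simp
  ring

/-! ### Rectangles on four lines -/

section Lines

variable (p v : Fin 4 → ℂ)

/-- The directions of the lines as a linear map. -/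
noncomputable def dirMap : (Fin 4 → ℝ) →ₗ[ℝ] Fin 4 → ℂ where
  toFun s k := s k • v k
  map_add' s s' := by ext k; simp [add_mul]
  map_smul' c s := by ext k; simp [mul_assoc]

/-- The constant part of the matrix of the equations in the coordinates of the four lines. -/
noncomputable def lineMat₀ : Matrix (Fin 4) (Fin 4) ℝ := LinearMap.toMatrix' (rectForm₀ ∘ₗ dirMap v)

/-- The linear part of the matrix of the equations in the coordinates of the four lines. -/
noncomputable def lineMat₁ : Matrix (Fin 4) (Fin 4) ℝ := LinearMap.toMatrix' (rectForm₁ ∘ₗ dirMap v)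

/-- The determinant of the equations for rectangles on four lines. -/
noncomputable def lineDet : ℝ[X] := pencilDet (lineMat₀ v) (lineMat₁ v)

/-- The numerators of the coordinates of the rectangle on four lines. -/
noncomputable def lineNum (k : Fin 4) : ℝ[X] :=
  pencilNum (lineMat₀ v) (lineMat₁ v) (-rectForm₀ p) (-rectForm₁ p) k

/-- The coordinates on the four lines of the rectangle with parameter `t`. -/
noncomputable def lineSol (k : Fin 4) (t : ℝ) : ℝ :=
  pencilSol (lineMat₀ v) (lineMat₁ v) (-rectForm₀ p) (-rectForm₁ p) k t

lemma lineMat_mulVec (t : ℝ) (s : Fin 4 → ℝ) : (lineMat₀ v + t • lineMat₁ v).mulVec s =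
    rectForm₀ (dirMap v s) + t • rectForm₁ (dirMap v s) := by
  rw [Matrix.add_mulVec, Matrix.smul_mulVec, lineMat₀, lineMat₁, LinearMap.toMatrix'_mulVec,
    LinearMap.toMatrix'_mulVec]
  rfl

lemma rectEq_line_iff (t : ℝ) (s : Fin 4 → ℝ) : RectEq t (p + dirMap v s) ↔
    (lineMat₀ v + t • lineMat₁ v).mulVec s = -rectForm₀ p + t • -rectForm₁ p := by
  rw [lineMat_mulVec, RectEq, map_add, map_add, smul_add, smul_neg, ← sub_eq_zero (b := _ + _)]
  abel_nf

variable {p v}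

lemma rectEq_line_iff_eq {t : ℝ} (h : (lineDet v).eval t ≠ 0) (s : Fin 4 → ℝ) :
    RectEq t (p + dirMap v s) ↔ s = fun k => lineSol p v k t := by
  rw [rectEq_line_iff]
  exact pencil_mulVec_eq_iff _ _ _ _ h s

lemma hasDerivAt_lineSol (k : Fin 4) {t : ℝ} (h : (lineDet v).eval t ≠ 0) :
    HasDerivAt (lineSol p v k) (deriv (lineSol p v k) t) t := hasDerivAt_pencilSol _ _ _ _ k h

lemma eventually_lineDet_ne {t : ℝ} (h : (lineDet v).eval t ≠ 0) :
    ∀ᶠ x in 𝓝 t, (lineDet v).eval x ≠ 0 := eventually_pencilDet_ne _ _ h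

/-- If the determinant vanishes, a rectangle on four lines is not unique. -/
lemma exists_ne_of_lineDet_eq_zero {t : ℝ} (h : (lineDet v).eval t = 0)
    {s : Fin 4 → ℝ} (hs : RectEq t (p + dirMap v s)) (h0 : (p + dirMap v s) 0 ≠ (p + dirMap v s) 1) :
    ∃ s', s' ≠ s ∧ RectEq t (p + dirMap v s') ∧ (p + dirMap v s') 0 ≠ (p + dirMap v s') 1 := by
  rw [lineDet, eval_pencilDet, ← Matrix.exists_mulVec_eq_zero_iff] at h
  obtain ⟨w, hw, hw0⟩ := h
  have h1 : ∀ c : ℝ, RectEq t (p + dirMap v (s + c • w)) := by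
    intro c
    rw [rectEq_line_iff] at hs ⊢
    rw [Matrix.mulVec_add, hs, Matrix.mulVec_smul, hw0, smul_zero, add_zero]
  have h2 : ∀ c : ℝ, c ≠ 0 → s + c • w ≠ s := by
    intro c hc h
    rw [add_eq_left, smul_eq_zero] at h
    tauto
  -- The difference of the first two vertices is affine in the multiple of the kernel vector `w` and
  -- nonzero at multiple `0`. So it cannot vanish at both `1` and `2`.
  by_cases h3 : (p + dirMap v (s + (1 : ℝ) • w)) 0 = (p + dirMap v (s + (1 : ℝ) • w)) 1
  · refine ⟨_, h2 2 two_ne_zero, h1 2, fun h4 => h0 ?_⟩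
    simp only [dirMap, Pi.add_apply, Pi.smul_apply, LinearMap.coe_mk, AddHom.coe_mk, smul_eq_mul,
      Complex.real_smul] at h3 h4 ⊢
    push_cast at h3 h4 ⊢
    linear_combination 2 * h3 - h4
  · exact ⟨_, h2 1 one_ne_zero, h1 1, h3⟩

end Lines

end InscribedRect


namespace InscribedRect

open Set Filter Topology Polynomial

variable {N : ℕ}

/-! ### Sides of a polygon -/

/-- The direction of the `i`-th side. -/
def sideDir (γ : Polygon ℂ N) (i : Fin N) : ℂ := γ (finRotate N i) - γ i

/-- The points with the coordinates `s` on a quadruple of side lines. -/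
noncomputable def quadPoint (γ : Polygon ℂ N) (e : Fin 4 → Fin N) (s : Fin 4 → ℝ) : Fin 4 → ℂ :=
  (fun k => γ (e k)) + dirMap (fun k => sideDir γ (e k)) s

/-- The determinant of the equations for rectangles on a quadruple of side lines. -/
noncomputable def quadDet (γ : Polygon ℂ N) (e : Fin 4 → Fin N) : ℝ[X] :=
  lineDet fun k => sideDir γ (e k)

/-- The coordinates of the rectangle with parameter `t` on a quadruple of side lines. -/
noncomputable def quadSol (γ : Polygon ℂ N) (e : Fin 4 → Fin N) (k : Fin 4) (t : ℝ) : ℝ :=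
  lineSol (fun k => γ (e k)) (fun k => sideDir γ (e k)) k t

/-- The rectangle with parameter `t` on a quadruple of side lines. -/
noncomputable def quadRect (γ : Polygon ℂ N) (e : Fin 4 → Fin N) (t : ℝ) : Fin 4 → ℂ :=
  quadPoint γ e fun k => quadSol γ e k t

/-- The parameters of the rectangles on a quadruple of sides. -/
def quadParams (γ : Polygon ℂ N) (e : Fin 4 → Fin N) : Set ℝ :=
  {t | t ∈ Ioo (-1 : ℝ) 1 ∧ ∃ s : Fin 4 → ℝ, (∀ k, s k ∈ Icc (0 : ℝ) 1) ∧ RectEq t (quadPoint γ e s)}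

variable {γ : Polygon ℂ N}

lemma quadPoint_apply (e : Fin 4 → Fin N) (s : Fin 4 → ℝ) (k : Fin 4) :
    quadPoint γ e s k = γ (e k) + s k * sideDir γ (e k) := by
  simp [quadPoint, dirMap]

lemma mem_edgeSet_iff {i : Fin N} {z : ℂ} :
    z ∈ γ.edgeSet ℝ i ↔ ∃ s ∈ Icc (0 : ℝ) 1, z = γ i + s * sideDir γ i := by
  rw [Polygon.edgeSet_eq_image_edgePath]
  constructor
  · rintro ⟨s, hs, rfl⟩
    exact ⟨s, hs, by simp [Polygon.edgePath, AffineMap.lineMap_apply, sideDir]; ring⟩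
  · rintro ⟨s, hs, rfl⟩
    exact ⟨s, hs, by simp [Polygon.edgePath, AffineMap.lineMap_apply, sideDir]; ring⟩

lemma mem_sideLine_iff {i : Fin N} {z : ℂ} :
    z ∈ sideLine γ i ↔ ∃ s : ℝ, z = γ i + s * sideDir γ i := by
  rw [sideLine, mem_affineSpan_pair_iff_exists_lineMap_eq]
  refine exists_congr fun s => ?_
  rw [eq_comm, AffineMap.lineMap_apply, sideDir]
  simp [add_comm]

lemma quadPoint_mem_sideLine (e : Fin 4 → Fin N) (s : Fin 4 → ℝ) (k : Fin 4) :
    quadPoint γ e s k ∈ sideLine γ (e k) := mem_sideLine_iff.2 ⟨s k, quadPoint_apply e s k⟩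

lemma forall_mem_edgeSet_iff {e : Fin 4 → Fin N} {R : Fin 4 → ℂ} :
    (∀ k, R k ∈ γ.edgeSet ℝ (e k)) ↔
      ∃ s : Fin 4 → ℝ, (∀ k, s k ∈ Icc (0 : ℝ) 1) ∧ R = quadPoint γ e s := by
  simp only [mem_edgeSet_iff]
  constructor
  · intro h
    choose s hs h using h
    exact ⟨s, hs, funext fun k => by rw [quadPoint_apply, h]⟩
  · rintro ⟨s, hs, rfl⟩ k
    exact ⟨s k, hs k, quadPoint_apply e s k⟩

lemma isAssociated_iff {e : Fin 4 → Fin N} :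
    IsAssociated e ↔ ∃ i j k, e i ≠ e j ∧ e i ≠ e k ∧ e j ≠ e k := by
  rw [IsAssociated, Nat.succ_le_iff, two_lt_ncard]
  simp only [mem_range, exists_exists_eq_and]

/-! ### Rectangles on associated quadruples of sides. -/

namespace IsGenericPolygon

variable (hγ : IsGenericPolygon γ)
include hγ

lemma sideDir_ne_zero (i : Fin N) : sideDir γ i ≠ 0 := sub_ne_zero.2 (hγ.simple.1 i).symm

lemma not_collinear {i j : Fin N} (hij : i ≠ j) (c : ℝ) : sideDir γ i ≠ c * sideDir γ j := by
  intro h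
  have hc : c ≠ 0 := by
    rintro rfl
    exact hγ.sideDir_ne_zero i (by simpa using h)
  apply hγ.not_parallel i j hij
  rw [sideLine, sideLine, AffineSubspace.affineSpan_pair_parallel_iff_vectorSpan_eq,
    vectorSpan_pair_rev, vectorSpan_pair_rev, vsub_eq_sub, vsub_eq_sub]
  change Submodule.span ℝ {sideDir γ i} = Submodule.span ℝ {sideDir γ j}
  rw [h, ← Complex.real_smul, Submodule.span_singleton_smul_eq (IsUnit.mk0 c hc)]

lemma sideLine_injective : Function.Injective (sideLine γ) := fun i j h => by
  by_contra hij
  exact hγ.not_parallel i j hij (h ▸ AffineSubspace.Parallel.refl _)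

/-- Two sides meet only in a common vertex of consecutive sides. -/
lemma eq_vertex_of_mem {i j : Fin N} (hij : i ≠ j) {z : ℂ} (hi : z ∈ γ.edgeSet ℝ i)
    (hj : z ∈ γ.edgeSet ℝ j) : (j = finRotate N i ∧ z = γ j) ∨ (i = finRotate N j ∧ z = γ i) := by
  by_cases h1 : j = finRotate N i
  · left
    have := hγ.simple.2.1 i
    rw [← h1] at this
    exact ⟨h1, by rw [← mem_singleton_iff, ← this]; exact ⟨hi, hj⟩⟩
  by_cases h2 : i = finRotate N j
  · right
    have := hγ.simple.2.1 j
    rw [← h2] at this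
    exact ⟨h2, by rw [← mem_singleton_iff, ← this]; exact ⟨hj, hi⟩⟩
  exact absurd hj (disjoint_left.1 (hγ.simple.2.2 i j hij.symm h1 h2) hi)

lemma edge_unique {i j : Fin N} {z : ℂ} (hz : z ∉ range γ.vertices) (hi : z ∈ γ.edgeSet ℝ i)
    (hj : z ∈ γ.edgeSet ℝ j) : i = j := by
  by_contra hij
  rcases hγ.eq_vertex_of_mem hij hi hj with ⟨-, rfl⟩ | ⟨-, rfl⟩ <;> exact hz ⟨_, rfl⟩

lemma vertex_mem_edgeSet_iff {i j : Fin N} :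
    γ i ∈ γ.edgeSet ℝ j ↔ j = i ∨ j = (finRotate N).symm i := by
  constructor
  · intro h
    by_cases hij : i = j
    · exact Or.inl hij.symm
    have hi : γ i ∈ γ.edgeSet ℝ i := mem_edgeSet_iff.2 ⟨0, by simp, by simp⟩
    rcases hγ.eq_vertex_of_mem hij hi h with ⟨h1, h2⟩ | ⟨h1, -⟩
    · rw [h1] at h2
      exact absurd h2 (hγ.simple.1 i)
    · right; rw [h1, Equiv.symm_apply_apply]
  · rintro (rfl | rfl)
    · exact mem_edgeSet_iff.2 ⟨0, by simp, by simp⟩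
    · exact mem_edgeSet_iff.2 ⟨1, by simp, by rw [sideDir, Equiv.apply_symm_apply]; simp⟩

lemma rotate_symm_ne (i : Fin N) : (finRotate N).symm i ≠ i := by
  intro h
  rw [Equiv.symm_apply_eq] at h
  exact hγ.simple.1 i (by rw [← h])

omit hγ in
lemma vertex_of_zero_or_one {i : Fin N} {s : ℝ} (hs : s = 0 ∨ s = 1) :
    γ i + s * sideDir γ i ∈ range γ.vertices := by
  rcases hs with rfl | rfl
  · exact ⟨i, by simp⟩
  · exact ⟨finRotate N i, by simp [sideDir]⟩

/-- The sides that contain the vertices of an inscribed rectangle form an associated quadruple. -/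
lemma isAssociated {ρ : ℝ} {R : Fin 4 → ℂ} (hR : IsRectangle ρ R) {e : Fin 4 → Fin N}
    (he : ∀ k, R k ∈ γ.edgeSet ℝ (e k)) : IsAssociated e := by
  obtain ⟨s, hs, rfl⟩ := forall_mem_edgeSet_iff.1 he
  obtain ⟨hρ, h01, h21, h30⟩ := hR
  set R := quadPoint γ e s with hRdef
  have hRk : ∀ k, R k = γ (e k) + s k * sideDir γ (e k) := quadPoint_apply e s
  have hw : R 1 - R 0 ≠ 0 := sub_ne_zero.2 h01.symm
  have hdiff : ∀ a b, e a = e b → R a - R b = (s a - s b : ℝ) * sideDir γ (e b) := by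
    intro a b h
    rw [hRk, hRk, h]; push_cast; ring
  -- Adjacent sides of a rectangle are perpendicular, so three of its vertices never lie on one
  -- line.
  have hperp : ∀ c d : ℝ, ∀ v : ℂ, R 1 - R 0 = c * v → R 2 - R 1 = d * v → False := by
    intro c d v h1 h2
    have hv : v ≠ 0 := by rintro rfl; exact hw (by simpa using h1)
    rw [h1, h2] at h21
    have h3 : (d : ℂ) = Complex.I * ρ * c := mul_right_cancel₀ hv (by linear_combination h21)
    have h4 : c = 0 := by
      have := congrArg Complex.im h3
      simp at this
      rcases this with h | h
      · exact absurd h hρ.ne'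
      · exact h
    rw [h4] at h1
    exact hw (by simpa using h1)
  have hpar : ∀ a b : Fin 4, ∀ w : ℂ, w ≠ 0 → ∀ c d : ℝ, w = c * sideDir γ (e a) →
      w = d * sideDir γ (e b) → e a = e b := by
    intro a b w hw0 c d h1 h2
    by_contra hab
    have hc : (c : ℂ) ≠ 0 := by rintro h; rw [h] at h1; exact hw0 (by simpa using h1)
    apply hγ.not_collinear hab (d / c)
    push_cast
    rw [div_mul_eq_mul_div, ← h2, h1]
    field_simp
  -- If each diagonal has both its ends on a single side of the polygon, the centre lies on both
  -- these sides, hence is a polygon vertex. That vertex is the initial point of one of the sides,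
  -- and a midpoint there forces the two ends of the diagonal to coincide.
  have hmid : ∀ a b c d : Fin 4, e a = e b → e c = e d → R a + R b = R c + R d → R a ≠ R b →
      R c ≠ R d → e a = e c := by
    intro a b c d hab hcd hsum hne1 hne2
    by_contra hac
    have m1 : (R a + R b) / 2 = γ (e a) + ((s a + s b) / 2 : ℝ) * sideDir γ (e a) := by
      rw [hRk, hRk b, ← hab]; push_cast; ring
    have m2 : (R a + R b) / 2 = γ (e c) + ((s c + s d) / 2 : ℝ) * sideDir γ (e c) := by
      rw [hsum, hRk, hRk d, ← hcd]; push_cast; ring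
    have e1 : (R a + R b) / 2 ∈ γ.edgeSet ℝ (e a) :=
      mem_edgeSet_iff.2 ⟨_, ⟨by linarith [(hs a).1, (hs b).1], by linarith [(hs a).2, (hs b).2]⟩, m1⟩
    have e2 : (R a + R b) / 2 ∈ γ.edgeSet ℝ (e c) :=
      mem_edgeSet_iff.2 ⟨_, ⟨by linarith [(hs c).1, (hs d).1], by linarith [(hs c).2, (hs d).2]⟩, m2⟩
    have key : ∀ x y : Fin 4, e x = e y → R x ≠ R y →
        (R a + R b) / 2 = γ (e x) + ((s x + s y) / 2 : ℝ) * sideDir γ (e x) →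
        (R a + R b) / 2 = γ (e x) → False := by
      intro x y hxy hne h1 h2
      rw [h2, left_eq_add, mul_eq_zero, or_iff_left (hγ.sideDir_ne_zero _)] at h1
      have h3 : (s x + s y) / 2 = 0 := by exact_mod_cast h1
      have h4 : s x = 0 := by linarith [(hs x).1, (hs y).1]
      have h5 : s y = 0 := by linarith [(hs x).1, (hs y).1]
      exact hne (by rw [hRk, hRk, hxy, h4, h5])
    rcases hγ.eq_vertex_of_mem hac e1 e2 with ⟨-, h⟩ | ⟨-, h⟩
    · exact key c d hcd hne2 m2 h
    · exact key a b hab hne1 m1 h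
  have h12 : R 2 - R 1 ≠ 0 := by
    rw [h21]
    exact mul_ne_zero (mul_ne_zero Complex.I_ne_zero (by exact_mod_cast hρ.ne')) hw
  have t012 : ¬ (e 0 = e 1 ∧ e 2 = e 1) := by
    rintro ⟨h1, h2⟩
    refine hperp (s 1 - s 0) (s 2 - s 1) (sideDir γ (e 1)) ?_ (by rw [← hdiff 2 1 h2])
    rw [hdiff 1 0 h1.symm, h1]
  have t123 : ¬ (e 1 = e 2 ∧ e 3 = e 2) := by
    rintro ⟨h1, h2⟩
    refine hperp (s 2 - s 3) (s 2 - s 1) (sideDir γ (e 2)) ?_ ?_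
    · rw [show R 1 - R 0 = R 2 - R 3 by linear_combination h30, hdiff 2 3 h2.symm, h2]
    · rw [hdiff 2 1 h1.symm, h1]
  have t230 : ¬ (e 2 = e 3 ∧ e 0 = e 3) := by
    rintro ⟨h1, h2⟩
    refine hperp (s 2 - s 3) (s 3 - s 0) (sideDir γ (e 3)) ?_ ?_
    · rw [show R 1 - R 0 = R 2 - R 3 by linear_combination h30, hdiff 2 3 h1]
    · rw [← h30, hdiff 3 0 h2.symm, h2]
  have t301 : ¬ (e 3 = e 0 ∧ e 1 = e 0) := by
    rintro ⟨h1, h2⟩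
    refine hperp (s 1 - s 0) (s 3 - s 0) (sideDir γ (e 0)) ?_ ?_
    · rw [hdiff 1 0 h2]
    · rw [← h30, hdiff 3 0 h1]
  have p1 : e 0 = e 1 → e 2 = e 3 → e 0 = e 2 := fun h1 h2 => by
    have := hpar 0 3 _ hw (s 1 - s 0) (s 2 - s 3) (by rw [hdiff 1 0 h1.symm])
      (by rw [show R 1 - R 0 = R 2 - R 3 by linear_combination h30, hdiff 2 3 h2])
    rw [this, h2]
  have p2 : e 1 = e 2 → e 3 = e 0 → e 1 = e 0 := fun h1 h2 =>
    hpar 1 0 _ h12 (s 2 - s 1) (s 3 - s 0) (by rw [hdiff 2 1 h1.symm])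
      (by rw [← h30, hdiff 3 0 h2])
  have h02 : R 0 ≠ R 2 := by
    intro h
    have h3 : (1 + Complex.I * ρ) * (R 1 - R 0) = 0 := by linear_combination -h - h21
    rcases mul_eq_zero.1 h3 with h4 | h4
    · have := congrArg Complex.re h4
      simp at this
    · exact hw h4
  have h13 : R 1 ≠ R 3 := by
    intro h
    have h3 : (1 - Complex.I * ρ) * (R 1 - R 0) = 0 := by linear_combination h + h30 + h21
    rcases mul_eq_zero.1 h3 with h4 | h4
    · have := congrArg Complex.re h4
      simp at this
    · exact hw h4
  have p3 : e 0 = e 2 → e 1 = e 3 → e 0 = e 1 := fun h1 h2 =>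
    hmid 0 2 1 3 h1 h2 (by linear_combination -h30) h02 h13
  rw [isAssociated_iff]
  -- With at most two sides, either three vertices share one (`t012` to `t301`), or they split into
  -- adjacent pairs (`p1`, `p2`) or diagonal pairs (`p3`). These splittings reduce to the first
  -- case, as `hpar` and `hmid` force equal sides.
  by_contra hcon
  push Not at hcon
  have c1 := hcon 0 1 2
  have c2 := hcon 0 1 3
  have c3 := hcon 0 2 3
  have c4 := hcon 1 2 3
  clear_value R
  clear hRdef hRk hdiff hpar hmid hperp hcon he
  grind

section Quad

variable {e : Fin 4 → Fin N} (he : IsAssociated e)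
include he

/-- A solution of the rectangle equations on an associated quadruple is nondegenerate. -/
lemma ne_of_rectEq {t : ℝ} (ht : t ∈ Ioo (-1 : ℝ) 1) {s : Fin 4 → ℝ} (h : RectEq t (quadPoint γ e s)) :
    quadPoint γ e s 0 ≠ quadPoint γ e s 1 := by
  intro h0
  obtain ⟨i, j, k, hij, hik, hjk⟩ := isAssociated_iff.1 he
  rw [rectEq_iff] at h
  have h1 : (1 : ℂ) - t ≠ 0 := by
    have : (1 : ℝ) - t ≠ 0 := by linarith [ht.2]
    exact_mod_cast this
  have h2 : quadPoint γ e s 2 = quadPoint γ e s 1 := by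
    have := h.2
    rw [h0, sub_self, mul_zero, mul_eq_zero, or_iff_right h1, sub_eq_zero] at this
    exact this
  have h3 : quadPoint γ e s 3 = quadPoint γ e s 1 := by
    have := h.1
    rw [h2, sub_self, sub_eq_zero, h0] at this
    exact this
  have hall : ∀ m, quadPoint γ e s m = quadPoint γ e s 1 := by
    intro m
    fin_cases m
    exacts [h0, rfl, h2, h3]
  -- A degenerate solution is a single point on three distinct side lines, which are not concurrent.
  refine (hγ.generic_quad e he).2.1 i j k (fun h => hij (hγ.sideLine_injective h))
    (fun h => hjk (hγ.sideLine_injective h)) (fun h => hik (hγ.sideLine_injective h))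
    (quadPoint γ e s 1) ⟨?_, ?_, ?_⟩
  · rw [← hall i]; exact quadPoint_mem_sideLine e s i
  · rw [← hall j]; exact quadPoint_mem_sideLine e s j
  · rw [← hall k]; exact quadPoint_mem_sideLine e s k

lemma mem_rectanglesOn {t : ℝ} (ht : t ∈ Ioo (-1 : ℝ) 1) {s : Fin 4 → ℝ}
    (h : RectEq t (quadPoint γ e s)) :
    quadPoint γ e s ∈ rectanglesOn (fun k => sideLine γ (e k)) ((1 + t) / (1 - t)) :=
  ⟨(isRectangle_iff_rectEq ht _).2 ⟨hγ.ne_of_rectEq he ht h, h⟩, quadPoint_mem_sideLine e s⟩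

omit he in
lemma quadPoint_injective : Function.Injective (quadPoint γ e) := by
  intro s s' h
  ext k
  have := congrFun h k
  rw [quadPoint_apply, quadPoint_apply, add_right_inj, mul_left_inj' (hγ.sideDir_ne_zero _)] at this
  exact_mod_cast this

/-- A singular system with one rectangle would have a second one of the same aspect ratio on the
same lines, against the uniqueness in a generic quad. -/
lemma quadDet_ne_zero {t : ℝ} (ht : t ∈ Ioo (-1 : ℝ) 1) {s : Fin 4 → ℝ}
    (h : RectEq t (quadPoint γ e s)) : (quadDet γ e).eval t ≠ 0 := by
  intro h0
  obtain ⟨s', hs', h1, -⟩ := exists_ne_of_lineDet_eq_zero h0 h (hγ.ne_of_rectEq he ht h)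
  have hρ : 0 < (1 + t) / (1 - t) := div_pos (by linarith [ht.1]) (by linarith [ht.2])
  exact hs' (hγ.quadPoint_injective ((hγ.generic_quad e he).2.2 _ hρ
    (hγ.mem_rectanglesOn he ht h1) (hγ.mem_rectanglesOn he ht h)))

omit hγ he in
lemma rectEq_quadPoint_iff {t : ℝ} (h : (quadDet γ e).eval t ≠ 0) (s : Fin 4 → ℝ) :
    RectEq t (quadPoint γ e s) ↔ s = fun k => quadSol γ e k t := rectEq_line_iff_eq h s

omit hγ he in
lemma rectEq_quadRect {t : ℝ} (h : (quadDet γ e).eval t ≠ 0) : RectEq t (quadRect γ e t) :=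
  (rectEq_quadPoint_iff h _).2 rfl

lemma mem_quadParams_iff {t : ℝ} : t ∈ quadParams γ e ↔ t ∈ Ioo (-1 : ℝ) 1 ∧
    (quadDet γ e).eval t ≠ 0 ∧ ∀ k, quadSol γ e k t ∈ Icc (0 : ℝ) 1 := by
  constructor
  · rintro ⟨ht, s, hs, h⟩
    have hd := hγ.quadDet_ne_zero he ht h
    rw [rectEq_quadPoint_iff hd] at h
    exact ⟨ht, hd, fun k => by simpa [h] using hs k⟩
  · rintro ⟨ht, hd, h⟩
    exact ⟨ht, _, h, rectEq_quadRect hd⟩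

lemma quadRect_mem_edgeSet {t : ℝ} (ht : t ∈ quadParams γ e) (k : Fin 4) :
    quadRect γ e t k ∈ γ.edgeSet ℝ (e k) :=
  forall_mem_edgeSet_iff.2 ⟨_, ((hγ.mem_quadParams_iff he).1 ht).2.2, rfl⟩ k

lemma quadRect_mem_inscribed {t : ℝ} (ht : t ∈ quadParams γ e) : quadRect γ e t ∈ inscribed γ := by
  have h := (hγ.mem_quadParams_iff he).1 ht
  exact ⟨⟨_, (hγ.mem_rectanglesOn he h.1 (rectEq_quadRect h.2.1)).1⟩,
    fun k => mem_iUnion.2 ⟨_, hγ.quadRect_mem_edgeSet he ht k⟩⟩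

lemma ratioCoord_quadRect {t : ℝ} (ht : t ∈ quadParams γ e) : ratioCoord (quadRect γ e t) = t := by
  have h := (hγ.mem_quadParams_iff he).1 ht
  exact ratioCoord_of_rectEq h.1 (hγ.ne_of_rectEq he h.1 (rectEq_quadRect h.2.1))
    (rectEq_quadRect h.2.1)

end Quad

/-- Every inscribed rectangle is recovered from its parameter and any choice of sides containing its
vertices. So $I(\gamma)$ is covered by the curves `quadRect`. -/
lemma ratioCoord_mem_quadParams {R : Fin 4 → ℂ} (hR : R ∈ inscribed γ) {e : Fin 4 → Fin N}
    (he : ∀ k, R k ∈ γ.edgeSet ℝ (e k)) :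
    IsAssociated e ∧ ratioCoord R ∈ quadParams γ e ∧ quadRect γ e (ratioCoord R) = R := by
  obtain ⟨⟨ρ, hρ⟩, -⟩ := hR
  have ha := hγ.isAssociated hρ he
  obtain ⟨s, hs, rfl⟩ := forall_mem_edgeSet_iff.1 he
  have hmem : ratioCoord (quadPoint γ e s) ∈ quadParams γ e := ⟨hρ.ratioCoord_mem, s, hs, hρ.rectEq⟩
  refine ⟨ha, hmem, ?_⟩
  have := (rectEq_quadPoint_iff ((hγ.mem_quadParams_iff ha).1 hmem).2.1 s).1 hρ.rectEq
  rw [quadRect, ← this]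

omit hγ in
lemma exists_quad {R : Fin 4 → ℂ} (hR : R ∈ inscribed γ) :
    ∃ e : Fin 4 → Fin N, ∀ k, R k ∈ γ.edgeSet ℝ (e k) := by
  have h : ∀ k, ∃ i, R k ∈ γ.edgeSet ℝ i := fun k => mem_iUnion.1 (hR.2 k)
  choose e he using h
  exact ⟨e, he⟩

end IsGenericPolygon

end InscribedRect


namespace InscribedRect

open Set Filter Topology Polynomial

variable {N : ℕ} {γ : Polygon ℂ N}

/-! ### Gaps of a finite set -/

/-- `lo` and `hi` are consecutive points of the set `B` to which `-1` and `1` are added. -/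
def IsGap (B : Set ℝ) (lo hi : ℝ) : Prop :=
  lo < hi ∧ lo ∈ insert (-1) (insert 1 B) ∧ hi ∈ insert (-1) (insert 1 B) ∧
    ∀ b ∈ insert (-1) (insert 1 B), b ≤ lo ∨ hi ≤ b

section Gap

variable {B : Set ℝ}

lemma exists_isGap_above (hB : B.Finite) {b : ℝ} (hb : b ∈ insert (-1) (insert 1 B)) (h1 : b < 1) :
    ∃ hi, IsGap B b hi := by
  have hfin : (insert (-1) (insert 1 B) ∩ Ioi b).Finite := ((hB.insert _).insert _).inter_of_left _
  obtain ⟨hi, hhi, hmin⟩ := hfin.exists_minimal ⟨1, by simp, h1⟩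
  refine ⟨hi, hhi.2, hb, hhi.1, fun c hc => ?_⟩
  by_contra! h
  exact absurd (hmin ⟨hc, h.1⟩ h.2.le) h.2.not_ge

lemma exists_isGap_below (hB : B.Finite) {b : ℝ} (hb : b ∈ insert (-1) (insert 1 B)) (h1 : -1 < b) :
    ∃ lo, IsGap B lo b := by
  have hfin : (insert (-1) (insert 1 B) ∩ Iio b).Finite := ((hB.insert _).insert _).inter_of_left _
  obtain ⟨lo, hlo, hmax⟩ := hfin.exists_maximal ⟨-1, by simp, h1⟩
  refine ⟨lo, hlo.2, hlo.1, hb, fun c hc => ?_⟩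
  by_contra! h
  exact absurd (hmax ⟨hc, h.2⟩ h.1.le) h.1.not_ge

lemma exists_isGap_around (hB : B.Finite) {t : ℝ} (ht : t ∈ Ioo (-1 : ℝ) 1) (htB : t ∉ B) :
    ∃ lo hi, IsGap B lo hi ∧ t ∈ Ioo lo hi := by
  have hfin : (insert (-1) (insert 1 B) ∩ Iio t).Finite := ((hB.insert _).insert _).inter_of_left _
  obtain ⟨lo, hlo, hmax⟩ := hfin.exists_maximal ⟨-1, by simp, ht.1⟩
  have hlo1 : lo < 1 := lt_trans hlo.2 ht.2
  obtain ⟨hi, h⟩ := exists_isGap_above hB hlo.1 hlo1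
  refine ⟨lo, hi, h, hlo.2, ?_⟩
  have hne : hi ≠ t := by
    rintro rfl
    rcases h.2.2.1 with h | h | h
    · exact ht.1.ne' h
    · exact ht.2.ne h
    · exact htB h
  by_contra! hle
  have hlt := lt_of_le_of_ne hle hne
  exact absurd (hmax ⟨h.2.2.1, hlt⟩ h.1.le) h.1.not_ge

lemma IsGap.hi_unique {lo hi hi' : ℝ} (h : IsGap B lo hi) (h' : IsGap B lo hi') : hi = hi' := by
  have h1 := h.2.2.2 hi' h'.2.2.1
  have h2 := h'.2.2.2 hi h.2.2.1
  have h3 := h.1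
  have h4 := h'.1
  rcases h1 with h1 | h1 <;> rcases h2 with h2 | h2 <;> linarith

lemma IsGap.lo_unique {lo lo' hi : ℝ} (h : IsGap B lo hi) (h' : IsGap B lo' hi) : lo = lo' := by
  have h1 := h.2.2.2 lo' h'.2.1
  have h2 := h'.2.2.2 lo h.2.1
  have h3 := h.1
  have h4 := h'.1
  rcases h1 with h1 | h1 <;> rcases h2 with h2 | h2 <;> linarith

lemma IsGap.notMem {lo hi t : ℝ} (h : IsGap B lo hi) (ht : t ∈ Ioo lo hi) :
    t ∉ insert (-1) (insert 1 B) := fun hb => by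
  rcases h.2.2.2 t hb with h1 | h1
  · exact absurd ht.1 h1.not_gt
  · exact absurd ht.2 h1.not_gt

lemma IsGap.eq_of_mem {lo hi lo' hi' t : ℝ} (h : IsGap B lo hi) (h' : IsGap B lo' hi')
    (ht : t ∈ Ioo lo hi) (ht' : t ∈ Icc lo' hi') : lo = lo' ∧ hi = hi' := by
  have hlo : lo' < t := lt_of_le_of_ne ht'.1 fun h0 => h.notMem ht (h0 ▸ h'.2.1)
  have h1 := h.2.2.2 lo' h'.2.1
  have h2 := h'.2.2.2 lo h.2.1
  have : lo = lo' := by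
    rcases h1 with h1 | h1 <;> rcases h2 with h2 | h2 <;> linarith [ht.1, ht.2, ht'.1, ht'.2]
  subst this
  exact ⟨rfl, h.hi_unique h'⟩

lemma IsGap.neg {lo hi : ℝ} (hB : ∀ b ∈ B, -b ∈ B) (h : IsGap B lo hi) : IsGap B (-hi) (-lo) := by
  have key : ∀ b ∈ insert (-1) (insert 1 B), -b ∈ insert (-1) (insert 1 B) := by
    rintro b (rfl | rfl | h)
    · simp
    · simp
    · exact Or.inr (Or.inr (hB b h))
  refine ⟨neg_lt_neg h.1, key _ h.2.2.1, key _ h.2.1, fun b hb => ?_⟩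
  have := h.2.2.2 _ (key b hb)
  rcases this with h1 | h1
  · right; linarith
  · left; linarith

lemma IsGap.subset {lo hi : ℝ} (hB : B ⊆ Ioo (-1) 1) (h : IsGap B lo hi) : -1 ≤ lo ∧ hi ≤ 1 := by
  constructor
  · rcases h.2.1 with h | h | h
    · exact h.ge
    · linarith
    · exact (hB h).1.le
  · rcases h.2.2.1 with h | h | h
    · linarith
    · exact h.le
    · exact (hB h).2.le

end Gap

/-! ### The parameters at which vertices of the polygon are met -/

/-- The parameters of the inscribed rectangles with a vertex at a vertex of the polygon. -/
def vertexParams (γ : Polygon ℂ N) : Set ℝ :=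
  {t | ∃ R ∈ inscribed γ, ratioCoord R = t ∧ ∃ k, R k ∈ range γ.vertices}

lemma isClosed_rectEq (e : Fin 4 → Fin N) :
    IsClosed {x : ℝ × (Fin 4 → ℝ) | RectEq x.1 (quadPoint γ e x.2)} := by
  simp only [rectEq_iff, quadPoint_apply]
  refine IsClosed.inter (isClosed_eq ?_ ?_) (isClosed_eq ?_ ?_) <;> fun_prop

/-- The coordinates stay in the compact cube $[0,1]^4$ and the equations are closed, so solutions
survive in the limit. Nonvanishing of the determinant is not needed. -/
lemma mem_quadParams_of_closure {e : Fin 4 → Fin N} {t : ℝ} (ht : t ∈ Ioo (-1 : ℝ) 1)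
    (hcl : t ∈ closure (quadParams γ e)) : t ∈ quadParams γ e := by
  have hK : IsCompact ({x : ℝ × (Fin 4 → ℝ) | RectEq x.1 (quadPoint γ e x.2)} ∩
      (Icc (-1) 1 ×ˢ Set.pi univ fun _ => Icc (0 : ℝ) 1)) :=
    (isCompact_Icc.prod (isCompact_univ_pi fun _ => isCompact_Icc)).inter_left (isClosed_rectEq e)
  have hcl2 := (hK.image continuous_fst).isClosed
  have hsub : quadParams γ e ⊆ Prod.fst '' ({x : ℝ × (Fin 4 → ℝ) | RectEq x.1 (quadPoint γ e x.2)} ∩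
      (Icc (-1) 1 ×ˢ Set.pi univ fun _ => Icc (0 : ℝ) 1)) := by
    rintro x ⟨hx, s, hs, h⟩
    exact ⟨(x, s), ⟨h, Ioo_subset_Icc_self hx, fun k _ => hs k⟩, rfl⟩
  obtain ⟨⟨x, s⟩, ⟨h, -, hs⟩, rfl⟩ := closure_minimal hsub hcl2 hcl
  exact ⟨ht, s, fun k => hs k (mem_univ k), h⟩

/-! ### Rectangle curves near polygon vertices. -/

namespace IsGenericPolygon

variable (hγ : IsGenericPolygon γ)
include hγ

lemma coord_eq_of_vertex {i : Fin N} {s : ℝ} (hs : s ∈ Icc (0 : ℝ) 1)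
    (h : γ i + s * sideDir γ i ∈ range γ.vertices) : s = 0 ∨ s = 1 := by
  obtain ⟨j, hj⟩ := h
  have hmem : γ j ∈ γ.edgeSet ℝ i := mem_edgeSet_iff.2 ⟨s, hs, hj⟩
  have hd := hγ.sideDir_ne_zero i
  rcases hγ.vertex_mem_edgeSet_iff.1 hmem with rfl | rfl
  · left
    rw [left_eq_add, mul_eq_zero, or_iff_left hd] at hj
    exact_mod_cast hj
  · right
    have h1 : γ j = γ ((finRotate N).symm j) + 1 * sideDir γ ((finRotate N).symm j) := by
      rw [sideDir, Equiv.apply_symm_apply]; ring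
    rw [h1, add_right_inj, mul_left_inj' hd] at hj
    exact_mod_cast hj.symm

section Quad

variable {e : Fin 4 → Fin N} (he : IsAssociated e)
include he

lemma quadRect_apply_vertex_iff {t : ℝ} (ht : t ∈ quadParams γ e) (k : Fin 4) :
    quadRect γ e t k ∈ range γ.vertices ↔ quadSol γ e k t = 0 ∨ quadSol γ e k t = 1 := by
  rw [quadRect, quadPoint_apply]
  exact ⟨hγ.coord_eq_of_vertex (((hγ.mem_quadParams_iff he).1 ht).2.2 k), vertex_of_zero_or_one⟩

omit hγ he in
lemma hasDerivAt_quadSol {t : ℝ} (h : (quadDet γ e).eval t ≠ 0) (k : Fin 4) :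
    HasDerivAt (quadSol γ e k) (deriv (quadSol γ e k) t) t := hasDerivAt_lineSol k h

/-- The rectangle on a quadruple of lines moves with nonzero speed through a vertex. -/
lemma deriv_quadSol_ne_zero {t : ℝ} (ht : t ∈ quadParams γ e) {k : Fin 4}
    (hk : quadRect γ e t k ∈ range γ.vertices) : deriv (quadSol γ e k) t ≠ 0 := by
  intro h0
  obtain ⟨i, hi⟩ := hk
  have hp := (hγ.mem_quadParams_iff he).1 ht
  have h1 : 0 < 1 - t := by linarith [hp.1.2]
  have h2 : 0 < 1 + t := by linarith [hp.1.1]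
  have hb : 0 < (1 + t) / (1 - t) := by positivity
  set b := (1 + t) / (1 - t) with hbdef
  -- Singular images are defined by derivatives in the aspect ratio; the chain rule for this change
  -- of variable transfers a zero derivative in `t`.
  set c : ℝ → ℝ := fun ρ => (ρ - 1) / (ρ + 1) with hc
  have hcb : c b = t := by rw [hc, hbdef]; field_simp; ring
  have hcd : DifferentiableAt ℝ c b := by
    apply DifferentiableAt.div (by fun_prop) (by fun_prop); linarith
  have hcc : Tendsto c (𝓝 b) (𝓝 t) := by
    have := hcd.continuousAt.tendsto
    rwa [hcb] at this
  apply hγ.regular_vertex e he k i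
  refine ⟨b, hb, fun ρ => quadRect γ e (c ρ), ?_, ?_, ?_⟩
  · filter_upwards [hcc.eventually (isOpen_Ioo.mem_nhds hp.1),
      hcc.eventually (eventually_lineDet_ne hp.2.1), lt_mem_nhds hb] with ρ h3 h4 h5
    have := hγ.mem_rectanglesOn he h3 (rectEq_quadRect h4)
    have hρ : (1 + c ρ) / (1 - c ρ) = ρ := by
      have h6 : 1 - (ρ - 1) / (ρ + 1) ≠ 0 := (sub_pos.2 h3.2).ne'
      rw [hc]; field_simp; ring
    rwa [hρ] at this
  · have hd : HasDerivAt (quadSol γ e k) 0 (c b) := by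
      rw [hcb, ← h0]; exact hasDerivAt_quadSol hp.2.1 k
    have h3 := (hd.comp b hcd.hasDerivAt).ofReal_comp
    have h4 := (h3.mul_const (sideDir γ (e k))).const_add (γ (e k))
    simp only [zero_mul, Complex.ofReal_zero] at h4
    refine h4.congr_of_eventuallyEq (Eventually.of_forall fun ρ => ?_)
    simp only [quadRect, quadPoint_apply, Function.comp]
  · change quadRect γ e (c b) k = γ i
    rw [hcb, hi]

lemma eventually_quadSol_mem {t : ℝ} (ht : t ∈ quadParams γ e) {k : Fin 4}
    (hk : quadRect γ e t k ∉ range γ.vertices) :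
    ∀ᶠ x in 𝓝 t, quadSol γ e k x ∈ Ioo (0 : ℝ) 1 := by
  have hp := (hγ.mem_quadParams_iff he).1 ht
  rw [hγ.quadRect_apply_vertex_iff he ht, not_or] at hk
  have := hp.2.2 k
  exact (hasDerivAt_quadSol hp.2.1 k).continuousAt.eventually (isOpen_Ioo.mem_nhds
    ⟨lt_of_le_of_ne this.1 (Ne.symm hk.1), lt_of_le_of_ne this.2 hk.2⟩)

lemma quadParams_mem_nhds {t : ℝ} (ht : t ∈ quadParams γ e)
    (hk : ∀ k, quadRect γ e t k ∉ range γ.vertices) : quadParams γ e ∈ 𝓝 t := by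
  have hp := (hγ.mem_quadParams_iff he).1 ht
  filter_upwards [isOpen_Ioo.mem_nhds hp.1, eventually_lineDet_ne hp.2.1,
    eventually_all.2 fun k => hγ.eventually_quadSol_mem he ht (hk k)] with x h1 h2 h3
  exact (hγ.mem_quadParams_iff he).2 ⟨h1, h2, fun k => Ioo_subset_Icc_self (h3 k)⟩

/-- The `k`-th coordinate is at an end of $[0,1]$ and moves with nonzero speed, so it enters the
side in one direction of `t` and leaves it in the other. The other coordinates stay inside. -/
lemma quadParams_one_sided {t : ℝ} (ht : t ∈ quadParams γ e) {k : Fin 4}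
    (hk : quadRect γ e t k ∈ range γ.vertices) (hk' : ∀ m ≠ k, quadRect γ e t m ∉ range γ.vertices) :
    (quadParams γ e ∈ 𝓝[>] t ∧ (quadParams γ e)ᶜ ∈ 𝓝[<] t) ∨
    (quadParams γ e ∈ 𝓝[<] t ∧ (quadParams γ e)ᶜ ∈ 𝓝[>] t) := by
  have hp := (hγ.mem_quadParams_iff he).1 ht
  have hother : ∀ᶠ x in 𝓝 t, quadSol γ e k x ∈ Ioo (0 : ℝ) 1 → x ∈ quadParams γ e := by
    have h3 : ∀ᶠ x in 𝓝 t, ∀ m, m ≠ k → quadSol γ e m x ∈ Ioo (0 : ℝ) 1 := by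
      refine eventually_all.2 fun m => ?_
      by_cases hm : m = k
      · exact Eventually.of_forall fun x h => absurd hm h
      · filter_upwards [hγ.eventually_quadSol_mem he ht (hk' m hm)] with x hx _ using hx
    filter_upwards [isOpen_Ioo.mem_nhds hp.1, eventually_lineDet_ne hp.2.1, h3] with x h1 h2 h3 h4
    refine (hγ.mem_quadParams_iff he).2 ⟨h1, h2, fun m => ?_⟩
    by_cases hm : m = k
    · rw [hm]; exact Ioo_subset_Icc_self h4
    · exact Ioo_subset_Icc_self (h3 m hm)
  have hnot : ∀ x, quadSol γ e k x ∉ Icc (0 : ℝ) 1 → x ∈ (quadParams γ e)ᶜ := fun x hx h =>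
    hx (((hγ.mem_quadParams_iff he).1 h).2.2 k)
  have hd := hasDerivAt_quadSol hp.2.1 k
  have hne := hγ.deriv_quadSol_ne_zero he ht hk
  have hs := (hγ.quadRect_apply_vertex_iff he ht k).1 hk
  -- A coordinate that enters $[0,1]$ at one end does not reach the other end nearby.
  have hcont : ∀ᶠ x in 𝓝 t, |quadSol γ e k x - quadSol γ e k t| < 1 := by
    have := Metric.continuousAt_iff'.1 hd.continuousAt 1 one_pos
    simpa only [Real.dist_eq] using this
  have hslope : ∀ (f : ℝ → ℝ) (c : ℝ), HasDerivAt f c t → 0 < c →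
      (∀ᶠ x in 𝓝[>] t, f t < f x) ∧ ∀ᶠ x in 𝓝[<] t, f x < f t := by
    intro f c hf hc
    have h1 := (hasDerivAt_iff_tendsto_slope.1 hf).eventually (lt_mem_nhds hc)
    constructor
    · filter_upwards [h1.filter_mono (nhdsWithin_mono t fun x hx => ne_of_gt hx),
        self_mem_nhdsWithin] with x hx hxt
      rw [slope_def_field] at hx
      have := (div_pos_iff_of_pos_right (sub_pos.2 hxt)).1 hx
      linarith
    · filter_upwards [h1.filter_mono (nhdsWithin_mono t fun x hx => ne_of_lt hx),
        self_mem_nhdsWithin] with x hx hxt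
      rw [slope_def_field, ← neg_div_neg_eq] at hx
      have := (div_pos_iff_of_pos_right (neg_pos.2 (sub_neg.2 hxt))).1 hx
      linarith
  have hsign : ((∀ᶠ x in 𝓝[>] t, quadSol γ e k t < quadSol γ e k x) ∧
      ∀ᶠ x in 𝓝[<] t, quadSol γ e k x < quadSol γ e k t) ∨
      ((∀ᶠ x in 𝓝[>] t, quadSol γ e k x < quadSol γ e k t) ∧
      ∀ᶠ x in 𝓝[<] t, quadSol γ e k t < quadSol γ e k x) := by
    rcases lt_or_gt_of_ne hne with h | h
    · right
      have := hslope _ _ hd.neg (neg_pos.2 h)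
      simpa only [Pi.neg_apply, neg_lt_neg_iff] using this
    · exact Or.inl (hslope _ _ hd h)
  have hin : ∀ l : Filter ℝ, l ≤ 𝓝 t → quadSol γ e k t = 0 →
      ((∀ᶠ x in l, quadSol γ e k t < quadSol γ e k x) → quadParams γ e ∈ l) ∧
      ((∀ᶠ x in l, quadSol γ e k x < quadSol γ e k t) → (quadParams γ e)ᶜ ∈ l) := by
    intro l hl h0
    constructor
    · intro h
      filter_upwards [h, hcont.filter_mono hl, hother.filter_mono hl] with x h1 h2 h3
      rw [h0] at h1 h2
      rw [sub_zero] at h2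
      exact h3 ⟨h1, (abs_lt.1 h2).2⟩
    · intro h
      filter_upwards [h] with x h1
      rw [h0] at h1
      exact hnot x fun h2 => h1.not_ge h2.1
  have hin' : ∀ l : Filter ℝ, l ≤ 𝓝 t → quadSol γ e k t = 1 →
      ((∀ᶠ x in l, quadSol γ e k x < quadSol γ e k t) → quadParams γ e ∈ l) ∧
      ((∀ᶠ x in l, quadSol γ e k t < quadSol γ e k x) → (quadParams γ e)ᶜ ∈ l) := by
    intro l hl h0
    constructor
    · intro h
      filter_upwards [h, hcont.filter_mono hl, hother.filter_mono hl] with x h1 h2 h3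
      rw [h0] at h1 h2
      exact h3 ⟨by linarith [(abs_lt.1 h2).1], h1⟩
    · intro h
      filter_upwards [h] with x h1
      rw [h0] at h1
      exact hnot x fun h2 => h1.not_ge h2.2
  have hgt : 𝓝[>] t ≤ 𝓝 t := nhdsWithin_le_nhds
  have hlt : 𝓝[<] t ≤ 𝓝 t := nhdsWithin_le_nhds
  rcases hs with h0 | h0 <;> rcases hsign with ⟨h1, h2⟩ | ⟨h1, h2⟩
  · exact Or.inl ⟨(hin _ hgt h0).1 h1, (hin _ hlt h0).2 h2⟩
  · exact Or.inr ⟨(hin _ hlt h0).1 h2, (hin _ hgt h0).2 h1⟩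
  · exact Or.inr ⟨(hin' _ hlt h0).1 h2, (hin' _ hgt h0).2 h1⟩
  · exact Or.inl ⟨(hin' _ hgt h0).1 h1, (hin' _ hlt h0).2 h2⟩

/-- Over a gap of the vertex parameters there is a rectangle on the sides either for all
parameters or for none. -/
lemma Ioo_subset_quadParams {lo hi t : ℝ} (hgap : IsGap (vertexParams γ) lo hi)
    (hI : Ioo lo hi ⊆ Ioo (-1 : ℝ) 1) (ht : t ∈ Ioo lo hi) (htp : t ∈ quadParams γ e) :
    Ioo lo hi ⊆ quadParams γ e := by
  have hint : ∀ x ∈ Ioo lo hi, x ∈ quadParams γ e → x ∈ interior (quadParams γ e) := by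
    intro x hx hxp
    rw [mem_interior_iff_mem_nhds]
    refine hγ.quadParams_mem_nhds he hxp fun k hk => hgap.notMem hx (Or.inr (Or.inr ?_))
    exact ⟨_, hγ.quadRect_mem_inscribed he hxp, hγ.ratioCoord_quadRect he hxp, k, hk⟩
  -- Within the gap the set of parameters is open, as no polygon vertex is met, and closed by
  -- compactness.
  refine (isPreconnected_Ioo.subset_of_closure_inter_subset isOpen_interior
    ⟨t, ht, hint t ht htp⟩ ?_).trans interior_subset
  rintro x ⟨hx, hxI⟩
  exact hint x hxI (mem_quadParams_of_closure (hI hxI) (closure_mono interior_subset hx))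

omit hγ he in
lemma Icc_subset_quadParams {lo hi : ℝ} (hlt : lo < hi) (h : Ioo lo hi ⊆ quadParams γ e) :
    Icc lo hi ∩ Ioo (-1 : ℝ) 1 ⊆ quadParams γ e := by
  rintro x ⟨hx, hx1⟩
  apply mem_quadParams_of_closure hx1
  apply closure_mono h
  rwa [closure_Ioo hlt.ne]

end Quad

/-- Finitely many aspect ratios of inscribed rectangles involve vertices of the polygon. -/
lemma finite_vertexParams : (vertexParams γ).Finite := by
  have hsub : vertexParams γ ⊆ ⋃ (e : Fin 4 → Fin N) (k : Fin 4) (σ : Fin 2),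
      ↑((lineNum (fun k => γ (e k)) (fun k => sideDir γ (e k)) k -
        C ((σ : ℕ) : ℝ) * quadDet γ e).roots.toFinset : Finset ℝ) := by
    rintro t ⟨R, hR, ht, k, hk⟩
    obtain ⟨e, he⟩ := exists_quad hR
    obtain ⟨ha, hp, hq⟩ := hγ.ratioCoord_mem_quadParams hR he
    rw [ht] at hp hq
    rw [← hq] at hk
    have hs := (hγ.quadRect_apply_vertex_iff ha hp k).1 hk
    obtain ⟨σ, hσ⟩ : ∃ σ : Fin 2, quadSol γ e k t = ((σ : ℕ) : ℝ) := by
      rcases hs with h | h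
      · exact ⟨0, by simpa using h⟩
      · exact ⟨1, by simpa using h⟩
    have hd := ((hγ.mem_quadParams_iff ha).1 hp).2.1
    have heval : ∀ x, (quadDet γ e).eval x ≠ 0 →
        ((lineNum (fun k => γ (e k)) (fun k => sideDir γ (e k)) k -
        C ((σ : ℕ) : ℝ) * quadDet γ e).eval x = 0 ↔ quadSol γ e k x = ((σ : ℕ) : ℝ)) := by
      intro x hx
      rw [eval_sub, eval_mul, eval_C, sub_eq_zero, ← div_eq_iff hx]
      rfl
    simp only [mem_iUnion, Finset.mem_coe, Multiset.mem_toFinset]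
    refine ⟨e, k, σ, ?_⟩
    rw [mem_roots', IsRoot]
    -- If this polynomial were zero, the coordinate would be constant near `t`, and the rectangle
    -- vertex would rest at the polygon vertex.
    refine ⟨fun h0 => ?_, (heval t hd).2 hσ⟩
    apply hγ.deriv_quadSol_ne_zero ha hp hk
    have : quadSol γ e k =ᶠ[𝓝 t] fun _ => ((σ : ℕ) : ℝ) := by
      filter_upwards [eventually_lineDet_ne hd] with x hx
      rw [← heval x hx, h0, eval_zero]
    rw [this.deriv_eq, deriv_const]
  refine Finite.subset ?_ hsub
  exact finite_iUnion fun e => finite_iUnion fun k => finite_iUnion fun σ => Finset.finite_toSet _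

omit hγ in
lemma _root_.InscribedRect.vertexParams_subset : vertexParams γ ⊆ Ioo (-1) 1 := by
  rintro t ⟨R, ⟨⟨ρ, hρ⟩, -⟩, rfl, -⟩
  exact hρ.ratioCoord_mem

omit hγ in
lemma _root_.InscribedRect.ratioCoord_eq_zero_iff {R : Fin 4 → ℂ} (hR : R ∈ inscribed γ) :
    ratioCoord R = 0 ↔ aspectRatio R = 1 := by
  obtain ⟨⟨ρ, hρ⟩, -⟩ := hR
  have := hρ.1
  rw [hρ.ratioCoord_eq, hρ.aspectRatio_eq, div_eq_zero_iff, or_iff_left (by linarith), sub_eq_zero]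

lemma zero_notMem_vertexParams : (0 : ℝ) ∉ vertexParams γ := by
  rintro ⟨R, hR, h0, k, hk⟩
  exact hγ.square_vertex R hR ((ratioCoord_eq_zero_iff hR).1 h0) k hk

end IsGenericPolygon

end InscribedRect


/-! ### The decomposition of the space of inscribed rectangles into arcs. -/

namespace InscribedRect

open Set Filter Topology

variable {N : ℕ} {γ : Polygon ℂ N}

/-- A germ of a curve of inscribed rectangles at the rectangle `R`: a quadruple of sides that
contain the vertices of `R`, together with a side of the parameter of `R` on which the rectangles
of these sides continue over the gap. -/
def IsGermAt (γ : Polygon ℂ N) (R : Fin 4 → ℂ) (lo hi : ℝ) (y : (Fin 4 → Fin N) × Bool) : Prop :=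
  (∀ k, R k ∈ γ.edgeSet ℝ (y.1 k)) ∧
    (bif y.2 then Ioo lo (ratioCoord R) else Ioo (ratioCoord R) hi) ⊆ quadParams γ y.1

/-- The arcs of inscribed rectangles: an associated quadruple of sides and a gap over which it
carries inscribed rectangles. -/
abbrev Piece (γ : Polygon ℂ N) : Type :=
  {x : (Fin 4 → Fin N) × ℝ × ℝ // IsAssociated x.1 ∧ IsGap (vertexParams γ) x.2.1 x.2.2 ∧
    Ioo x.2.1 x.2.2 ⊆ quadParams γ x.1}

namespace IsGenericPolygon

variable (hγ : IsGenericPolygon γ)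
include hγ

lemma subset_quadParams_of_mem {e : Fin 4 → Fin N} (he : IsAssociated e) {lo hi : ℝ}
    (hgap : IsGap (vertexParams γ) lo hi) {s : Set ℝ} {l : Filter ℝ} [l.NeBot] (hs : s ∈ l)
    (hI : Ioo lo hi ∈ l) (hsub : s ⊆ quadParams γ e) : Ioo lo hi ⊆ quadParams γ e := by
  obtain ⟨t, ht1, ht2⟩ := Filter.nonempty_of_mem (inter_mem hs hI)
  obtain ⟨h1, h2⟩ := hgap.subset vertexParams_subset
  exact hγ.Ioo_subset_quadParams he hgap (Ioo_subset_Ioo h1 h2) ht2 (hsub ht1)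

/-- At a rectangle whose parameter is a vertex parameter there are exactly two germs. -/
lemma exists_germs {R : Fin 4 → ℂ} (hR : R ∈ inscribed γ) {lo hi : ℝ}
    (h1 : IsGap (vertexParams γ) lo (ratioCoord R)) (h2 : IsGap (vertexParams γ) (ratioCoord R) hi) :
    ∃ y₁ y₂, y₁ ≠ y₂ ∧ ∀ z, IsGermAt γ R lo hi z ↔ z = y₁ ∨ z = y₂ := by
  have hleft : Ioo lo (ratioCoord R) ∈ 𝓝[<] (ratioCoord R) := Ioo_mem_nhdsLT h1.1
  have hright : Ioo (ratioCoord R) hi ∈ 𝓝[>] (ratioCoord R) := Ioo_mem_nhdsGT h2.1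
  by_cases hv : ∃ k, R k ∈ range γ.vertices
  · obtain ⟨k, i, hi'⟩ := hv
    have hother : ∀ m ≠ k, R m ∉ range γ.vertices := fun m hm h =>
      hm (hγ.rectangle_vertex R hR m k h ⟨i, hi'⟩)
    -- Each quadruple of sides through `R` contributes exactly one germ, to the left or to the
    -- right.
    have hside : ∀ e : Fin 4 → Fin N, (∀ k, R k ∈ γ.edgeSet ℝ (e k)) →
        ∃ b, ∀ c, IsGermAt γ R lo hi (e, c) ↔ c = b := by
      intro e he
      obtain ⟨ha, hp, hq⟩ := hγ.ratioCoord_mem_quadParams hR he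
      have hno : ∀ (l : Filter ℝ) [l.NeBot] (s : Set ℝ), s ∈ l → (quadParams γ e)ᶜ ∈ l →
          ¬ s ⊆ quadParams γ e := by
        intro l _ s hs hc hsub
        obtain ⟨x, hx1, hx2⟩ := Filter.nonempty_of_mem (inter_mem hs hc)
        exact hx2 (hsub hx1)
      rcases hγ.quadParams_one_sided ha hp (k := k) (by rw [hq]; exact ⟨i, hi'⟩)
        (by rw [hq]; exact hother) with ⟨h3, h4⟩ | ⟨h3, h4⟩
      · refine ⟨false, fun c => ?_⟩
        cases c
        · simp only [iff_true]
          exact ⟨he, hγ.subset_quadParams_of_mem ha h2 h3 hright subset_rfl⟩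
        · simp only [Bool.true_eq_false, iff_false]
          exact fun h => hno _ _ hleft h4 h.2
      · refine ⟨true, fun c => ?_⟩
        cases c
        · simp only [Bool.false_eq_true, iff_false]
          exact fun h => hno _ _ hright h4 h.2
        · simp only [iff_true]
          exact ⟨he, hγ.subset_quadParams_of_mem ha h1 h3 hleft subset_rfl⟩
    obtain ⟨e₀, he₀⟩ := exists_quad hR
    -- There are two such quadruples: only the `k`-th vertex is a polygon vertex, and it lies on the
    -- two sides that meet there.
    have hmem : ∀ e : Fin 4 → Fin N, (∀ k, R k ∈ γ.edgeSet ℝ (e k)) ↔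
        e = Function.update e₀ k i ∨ e = Function.update e₀ k ((finRotate N).symm i) := by
      have hR' : ∀ j, R k ∈ γ.edgeSet ℝ j ↔ j = i ∨ j = (finRotate N).symm i := fun j => by
        rw [← hi']; exact hγ.vertex_mem_edgeSet_iff
      intro e
      constructor
      · intro he
        have : e = Function.update e₀ k (e k) := by
          ext1 m
          by_cases hm : m = k
          · rw [hm, Function.update_self]
          · rw [Function.update_of_ne hm]
            exact hγ.edge_unique (hother m hm) (he m) (he₀ m)
        rcases (hR' _).1 (he k) with h | h
        · left; rw [this, h]
        · right; rw [this, h]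
      · intro h m
        by_cases hm : m = k
        · rw [hm, hR']
          rcases h with rfl | rfl
          · left; rw [Function.update_self]
          · right; rw [Function.update_self]
        · rcases h with rfl | rfl <;> rw [Function.update_of_ne hm] <;> exact he₀ m
    obtain ⟨b₁, hb₁⟩ := hside _ ((hmem _).2 (Or.inl rfl))
    obtain ⟨b₂, hb₂⟩ := hside _ ((hmem _).2 (Or.inr rfl))
    refine ⟨(Function.update e₀ k i, b₁), (Function.update e₀ k ((finRotate N).symm i), b₂),
      fun h => ?_, ?_⟩
    · have := congrFun (congrArg Prod.fst h) k
      simp only [Function.update_self] at this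
      exact hγ.rotate_symm_ne i this.symm
    · rintro ⟨e, c⟩
      constructor
      · intro h
        rcases (hmem e).1 h.1 with rfl | rfl
        · left; rw [(hb₁ c).1 h]
        · right; rw [(hb₂ c).1 h]
      · rintro (h | h)
        · rw [h]; exact (hb₁ b₁).2 rfl
        · rw [h]; exact (hb₂ b₂).2 rfl
  -- The parameter may be a cut only because of another rectangle. Then the quadruple is unique and
  -- its curve passes through `R` in both directions.
  · push Not at hv
    obtain ⟨e, he⟩ := exists_quad hR
    obtain ⟨ha, hp, hq⟩ := hγ.ratioCoord_mem_quadParams hR he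
    have hnhds := hγ.quadParams_mem_nhds ha hp (by rw [hq]; exact hv)
    refine ⟨(e, false), (e, true), by simp, ?_⟩
    rintro ⟨e', c⟩
    constructor
    · intro h
      have : e' = e := funext fun m => hγ.edge_unique (hv m) (h.1 m) (he m)
      subst this
      cases c <;> simp
    · have hF : IsGermAt γ R lo hi (e, false) := ⟨he, hγ.subset_quadParams_of_mem ha h2
        (mem_nhdsWithin_of_mem_nhds hnhds) hright subset_rfl⟩
      have hT : IsGermAt γ R lo hi (e, true) := ⟨he, hγ.subset_quadParams_of_mem ha h1
        (mem_nhdsWithin_of_mem_nhds hnhds) hleft subset_rfl⟩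
      rintro (h | h) <;> rw [h] <;> assumption

lemma finite_piece : Finite (Piece γ) := by
  have h := (hγ.finite_vertexParams.insert 1).insert (-1)
  refine Set.Finite.to_subtype (Set.Finite.subset (finite_univ.prod (h.prod h)) ?_)
  rintro ⟨e, lo, hi⟩ ⟨-, hgap, -⟩
  exact ⟨mem_univ _, hgap.2.1, hgap.2.2.1⟩

omit hγ in
lemma dom_subset (p : Piece γ) : Icc p.1.2.1 p.1.2.2 ∩ Ioo (-1) 1 ⊆ quadParams γ p.1.1 :=
  Icc_subset_quadParams p.2.2.1.1 p.2.2.2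

/-- The two flags at an inscribed rectangle whose parameter is a vertex parameter. -/
lemma exists_flags {R : Fin 4 → ℂ} (hR : R ∈ inscribed γ) (hv : ratioCoord R ∈ vertexParams γ) :
    ∃ y₁ y₂ : Piece γ × Bool, y₁ ≠ y₂ ∧ ∀ z : Piece γ × Bool,
      ((bif z.2 then z.1.1.2.2 else z.1.1.2.1) = ratioCoord R ∧
        quadRect γ z.1.1.1 (ratioCoord R) = R) ↔ z = y₁ ∨ z = y₂ := by
  have ht := vertexParams_subset hv
  obtain ⟨hi, h2⟩ := exists_isGap_above hγ.finite_vertexParams (Or.inr (Or.inr hv)) ht.2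
  obtain ⟨lo, h1⟩ := exists_isGap_below hγ.finite_vertexParams (Or.inr (Or.inr hv)) ht.1
  -- Flags at `R` correspond to germs at `R`: the gap of the piece is determined by its end at `R`
  -- and the direction.
  have hgerm : ∀ z : Piece γ × Bool, (bif z.2 then z.1.1.2.2 else z.1.1.2.1) = ratioCoord R →
      quadRect γ z.1.1.1 (ratioCoord R) = R → IsGermAt γ R lo hi (z.1.1.1, z.2) ∧
      z.1.1.2 = bif z.2 then (lo, ratioCoord R) else (ratioCoord R, hi) := by
    rintro ⟨⟨⟨e, a, b⟩, ha, hgap, hsub⟩, c⟩ hpos hq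
    have hlt := hgap.1
    have hmem : ratioCoord R ∈ quadParams γ e := by
      refine Icc_subset_quadParams hlt hsub ⟨?_, ht⟩
      rw [← hpos]
      cases c
      · exact left_mem_Icc.2 hlt.le
      · exact right_mem_Icc.2 hlt.le
    have hedge : ∀ k, R k ∈ γ.edgeSet ℝ (e k) := fun k => by
      rw [← hq]; exact hγ.quadRect_mem_edgeSet ha hmem k
    cases c
    · obtain rfl : a = ratioCoord R := hpos
      obtain rfl := hgap.hi_unique h2
      exact ⟨⟨hedge, hsub⟩, rfl⟩
    · obtain rfl : b = ratioCoord R := hpos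
      obtain rfl := hgap.lo_unique h1
      exact ⟨⟨hedge, hsub⟩, rfl⟩
  have hflag : ∀ y, IsGermAt γ R lo hi y → ∃ z : Piece γ × Bool, (z.1.1.1, z.2) = y ∧
      (bif z.2 then z.1.1.2.2 else z.1.1.2.1) = ratioCoord R ∧
      quadRect γ z.1.1.1 (ratioCoord R) = R := by
    rintro ⟨e, c⟩ ⟨he, hsub⟩
    obtain ⟨ha, hp, hq⟩ := hγ.ratioCoord_mem_quadParams hR he
    cases c
    · exact ⟨(⟨(e, ratioCoord R, hi), ha, h2, hsub⟩, false), rfl, rfl, hq⟩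
    · exact ⟨(⟨(e, lo, ratioCoord R), ha, h1, hsub⟩, true), rfl, rfl, hq⟩
  obtain ⟨g₁, g₂, hne, hg⟩ := hγ.exists_germs hR h1 h2
  obtain ⟨y₁, hy₁, hp₁, hq₁⟩ := hflag g₁ ((hg g₁).2 (Or.inl rfl))
  obtain ⟨y₂, hy₂, hp₂, hq₂⟩ := hflag g₂ ((hg g₂).2 (Or.inr rfl))
  have hinj : ∀ y z : Piece γ × Bool, (y.1.1.1, y.2) = (z.1.1.1, z.2) →
      (bif y.2 then y.1.1.2.2 else y.1.1.2.1) = ratioCoord R →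
      (bif z.2 then z.1.1.2.2 else z.1.1.2.1) = ratioCoord R →
      quadRect γ y.1.1.1 (ratioCoord R) = R → quadRect γ z.1.1.1 (ratioCoord R) = R → y = z := by
    intro y z h hy hz hy' hz'
    have e1 := (hgerm y hy hy').2
    have e2 := (hgerm z hz hz').2
    rw [Prod.mk.injEq] at h
    rw [h.2, ← e2] at e1
    exact Prod.ext (Subtype.ext (Prod.ext h.1 e1)) h.2
  refine ⟨y₁, y₂, fun h => hne (by rw [← hy₁, ← hy₂, h]), fun z => ⟨?_, ?_⟩⟩
  · rintro ⟨hp, hq⟩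
    rcases (hg _).1 (hgerm z hp hq).1 with h | h
    · exact Or.inl (hinj z y₁ (h.trans hy₁.symm) hp hp₁ hq hq₁)
    · exact Or.inr (hinj z y₂ (h.trans hy₂.symm) hp hp₂ hq hq₂)
  · rintro (rfl | rfl)
    · exact ⟨hp₁, hq₁⟩
    · exact ⟨hp₂, hq₂⟩

omit hγ in
lemma _root_.InscribedRect.continuousOn_ratioCoord : ContinuousOn ratioCoord (inscribed γ) := by
  unfold ratioCoord
  refine ContinuousOn.div (by fun_prop) (by fun_prop) ?_
  rintro R ⟨⟨ρ, hρ⟩, -⟩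
  have := hρ.norm_pos
  positivity

/-- The space of inscribed rectangles of a generic polygon as a union of arcs. -/
noncomputable def arcSystem : ArcSystem (inscribed γ) ratioCoord (Piece γ) where
  lo p := p.1.2.1
  hi p := p.1.2.2
  arc p := quadRect γ p.1.1
  lo_lt_hi p := p.2.2.1.1
  neg_one_le_lo p := (p.2.2.1.subset vertexParams_subset).1
  hi_le_one p := (p.2.2.1.subset vertexParams_subset).2
  lo_ne_zero p h := by
    rcases h ▸ p.2.2.1.2.1 with h | h | h
    · norm_num at h
    · norm_num at h
    · exact hγ.zero_notMem_vertexParams h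
  hi_ne_zero p h := by
    rcases h ▸ p.2.2.1.2.2.1 with h | h | h
    · norm_num at h
    · norm_num at h
    · exact hγ.zero_notMem_vertexParams h
  continuousOn_u := continuousOn_ratioCoord
  u_mem := by
    rintro R ⟨⟨ρ, hρ⟩, -⟩
    exact hρ.ratioCoord_mem
  continuousOn_arc p := by
    refine ContinuousOn.mono (fun t ht => ContinuousAt.continuousWithinAt ?_) (dom_subset p)
    have hp := (hγ.mem_quadParams_iff p.2.1).1 ht
    refine continuousAt_pi.2 fun k => ?_
    have h1 := (hasDerivAt_quadSol hp.2.1 k).continuousAt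
    simp only [quadRect, quadPoint_apply]
    fun_prop
  arc_mem p t ht := hγ.quadRect_mem_inscribed p.2.1 (dom_subset p ht)
  u_arc p t ht := hγ.ratioCoord_quadRect p.2.1 (dom_subset p ht)
  exists_arc R hR := by
    by_cases hv : ratioCoord R ∈ vertexParams γ
    · obtain ⟨y, _, -, hy⟩ := hγ.exists_flags hR hv
      obtain ⟨h1, h2⟩ := (hy y).2 (Or.inl rfl)
      refine ⟨y.1, ?_, h2⟩
      have := y.1.2.2.1.1
      rw [← h1]
      cases y.2
      · exact left_mem_Icc.2 this.le
      · exact right_mem_Icc.2 this.le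
    · obtain ⟨e, he⟩ := exists_quad hR
      obtain ⟨ha, hp, hq⟩ := hγ.ratioCoord_mem_quadParams hR he
      obtain ⟨lo, hi, hgap, ht⟩ := exists_isGap_around hγ.finite_vertexParams hp.1 hv
      obtain ⟨h1, h2⟩ := hgap.subset vertexParams_subset
      exact ⟨⟨(e, lo, hi), ha, hgap,
        hγ.Ioo_subset_quadParams ha hgap (Ioo_subset_Ioo h1 h2) ht hp⟩, Ioo_subset_Icc_self ht, hq⟩
  eq_of_interior p q t hp hq h := by
    have hp' := p.2.2.2 hp
    -- Inside a gap no rectangle vertex is a polygon vertex, so the rectangle determines its four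
    -- sides.
    have hno : ∀ k, quadRect γ p.1.1 t k ∉ range γ.vertices := fun k hk =>
      p.2.2.1.notMem hp (Or.inr (Or.inr ⟨_, hγ.quadRect_mem_inscribed p.2.1 hp',
        hγ.ratioCoord_quadRect p.2.1 hp', k, hk⟩))
    have hgap := p.2.2.1.eq_of_mem q.2.2.1 hp hq
    refine Subtype.ext (Prod.ext (funext fun k => ?_) (Prod.ext hgap.1 hgap.2))
    refine hγ.edge_unique (hno k) (hγ.quadRect_mem_edgeSet p.2.1 hp' k) ?_
    rw [h]
    exact hγ.quadRect_mem_edgeSet q.2.1 (dom_subset q ⟨hq, hp'.1⟩) k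
  exists_other x hx := by
    set t := bif x.2 then x.1.1.2.2 else x.1.1.2.1 with ht
    have hlt := x.1.2.2.1.1
    have htI : t ∈ Icc x.1.1.2.1 x.1.1.2.2 := by
      rw [ht]
      cases x.2
      · exact left_mem_Icc.2 hlt.le
      · exact right_mem_Icc.2 hlt.le
    have htB : t ∈ vertexParams γ := by
      have : t ∈ insert (-1) (insert 1 (vertexParams γ)) := by
        rw [ht]
        cases x.2
        · exact x.1.2.2.1.2.1
        · exact x.1.2.2.1.2.2.1
      rcases this with h | h | h
      · exact absurd h hx.1.ne'
      · exact absurd h hx.2.ne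
      · exact h
    have hp := dom_subset x.1 ⟨htI, hx⟩
    have hu := hγ.ratioCoord_quadRect x.1.2.1 hp
    obtain ⟨y₁, y₂, hne, hy⟩ := hγ.exists_flags (hγ.quadRect_mem_inscribed x.1.2.1 hp)
      (by rw [hu]; exact htB)
    simp only [hu] at hy
    rcases (hy x).1 ⟨ht.symm, rfl⟩ with rfl | rfl
    · exact ⟨y₂, hne.symm, hy⟩
    · exact ⟨y₁, hne, fun z => (hy z).trans or_comm⟩

end IsGenericPolygon

/-! ### The relabeling symmetry -/

lemma relabel_one_apply (R : Fin 4 → ℂ) (k : Fin 4) : relabel 1 R k = R (k + 1) := rfl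

lemma relabel_relabel (i j : Fin 4) (R : Fin 4 → ℂ) : relabel i (relabel j R) = relabel (i + j) R := by
  ext k
  simp [relabel, add_assoc]

lemma IsRectangle.relabel {ρ : ℝ} {R : Fin 4 → ℂ} (h : IsRectangle ρ R) :
    IsRectangle ρ⁻¹ (relabel 1 R) := by
  obtain ⟨h0, h1, h2, h3⟩ := h
  have hρ : (ρ : ℂ) ≠ 0 := by exact_mod_cast h0.ne'
  have hw : R 1 - R 0 ≠ 0 := sub_ne_zero.2 h1.symm
  refine ⟨inv_pos.2 h0, ?_, ?_, ?_⟩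
  · change R 1 ≠ R 2
    rw [← sub_ne_zero, ← neg_sub, h2]
    exact neg_ne_zero.2 (mul_ne_zero (mul_ne_zero Complex.I_ne_zero hρ) hw)
  · change R 3 - R 2 = Complex.I * (ρ⁻¹ : ℝ) * (R 2 - R 1)
    have h4 : Complex.I * (ρ⁻¹ : ℝ) * (R 2 - R 1) = -(R 1 - R 0) := by
      rw [h2]
      push_cast
      field_simp
      rw [Complex.I_sq]
    rw [h4]
    linear_combination h3
  · change R 0 - R 1 = R 3 - R 2
    linear_combination -h3

lemma IsRectangle.zero_ne_two {ρ : ℝ} {R : Fin 4 → ℂ} (h : IsRectangle ρ R) : R 2 ≠ R 0 := by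
  obtain ⟨h0, h1, h2, h3⟩ := h
  intro h
  have h3 : (1 + Complex.I * ρ) * (R 1 - R 0) = 0 := by linear_combination h - h2
  rcases mul_eq_zero.1 h3 with h4 | h4
  · have := congrArg Complex.re h4
    simp at this
  · exact h1 (sub_eq_zero.1 h4).symm

lemma relabel_mem_inscribed {R : Fin 4 → ℂ} (h : R ∈ inscribed γ) : relabel 1 R ∈ inscribed γ := by
  obtain ⟨⟨ρ, hρ⟩, hb⟩ := h
  exact ⟨⟨_, hρ.relabel⟩, fun k => hb _⟩

/-- Relabeling by one step exchanges the two side lengths, and $\rho\mapsto1/\rho$ becomes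
$t\mapsto-t$. -/
lemma ratioCoord_relabel {R : Fin 4 → ℂ} (h : R ∈ inscribed γ) :
    ratioCoord (relabel 1 R) = -ratioCoord R := by
  obtain ⟨⟨ρ, hρ⟩, -⟩ := h
  have h0 := hρ.1
  rw [hρ.relabel.ratioCoord_eq, hρ.ratioCoord_eq]
  field_simp
  ring

lemma neg_mem_vertexParams {t : ℝ} (h : t ∈ vertexParams γ) : -t ∈ vertexParams γ := by
  obtain ⟨R, hR, rfl, k, hk⟩ := h
  refine ⟨relabel 1 R, relabel_mem_inscribed hR, ratioCoord_relabel hR, k - 1, ?_⟩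
  rwa [relabel_one_apply, sub_add_cancel]

lemma isAssociated_shift {e : Fin 4 → Fin N} (h : IsAssociated e) :
    IsAssociated fun k => e (k + 1) := by
  rw [isAssociated_iff] at h ⊢
  obtain ⟨i, j, k, h⟩ := h
  exact ⟨i - 1, j - 1, k - 1, by simpa only [sub_add_cancel] using h⟩

/-- Such a quadruple uses at most two sides. This is why neither relabeling nor its square fixes a
piece. -/
lemma not_isAssociated_of_shift_shift {e : Fin 4 → Fin N} (h : ∀ k, e (k + 1 + 1) = e k) :
    ¬ IsAssociated e := by
  rw [isAssociated_iff]
  have h0 : e 2 = e 0 := h 0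
  have h1 : e 3 = e 1 := h 1
  rintro ⟨i, j, k, hij, hik, hjk⟩
  have hall : ∀ m, e m = e 0 ∨ e m = e 1 := by
    intro m
    fin_cases m
    exacts [Or.inl rfl, Or.inr rfl, Or.inl h0, Or.inr h1]
  rcases hall i with hi | hi <;> rcases hall j with hj | hj <;> rcases hall k with hk | hk <;>
    simp_all

namespace IsGenericPolygon

variable (hγ : IsGenericPolygon γ)
include hγ

lemma quadRect_shift {e : Fin 4 → Fin N} (he : IsAssociated e) {t : ℝ} (ht : t ∈ quadParams γ e) :
    -t ∈ quadParams γ (fun k => e (k + 1)) ∧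
      quadRect γ (fun k => e (k + 1)) (-t) = relabel 1 (quadRect γ e t) := by
  have hR := hγ.quadRect_mem_inscribed he ht
  have := hγ.ratioCoord_mem_quadParams (relabel_mem_inscribed hR) (e := fun k => e (k + 1))
    fun k => hγ.quadRect_mem_edgeSet he ht (k + 1)
  rw [ratioCoord_relabel hR, hγ.ratioCoord_quadRect he ht] at this
  exact this.2

/-- Relabeling as a symmetry of the decomposition into arcs. -/
noncomputable def symmetry : hγ.arcSystem.Symmetry where
  map := relabel 1
  perm p := ⟨(fun k => p.1.1 (k + 1), -p.1.2.2, -p.1.2.1), isAssociated_shift p.2.1,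
    p.2.2.1.neg fun _ => neg_mem_vertexParams, fun t ht => by
      have : -t ∈ Ioo p.1.2.1 p.1.2.2 := ⟨by linarith [ht.2], by linarith [ht.1]⟩
      have := (hγ.quadRect_shift p.2.1 (p.2.2.2 this)).1
      rwa [neg_neg] at this⟩
  lo_perm _ := rfl
  hi_perm _ := rfl
  arc_perm p t ht := (hγ.quadRect_shift p.2.1 (dom_subset p ht)).2
  perm_four p := by
    refine Subtype.ext (Prod.ext (funext fun k => ?_) ?_)
    · change p.1.1 (k + 1 + 1 + 1 + 1) = p.1.1 k
      fin_cases k <;> rfl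
    · simp
  perm_ne p h := by
    have h1 : ∀ k, p.1.1 (k + 1) = p.1.1 k := fun k =>
      congrFun (congrArg (fun x : Piece γ => x.1.1) h) k
    exact not_isAssociated_of_shift_shift (fun k => by rw [h1, h1]) p.2.1
  perm_perm_ne p h := by
    have h1 : ∀ k, p.1.1 (k + 1 + 1) = p.1.1 k := fun k =>
      congrFun (congrArg (fun x : Piece γ => x.1.1) h) k
    exact not_isAssociated_of_shift_shift h1 p.2.1
  map_ne := by
    rintro R ⟨⟨ρ, hρ⟩, -⟩ h
    exact hρ.2.1 (congrFun h 0).symm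
  map_map_ne := by
    rintro R ⟨⟨ρ, hρ⟩, -⟩ h
    exact hρ.zero_ne_two (congrFun h 0)

end IsGenericPolygon

end InscribedRect


namespace InscribedRect

open Set Filter Topology

variable {N : ℕ} {γ : Polygon ℂ N}

/-! ### Orbits under relabeling -/

lemma fin_four_succ (i : Fin 3) : (i.succ : Fin 4) = 1 + i.castSucc := by
  fin_cases i <;> rfl

lemma relabel_zero (R : Fin 4 → ℂ) : relabel 0 R = R := by
  ext k
  simp [relabel]

lemma relabel_injective (j : Fin 4) : Function.Injective (relabel j) := fun R R' h => by
  have := congrArg (relabel (-j)) h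
  simpa [relabel_relabel, relabel_zero] using this

lemma relabel_image_image (i j : Fin 4) (A : Set (Fin 4 → ℂ)) :
    relabel i '' (relabel j '' A) = relabel (i + j) '' A := by
  rw [image_image]
  simp only [relabel_relabel]

lemma relabel_image_zero (A : Set (Fin 4 → ℂ)) : relabel 0 '' A = A := by
  simp [relabel_zero]

lemma rectangleOrbit_relabel (j : Fin 4) (R : Fin 4 → ℂ) :
    rectangleOrbit (relabel j R) = rectangleOrbit R := by
  simp only [rectangleOrbit, relabel_relabel]
  exact (Equiv.addRight j).surjective.range_comp fun i => relabel i R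

lemma componentOrbit_relabel (j : Fin 4) (A : Set (Fin 4 → ℂ)) :
    componentOrbit (relabel j '' A) = componentOrbit A := by
  simp only [componentOrbit, relabel_image_image]
  exact (Equiv.addRight j).surjective.range_comp fun i => relabel i '' A

lemma mem_componentOrbit_self (A : Set (Fin 4 → ℂ)) : A ∈ componentOrbit A :=
  ⟨0, relabel_image_zero A⟩

lemma relabel_eq_self_cases {R : Fin 4 → ℂ} (hR : R ∈ inscribed γ) {j : Fin 4}
    (h : relabel j R = R) : j = 0 := by
  obtain ⟨⟨ρ, hρ⟩, -⟩ := hR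
  have h1 : relabel 1 R ≠ R := fun h => hρ.2.1 (congrFun h 0).symm
  have h2 : relabel 2 R ≠ R := fun h => hρ.zero_ne_two (congrFun h 0)
  fin_cases j
  · rfl
  · exact absurd h h1
  · exact absurd h h2
  · refine absurd ?_ h2
    have h3 : relabel 3 R = R := h
    calc relabel 2 R = relabel 3 (relabel 3 R) := by rw [relabel_relabel]; rfl
      _ = R := by rw [h3, h3]

lemma card_rectangleOrbit_fiber {R : Fin 4 → ℂ} (hR : R ∈ inscribed γ) :
    {R' | rectangleOrbit R' = rectangleOrbit R}.ncard = 4 := by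
  have h1 : {R' | rectangleOrbit R' = rectangleOrbit R} = range fun j => relabel j R := by
    ext R'
    constructor
    · intro h
      have : R' ∈ rectangleOrbit R' := ⟨0, relabel_zero R'⟩
      rwa [h] at this
    · rintro ⟨j, rfl⟩
      exact rectangleOrbit_relabel j R
  have hinj : Function.Injective fun j => relabel j R := by
    intro i j h
    have := congrArg (relabel (-j)) h
    simp only [relabel_relabel, neg_add_cancel, relabel_zero] at this
    have := relabel_eq_self_cases hR this
    rwa [neg_add_eq_zero, eq_comm] at this
  rw [h1, ← image_univ, ncard_image_of_injective _ hinj, ncard_univ, Nat.card_fin]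

/-! ### Hyperbolic components -/

lemma IsRectangle.aspectRatio_eq_of_ratioCoord {R : Fin 4 → ℂ} {ρ : ℝ} (h : IsRectangle ρ R) :
    aspectRatio R = (1 + ratioCoord R) / (1 - ratioCoord R) := by
  rw [h.aspectRatio_eq, ← h.eq_of_ratioCoord]

/-- The substitution $t=1-2/(\rho+1)$ translates the limits $0$ and $\infty$ of the aspect ratio
into $-1$ and $1$. -/
lemma isHyperbolic_iff {A : Set (Fin 4 → ℂ)} :
    IsHyperbolic γ A ↔ IsComponent γ A ∧ ArcSystem.IsCrossingArc ratioCoord A := by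
  refine and_congr_right fun hA => exists_congr fun h => ?_
  have hsub : A ⊆ inscribed γ := by
    obtain ⟨R, -, rfl⟩ := hA
    exact connectedComponentIn_subset _ _
  have hu : ∀ t, ratioCoord (h t) = 1 - 2 / (aspectRatio (h t) + 1) := fun t => by
    obtain ⟨⟨ρ, hρ⟩, -⟩ := hsub (h t).2
    have := hρ.1
    rw [hρ.ratioCoord_eq, hρ.aspectRatio_eq]
    field_simp; ring
  have ha : ∀ t, aspectRatio (h t) = (1 + ratioCoord (h t)) * (1 - ratioCoord (h t))⁻¹ := fun t => by
    obtain ⟨⟨ρ, hρ⟩, -⟩ := hsub (h t).2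
    rw [hρ.aspectRatio_eq_of_ratioCoord, div_eq_mul_inv]
  have hlt : ∀ t, ratioCoord (h t) < 1 := fun t => by
    obtain ⟨⟨ρ, hρ⟩, -⟩ := hsub (h t).2
    exact hρ.ratioCoord_mem.2
  constructor
  · rintro ⟨h0, h1⟩
    simp only [hu]
    constructor
    · have := (tendsto_const_nhds (x := (2 : ℝ))).div (h0.add_const 1) (by norm_num)
      have := (tendsto_const_nhds (x := (1 : ℝ))).sub this
      norm_num at this
      exact this
    · have := (tendsto_const_nhds (x := (2 : ℝ))).div_atTop (tendsto_atTop_add_const_right _ 1 h1)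
      have := (tendsto_const_nhds (x := (1 : ℝ))).sub this
      rwa [sub_zero] at this
  · rintro ⟨h0, h1⟩
    simp only [ha]
    constructor
    · have := (h0.const_add 1).mul ((h0.const_sub 1).inv₀ (by norm_num))
      norm_num at this
      exact this
    · have h2 : Tendsto (fun t => 1 - ratioCoord (h t)) atTop (𝓝[>] 0) := by
        refine tendsto_nhdsWithin_iff.2 ⟨?_, Eventually.of_forall fun t => sub_pos.2 (hlt t)⟩
        simpa using h1.const_sub 1
      exact (h1.const_add 1).pos_mul_atTop (by norm_num) (tendsto_inv_nhdsGT_zero.comp h2)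

namespace IsGenericPolygon

variable (hγ : IsGenericPolygon γ)
include hγ

lemma isComponent_iff {A : Set (Fin 4 → ℂ)} :
    IsComponent γ A ↔ ∃ d, A = hγ.arcSystem.walkCarrier d := by
  have := hγ.finite_piece
  constructor
  · rintro ⟨R, hR, rfl⟩
    exact hγ.arcSystem.exists_walkCarrier_eq hR
  · rintro ⟨d, rfl⟩
    obtain ⟨R, hR⟩ : (hγ.arcSystem.walkCarrier d).Nonempty := by
      obtain ⟨R, hR⟩ := hγ.arcSystem.carrier_nonempty (hγ.arcSystem.walk d 0).1
      exact ⟨R, mem_iUnion.2 ⟨0, hR⟩⟩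
    exact ⟨R, hγ.arcSystem.walkCarrier_subset d hR, (hγ.arcSystem.connectedComponentIn_eq hR).symm⟩

lemma finite_components : {A | IsComponent γ A}.Finite := by
  have := hγ.finite_piece
  refine (finite_range hγ.arcSystem.walkCarrier).subset fun A hA => ?_
  obtain ⟨d, rfl⟩ := hγ.isComponent_iff.1 hA
  exact ⟨d, rfl⟩

lemma isComponent_relabel_one {A : Set (Fin 4 → ℂ)} (hA : IsComponent γ A) :
    IsComponent γ (relabel 1 '' A) := by
  obtain ⟨d, rfl⟩ := hγ.isComponent_iff.1 hA
  exact hγ.isComponent_iff.2 ⟨_, hγ.symmetry.image_walkCarrier d⟩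

omit hγ in
lemma zeros_relabel_one {A : Set (Fin 4 → ℂ)} (hA : A ⊆ inscribed γ) :
    {R ∈ relabel 1 '' A | ratioCoord R = 0}.ncard = {R ∈ A | ratioCoord R = 0}.ncard := by
  rw [← ncard_image_of_injective {R ∈ A | ratioCoord R = 0} (relabel_injective 1)]
  congr 1
  ext R
  constructor
  · rintro ⟨⟨R', h, rfl⟩, h0⟩
    rw [ratioCoord_relabel (hA h), neg_eq_zero] at h0
    exact ⟨R', ⟨h, h0⟩, rfl⟩
  · rintro ⟨R', ⟨h, h0⟩, rfl⟩
    exact ⟨⟨R', h, rfl⟩, by rw [ratioCoord_relabel (hA h), h0, neg_zero]⟩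

omit hγ in
lemma _root_.InscribedRect.IsComponent.subset {A : Set (Fin 4 → ℂ)} (hA : IsComponent γ A) : A ⊆ inscribed γ := by
  obtain ⟨R, -, rfl⟩ := hA
  exact connectedComponentIn_subset _ _

lemma relabel_component (j : Fin 4) {A : Set (Fin 4 → ℂ)} (hA : IsComponent γ A) :
    IsComponent γ (relabel j '' A) ∧
      {R ∈ relabel j '' A | ratioCoord R = 0}.ncard = {R ∈ A | ratioCoord R = 0}.ncard := by
  induction j using Fin.induction with
  | zero => rw [relabel_image_zero]; exact ⟨hA, rfl⟩
  | succ i ih =>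
    rw [fin_four_succ, ← relabel_image_image]
    exact ⟨hγ.isComponent_relabel_one ih.1, (zeros_relabel_one ih.1.subset).trans ih.2⟩

lemma finite_squares : {R ∈ inscribed γ | ratioCoord R = 0}.Finite := by
  have := hγ.finite_piece
  refine (finite_range fun p => hγ.arcSystem.arc p 0).subset ?_
  rintro R ⟨hR, h0⟩
  obtain ⟨p, -, hp⟩ := hγ.arcSystem.exists_arc R hR
  exact ⟨p, by rw [← h0]; exact hp⟩

omit hγ in
lemma _root_.InscribedRect.connectedComponentIn_eq_iff {A : Set (Fin 4 → ℂ)} (hA : IsComponent γ A)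
    {R : Fin 4 → ℂ} (hR : R ∈ inscribed γ) : connectedComponentIn (inscribed γ) R = A ↔ R ∈ A := by
  constructor
  · rintro rfl; exact mem_connectedComponentIn hR
  · obtain ⟨R', -, rfl⟩ := hA
    intro h
    exact (connectedComponentIn_eq h).symm

/-- The number of labeled squares on the components of an orbit. -/
lemma ncard_squares_orbit {A : Set (Fin 4 → ℂ)} (hA : IsComponent γ A) :
    {R ∈ {R ∈ inscribed γ | ratioCoord R = 0} |
      componentOrbit (connectedComponentIn (inscribed γ) R) = componentOrbit A}.ncard =
    (componentOrbit A).ncard * {R ∈ A | ratioCoord R = 0}.ncard := by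
  classical
  have hfin := hγ.finite_squares.sep fun R =>
    componentOrbit (connectedComponentIn (inscribed γ) R) = componentOrbit A
  have ho : (componentOrbit A).Finite := finite_range _
  rw [ncard_eq_toFinset_card _ hfin, ncard_eq_toFinset_card _ ho,
    Finset.card_eq_sum_card_fiberwise (f := connectedComponentIn (inscribed γ))
      (t := ho.toFinset), ← smul_eq_mul]
  · apply Finset.sum_eq_card_nsmul
    intro B hB
    obtain ⟨j, rfl⟩ := (Finite.mem_toFinset _).1 hB
    rw [← (hγ.relabel_component j hA).2, ← ncard_coe_finset]
    congr 1
    ext R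
    simp only [Finset.coe_filter, Finite.mem_toFinset, mem_ofPred_eq]
    have hj := (hγ.relabel_component j hA).1
    constructor
    · rintro ⟨⟨⟨hR, h0⟩, -⟩, hc⟩
      exact ⟨(connectedComponentIn_eq_iff hj hR).1 hc, h0⟩
    · rintro ⟨hR, h0⟩
      have hc := (connectedComponentIn_eq_iff hj (hj.subset hR)).2 hR
      exact ⟨⟨⟨hj.subset hR, h0⟩, by rw [hc, componentOrbit_relabel]⟩, hc⟩
  · intro R hR
    simp only [Finite.coe_toFinset, mem_ofPred_eq] at hR ⊢
    have := mem_componentOrbit_self (connectedComponentIn (inscribed γ) R)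
    rwa [hR.2] at this

omit hγ in
lemma _root_.InscribedRect.componentOrbit_eq_singleton {A : Set (Fin 4 → ℂ)} (h : relabel 1 '' A = A) :
    (∀ j, relabel j '' A = A) ∧ componentOrbit A = {A} := by
  have hall : ∀ j, relabel j '' A = A := by
    intro j
    induction j using Fin.induction with
    | zero => exact relabel_image_zero A
    | succ i ih =>
      rw [fin_four_succ, ← relabel_image_image, ih, h]
  refine ⟨hall, ?_⟩
  simp only [componentOrbit, hall, range_const]

omit hγ in
lemma _root_.InscribedRect.ncard_componentOrbit_two {A : Set (Fin 4 → ℂ)} (h1 : relabel 1 '' A ≠ A)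
    (h2 : relabel 2 '' A = A) : (componentOrbit A).ncard = 2 := by
  have h3 : relabel 3 '' A = relabel 1 '' A := by
    rw [← h2, relabel_image_image, relabel_image_image]
    have : (3 : Fin 4) + 2 = 1 := rfl
    rw [this, show (1 : Fin 4) + 2 = 1 + 2 from rfl, ← relabel_image_image, h2]
  have : componentOrbit A = {A, relabel 1 '' A} := by
    ext B
    simp only [componentOrbit, mem_range, mem_insert_iff, mem_singleton_iff]
    rw [Fin.exists_fin_succ, Fin.exists_fin_succ, Fin.exists_fin_succ, Fin.exists_fin_one]
    change (relabel 0 '' A = B ∨ relabel 1 '' A = B ∨ relabel 2 '' A = B ∨ relabel 3 '' A = B) ↔ _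
    rw [h2, h3, relabel_image_zero, eq_comm, eq_comm (b := B)]
    tauto
  rw [this, ncard_pair h1.symm]

omit hγ in
lemma _root_.InscribedRect.ncard_componentOrbit_four {A : Set (Fin 4 → ℂ)}
    (h2 : relabel 2 '' A ≠ A) : (componentOrbit A).ncard = 4 := by
  have hself : ∀ j, relabel j '' A = A → j = 0 := by
    intro j h
    have hjj : relabel (j + j) '' A = A := by rw [← relabel_image_image, h, h]
    fin_cases j
    · rfl
    · exact absurd hjj h2
    · exact absurd h h2
    · exact absurd hjj h2
  have hinj : Function.Injective fun j => relabel j '' A := by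
    intro i j h
    have := congrArg (fun B => relabel (-j) '' B) h
    simp only [relabel_image_image, neg_add_cancel, relabel_image_zero] at this
    have := hself _ this
    rwa [neg_add_eq_zero, eq_comm] at this
  rw [componentOrbit, ← image_univ, ncard_image_of_injective _ hinj, ncard_univ, Nat.card_fin]

open Classical in
/-- The number of labeled squares on the components of an orbit modulo `8`. -/
lemma orbit_count {c : Set (Set (Fin 4 → ℂ))} (hc : c ∈ componentOrbit '' {A | IsComponent γ A}) :
    {R ∈ {R ∈ inscribed γ | ratioCoord R = 0} |
      componentOrbit (connectedComponentIn (inscribed γ) R) = c}.ncard ≡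
    4 * ((if c ∈ unlabeledHyperbolic γ then 1 else 0) + if c ∈ unlabeledElliptic γ then 1 else 0)
      [MOD 8] := by
  have := hγ.finite_piece
  -- An elliptic orbit has a single member, so the property does not depend on the representative.
  have hell : ∀ A, componentOrbit A = c → (c ∈ unlabeledElliptic γ ↔ IsElliptic γ A) := by
    intro A hAc
    constructor
    · rintro ⟨B, hB, hBc⟩
      have hB1 := (componentOrbit_eq_singleton (hB.2 1)).2
      have hAB : A ∈ componentOrbit B := by rw [hBc, ← hAc]; exact mem_componentOrbit_self A
      rw [hB1, mem_singleton_iff] at hAB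
      rwa [hAB]
    · exact fun h => ⟨A, h, hAc⟩
  -- A hyperbolic representative is chosen whenever there is one, which avoids proving that
  -- relabeling preserves hyperbolicity.
  obtain ⟨A, hA, hAc, hhyp⟩ : ∃ A, IsComponent γ A ∧ componentOrbit A = c ∧
      (c ∈ unlabeledHyperbolic γ ↔ IsHyperbolic γ A) := by
    by_cases h : c ∈ unlabeledHyperbolic γ
    · obtain ⟨A, hA, hAc⟩ := h
      exact ⟨A, hA.1, hAc, fun _ => hA, fun _ => ⟨A, hA, hAc⟩⟩
    · obtain ⟨A, hA, hAc⟩ := hc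
      exact ⟨A, hA, hAc, fun h' => absurd h' h, fun h' => absurd ⟨A, h', hAc⟩ h⟩
  rw [hell A hAc, hhyp, ← hAc, hγ.ncard_squares_orbit hA]
  have hcount : (ArcSystem.IsCrossingArc ratioCoord A →
      Odd {R ∈ A | ratioCoord R = 0}.ncard ∧ relabel 1 '' A ≠ A ∧
        relabel 1 '' (relabel 1 '' A) ≠ A) ∧
      (¬ ArcSystem.IsCrossingArc ratioCoord A → Even {R ∈ A | ratioCoord R = 0}.ncard) ∧
      (relabel 1 '' A = A → {R ∈ A | ratioCoord R = 0}.ncard ≡ 4 [MOD 8]) ∧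
      (relabel 1 '' (relabel 1 '' A) = A → 4 ∣ {R ∈ A | ratioCoord R = 0}.ncard) := by
    obtain ⟨R, hR, hAR⟩ := hA
    exact hγ.symmetry.component_zeros hR hAR
  rw [relabel_image_image, show (1 : Fin 4) + 1 = 2 from rfl] at hcount
  obtain ⟨c1, c2, c3, c4⟩ := hcount
  have hHiff : IsHyperbolic γ A ↔ ArcSystem.IsCrossingArc ratioCoord A := by
    rw [isHyperbolic_iff, and_iff_right hA]
  by_cases h1 : relabel 1 '' A = A
  · obtain ⟨hall, hsing⟩ := componentOrbit_eq_singleton h1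
    rw [if_neg (fun h => (c1 (hHiff.1 h)).2.1 h1), if_pos ⟨hA, hall⟩, hsing, ncard_singleton, one_mul]
    exact c3 h1
  rw [if_neg (c := IsElliptic γ A) fun h => h1 (h.2 1)]
  by_cases h2 : relabel 2 '' A = A
  -- Two components with a multiple of four squares each contribute `0` modulo `8`.
  · rw [if_neg (fun h => (c1 (hHiff.1 h)).2.2 h2), ncard_componentOrbit_two h1 h2]
    obtain ⟨m, hm⟩ := c4 h2
    rw [hm, Nat.ModEq]; omega
  rw [ncard_componentOrbit_four h2]
  -- Four components contribute `4` modulo `8` if each has an odd number of squares, and `0` if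
  -- even.
  by_cases hH : IsHyperbolic γ A
  · obtain ⟨m, hm⟩ := (c1 (hHiff.1 hH)).1
    rw [if_pos hH, hm, Nat.ModEq]; omega
  · obtain ⟨m, hm⟩ := c2 (fun h => hH (hHiff.2 h))
    rw [if_neg hH, hm, Nat.ModEq]; omega

end IsGenericPolygon

lemma setOf_squares_eq : {R | R ∈ inscribed γ ∧ aspectRatio R = 1} =
    {R ∈ inscribed γ | ratioCoord R = 0} := by
  ext R
  exact and_congr_right fun h => (ratioCoord_eq_zero_iff h).symm

/-- Every unlabeled square corresponds to four labeled squares. -/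
lemma ncard_squares (hγ : IsGenericPolygon γ) :
    {R ∈ inscribed γ | ratioCoord R = 0}.ncard = 4 * (unlabeledSquares γ).ncard := by
  classical
  have hfin := hγ.finite_squares
  have himg := hfin.image rectangleOrbit
  rw [unlabeledSquares, setOf_squares_eq, ncard_eq_toFinset_card _ hfin,
    ncard_eq_toFinset_card _ himg, mul_comm, ← smul_eq_mul,
    Finset.card_eq_sum_card_fiberwise (f := rectangleOrbit) (t := himg.toFinset)]
  · apply Finset.sum_eq_card_nsmul
    intro o ho
    obtain ⟨R, ⟨hR, h0⟩, rfl⟩ := (Finite.mem_toFinset _).1 ho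
    refine Eq.trans ?_ (card_rectangleOrbit_fiber hR)
    rw [← ncard_coe_finset]
    congr 1
    ext R'
    simp only [Finset.coe_filter, Finite.mem_toFinset, mem_ofPred_eq, and_iff_right_iff_imp]
    intro h
    have h1 : R' ∈ rectangleOrbit R' := ⟨0, relabel_zero R'⟩
    rw [h] at h1
    obtain ⟨j, rfl⟩ := h1
    clear h
    show relabel j R ∈ inscribed γ ∧ ratioCoord (relabel j R) = 0
    induction j using Fin.induction with
    | zero => rw [relabel_zero]; exact ⟨hR, h0⟩
    | succ i ih =>
      rw [fin_four_succ, ← relabel_relabel]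
      exact ⟨relabel_mem_inscribed ih.1, by rw [ratioCoord_relabel ih.1, ih.2, neg_zero]⟩
  · intro R hR
    simp only [Finite.coe_toFinset] at hR ⊢
    exact ⟨R, hR, rfl⟩

end InscribedRect

/-! ### The parity theorem. -/

theorem mainTheorem8 {N : ℕ} (hN : 3 ≤ N) (γ : Polygon ℂ N)
    (hγ : InscribedRect.IsGenericPolygon γ) :
    (InscribedRect.unlabeledSquares γ).Finite ∧
    (InscribedRect.unlabeledHyperbolic γ).Finite ∧
    (InscribedRect.unlabeledElliptic γ).Finite ∧
    (InscribedRect.unlabeledSquares γ).ncard + (InscribedRect.unlabeledHyperbolic γ).ncard +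
      (InscribedRect.unlabeledElliptic γ).ncard ≡ 0 [MOD 2] := by
  classical
  open InscribedRect in
  have hC := hγ.finite_components.image componentOrbit
  have hsubH : unlabeledHyperbolic γ ⊆ componentOrbit '' {A | IsComponent γ A} :=
    Set.image_mono fun A hA => hA.1
  have hsubE : unlabeledElliptic γ ⊆ componentOrbit '' {A | IsComponent γ A} :=
    Set.image_mono fun A hA => hA.1
  have hS : (unlabeledSquares γ).Finite := by
    rw [unlabeledSquares, setOf_squares_eq]
    exact hγ.finite_squares.image _
  refine ⟨hS, hC.subset hsubH, hC.subset hsubE, ?_⟩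
  have hcard : ∀ U : Set (Set (Set (Fin 4 → ℂ))), U ⊆ componentOrbit '' {A | IsComponent γ A} →
      U.ncard = ∑ c ∈ hC.toFinset, if c ∈ U then 1 else 0 := by
    intro U hU
    rw [← Finset.card_filter, ← Set.ncard_coe_finset]
    congr 1
    ext c
    simp only [Finset.coe_filter, Set.Finite.mem_toFinset, Set.mem_ofPred_eq]
    exact ⟨fun h => ⟨hU h, h⟩, fun h => h.2⟩
  have hsum : {R ∈ inscribed γ | ratioCoord R = 0}.ncard = ∑ c ∈ hC.toFinset,
      {R ∈ {R ∈ inscribed γ | ratioCoord R = 0} |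
        componentOrbit (connectedComponentIn (inscribed γ) R) = c}.ncard := by
    rw [Set.ncard_eq_toFinset_card _ hγ.finite_squares, Finset.card_eq_sum_card_fiberwise
      (f := fun R => componentOrbit (connectedComponentIn (inscribed γ) R)) (t := hC.toFinset)]
    · refine Finset.sum_congr rfl fun c _ => ?_
      rw [← Set.ncard_coe_finset]
      congr 1
      ext R
      simp
    · intro R hR
      simp only [Set.Finite.coe_toFinset] at hR ⊢
      exact ⟨_, ⟨R, hR.1, rfl⟩, rfl⟩
  -- The left side is four times the number of unlabeled squares, so the congruence modulo `8`
  -- becomes the claimed one modulo `2`.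
  have hmod : {R ∈ inscribed γ | ratioCoord R = 0}.ncard ≡
      4 * ((unlabeledHyperbolic γ).ncard + (unlabeledElliptic γ).ncard) [MOD 8] := by
    rw [hsum, hcard _ hsubH, hcard _ hsubE, ← Finset.sum_add_distrib, Finset.mul_sum]
    exact Nat.ModEq.sum fun c hc => hγ.orbit_count ((Set.Finite.mem_toFinset _).1 hc)
  rw [ncard_squares hγ, Nat.ModEq] at hmod
  rw [Nat.ModEq]
  omega
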